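/- **Setting.** Let $K\subset\mathbb R^D$ be a connected post-critically finite self-similar set generated by contracting similitudes $F_1,\dots,F_m$ satisfying the open set condition, with normalised Hausdorff measure, boundary $V_0$ and a self-similar Dirichlet form $\mathcal E(u,v)=\lim_n\mathcal E_n(u,v)$, where $\mathcal E_{n+1}(u,v)=\kappa\sum_i r_i^{-1}\mathcal E_n(u\circ F_i,v\circ F_i)$ and the $\mathcal E_n$ are compatible. Let $\Delta$ be the associated Laplacian, $\mathcal E(u,v)=-\langle\Delta u,v\rangle_{L^2}$ for all continuous $v$ of finite energy vanishing on $B$, with vanishing boundary values imposed on a set $B\subseteq V_0$ ($B=\emptyset$: Neumann, $B=V_0$: Dirichlet conditions). Let $-\lambda_k$ be its eigenvalues, and let $\zeta_\Delta(s)=\sum_{\lambda_k\ne0}\lambda_k^{-s}$, counted with multiplicity. Let $p$ be a real polynomial of degree $d\ge2$ with leading coefficient $a_d$, $p(0)=0$ and $\lambda=p'(0)>1$, whose Julia set lies in $(-\infty,0]$. Put $\rho=\log_\lambda d$ and $\Phi(z)=\lim_{n\to\infty}p^{(n)}(\lambda^{-n}z)$ ($p^{(n)}$ is the $n$-th iterate).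 Assume that $\Delta$ admits spectral decimation with $p$: there are a finite set $A$ and multiplicities $\beta_m(w)\in\mathbb N_0$ ($w\in A$, $m\in\mathbb N_0$) such that every non-zero eigenvalue of $\Delta$ is of the form $\lambda^m\lim_n\lambda^n x_n$ with $p^{(n)}(x_n)=w\in A$, and such that the non-zero eigenvalues of $\Delta$, with multiplicity, are the numbers $\lambda^m z$ with $w\in A$, $m\in\mathbb N_0$, $\Phi(z)=w$, $z\neq0$ ($z$ counted with its multiplicity as a root), each taken $\beta_m(w)$ times; and for each $w\in A$ the generating function $R_w(z)=\sum_m\beta_m(w)z^m$ is a rational function. For real $w\le0$ let $\zeta_{\Phi,w}(s)=\sum_{\Phi(-\mu)=w,\ \mu\ne0}\mu^{-s}$ (roots counted with multiplicity, principal branch) and $$\Psi_w(z)=\frac{p(\Phi(z))-w}{a_d(\Phi(z)-w)^d}.$$ **Result.** 1. The limit $\Phi$ exists and is entire, $\Phi(0)=0$, $\Phi'(0)=1$, $\Phi(\lambda z)=p(\Phi(z))$. Moreover $\rho\le\frac12$, and $\rho<\frac12$ unless $p$ is conjugate by an affine map to the Chebyshev polynomial $T_d$. Every $w\in A$ with $R_w\ne0$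 is real and $\le0$. 2. For every real $w\le0$ the series $\zeta_{\Phi,w}(s)$ converges absolutely for $\operatorname{Re}s>\rho$ and has a meromorphic continuation to $\mathbb C$. It is holomorphic except for at most simple poles at $s_k=\log_\lambda d+\frac{2k\pi i}{\log\lambda}$, $k\in\mathbb Z$, and its residues at these points do not depend on $w$. For $\operatorname{Re}s<0$ the following integral converges absolutely and $$\zeta_{\Phi,w}(s)=\frac{s\sin(\pi s)}{\pi(\lambda^{s}-d)}\int_0^\infty\log\Psi_w(x)\,x^{-s-1}\,dx .$$ Further, $\zeta_{\Phi,w}(-m)=0$ for all $m\in\mathbb N_0$ if $w<0$, and for all $m\ge1$ if $w=0$. If $w<0$, then $$\zeta_{\Phi,w}'(0)=-\Bigl(\frac{\log a_d}{d-1}+\log(-w)\Bigr).$$ 3. For all $s$ with $\operatorname{Re}s>\rho$ such that $|\lambda^{-s}|$ is smaller than the modulus of every pole of every $R_w$, $w\in A$, the series $\zeta_\Delta(s)$ converges absolutely and $$\zeta_\Delta(s)=\sum_{w\in A}R_w(\lambda^{-s})\,\zeta_{\Phi,w}(s)$$ (terms with $R_w=0$ are zero). The right-hand side is the meromorphic continuation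 of $\zeta_\Delta$ to $\mathbb C$. It is holomorphic except possibly at the points $s_k$ and at the points $-\log_\lambda c+\frac{2k\pi i}{\log\lambda}$, where $k\in\mathbb Z$ and $c$ is a pole of some $R_w$, $w\in A$. If $1/d$ is not a pole of any $R_w$, then the poles at the $s_k$ are at most simple. 4. For every real $c>\rho$ such that no function $R_w(\lambda^{-s})$, $w\in A$, has a pole on the line $\operatorname{Re}s=c$, the function $\zeta_\Delta$ is bounded on this line. -/

import Mathlib

open Filter Topology MeasureTheory Polynomial

noncomputable section

/-! ### Post-critically finite self-similar sets in `ℝ^D` -/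

/-- A self-similar set `K ⊆ ℝ^D`, i.e. the unique non-empty compact set `K = ⋃ F_i(K)` for `m`
contracting similitudes `F_i(x) = b_i + A_i (x - b_i)` which satisfy the open set condition. The number `dim`
is the positive solution of `∑ α_i ^ dim = 1`. -/
structure SimilitudeSystem (D m : ℕ) where
  b : Fin m → EuclideanSpace ℝ (Fin D)
  A : Fin m → EuclideanSpace ℝ (Fin D) →ₗ[ℝ] EuclideanSpace ℝ (Fin D)
  ratio : Fin m → ℝ
  ratio_pos : ∀ i, 0 < ratio i
  ratio_lt_one : ∀ i, ratio i < 1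
  norm_A : ∀ i x, ‖A i x‖ = ratio i * ‖x‖
  K : Set (EuclideanSpace ℝ (Fin D))
  isCompact_K : IsCompact K
  nonempty_K : K.Nonempty
  selfSimilar_K : K = ⋃ i, (fun x => b i + A i (x - b i)) '' K
  openSetCondition : ∃ O : Set (EuclideanSpace ℝ (Fin D)),
    IsOpen O ∧ O.Nonempty ∧ Bornology.IsBounded O ∧
    (∀ i, (fun x => b i + A i (x - b i)) '' O ⊆ O) ∧
    ∀ i j, i ≠ j → Disjoint ((fun x => b i + A i (x - b i)) '' O)
      ((fun x => b j + A j (x - b j)) '' O)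
  dim : ℝ
  dim_pos : 0 < dim
  sum_ratio_rpow : ∑ i, ratio i ^ dim = 1

namespace SimilitudeSystem

variable {D m : ℕ} (S : SimilitudeSystem D m)

/-- The similitude `F_i`. -/
def map (i : Fin m) (x : EuclideanSpace ℝ (Fin D)) : EuclideanSpace ℝ (Fin D) :=
  S.b i + S.A i (x - S.b i)

/-- The composition `F_{ε 0} ∘ F_{ε 1} ∘ ⋯ ∘ F_{ε (n-1)}`. -/
def wordMap (ε : ℕ → Fin m) : ℕ → EuclideanSpace ℝ (Fin D) → EuclideanSpace ℝ (Fin D)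
  | 0 => id
  | n + 1 => wordMap ε n ∘ S.map (ε n)

/-- The projection `π` from the address space; the limit does not depend on the starting
point, which is taken to be the origin. -/
def address (ε : ℕ → Fin m) : EuclideanSpace ℝ (Fin D) :=
  limUnder atTop fun n : ℕ => S.wordMap ε n 0

/-- The critical set in the address space. -/
def criticalSet : Set (ℕ → Fin m) :=
  {ε | ∃ i j, i ≠ j ∧ S.address ε ∈ S.map i '' S.K ∩ S.map j '' S.K}

/-- The post-critical set: all shifts by at least one place of critical addresses. -/
def postCriticalSet : Set (ℕ → Fin m) :=
  {ε | ∃ n : ℕ, 1 ≤ n ∧ ∃ δ ∈ S.criticalSet, ε = fun k => δ (k + n)}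

/-- The boundary `V₀ = π(P)`. -/
def V₀ : Set (EuclideanSpace ℝ (Fin D)) := S.address '' S.postCriticalSet

/-- The probability vector `(α_i ^ dim)_i`. -/
def weights : PMF (Fin m) :=
  PMF.ofFintype (fun i => ENNReal.ofReal (S.ratio i ^ S.dim)) (by
    rw [← ENNReal.ofReal_sum_of_nonneg fun i _ => Real.rpow_nonneg (S.ratio_pos i).le _,
      S.sum_ratio_rpow, ENNReal.ofReal_one])

/-- The normalised Hausdorff measure on `K`, as the image under `π` of the product measure on
the address space with weights `α_i ^ dim`. -/
def measureK : Measure S.K :=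
  ((Measure.infinitePi fun _ : ℕ => S.weights.toMeasure).map S.address).comap
    (Subtype.val : S.K → EuclideanSpace ℝ (Fin D))

/-- A function on `K`, extended by zero. -/
def extend (u : S.K → ℝ) : EuclideanSpace ℝ (Fin D) → ℝ := Function.extend Subtype.val u 0

end SimilitudeSystem

/-- Connected self-similar sets which are post-critically finite. -/
structure PcfFractal (D m : ℕ) extends SimilitudeSystem D m where
  connected : IsConnected K
  pcf : toSimilitudeSystem.postCriticalSet.Finite

/-- Dirichlet forms on (the functions on) a finite set `V`. -/
structure IsDirichletForm {V : Type*} (E : LinearMap.BilinForm ℝ (V → ℝ)) : Prop where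
  symm : ∀ u v, E u v = E v u
  nonneg : ∀ u, 0 ≤ E u u
  const_of_zero : ∀ u, E u u = 0 → ∃ c, ∀ x, u x = c
  markov : ∀ u : V → ℝ, E (fun x => max 0 (min (u x) 1)) (fun x => max 0 (min (u x) 1)) ≤ E u u

/-- `energyStep E₀ r κ n u v` is `ℰ_n(u|V_n, v|V_n)`, for the forms given by
`ℰ_{n+1}(u, v) = κ ∑ i, r_i⁻¹ ℰ_n(u ∘ F_i, v ∘ F_i)`. -/
def energyStep {D m : ℕ} (S : SimilitudeSystem D m) (E₀ : LinearMap.BilinForm ℝ (S.V₀ → ℝ))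
    (r : Fin m → ℝ) (κ : ℝ) : ℕ → (EuclideanSpace ℝ (Fin D) → ℝ) →
      (EuclideanSpace ℝ (Fin D) → ℝ) → ℝ
  | 0, u, v => E₀ (fun x => u x) (fun x => v x)
  | n + 1, u, v =>
      κ * ∑ i, (r i)⁻¹ * energyStep S E₀ r κ n (fun x => u (S.map i x)) (fun x => v (S.map i x))

/-- A self-similar compatible sequence of Dirichlet forms on a p.c.f. fractal, given by the form
`E₀` on `V₀`, the weights `r_i` and the proportionality factor `κ`. The field `compatible` says
that the restriction of `ℰ_1` to `V₀` (a minimum over all extensions) is `ℰ_0`. -/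
structure HarmonicStructure {D m : ℕ} (F : PcfFractal D m) where
  E₀ : LinearMap.BilinForm ℝ (F.V₀ → ℝ)
  r : Fin m → ℝ
  κ : ℝ
  isDirichletForm : IsDirichletForm E₀
  r_pos : ∀ i, 0 < r i
  κ_pos : 0 < κ
  compatible : ∀ u : F.V₀ → ℝ,
    IsLeast {e : ℝ | ∃ v : EuclideanSpace ℝ (Fin D) → ℝ, (∀ x : F.V₀, v x = u x) ∧
      e = energyStep F.toSimilitudeSystem E₀ r κ 1 v v} (E₀ u u)

namespace HarmonicStructure

variable {D m : ℕ} {F : PcfFractal D m} (H : HarmonicStructure F)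

/-- `ℰ_n(u|V_n, v|V_n)` for functions `u, v` on `K`. -/
def energy (n : ℕ) (u v : F.K → ℝ) : ℝ :=
  energyStep F.toSimilitudeSystem H.E₀ H.r H.κ n (F.extend u) (F.extend v)

/-- The continuous functions on `K` of finite energy which vanish on the part `B` of the boundary:
`B = ∅` gives Neumann, `B = V₀` gives Dirichlet boundary conditions. -/
def domain (B : Set (EuclideanSpace ℝ (Fin D))) : Set C(F.K, ℝ) :=
  {u | BddAbove (Set.range fun n : ℕ => H.energy n u u) ∧ ∀ x : F.K, (x : EuclideanSpace ℝ (Fin D)) ∈ B → u x = 0}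

/-- `Δ u = f`: `ℰ(u, v) = -⟨f, v⟩` for all `v` in the domain, where `ℰ(u, v)` is the limit of
`ℰ_n(u, v)`. -/
def IsLaplacian (B : Set (EuclideanSpace ℝ (Fin D))) (u : C(F.K, ℝ)) (f : F.K → ℝ) : Prop :=
  u ∈ H.domain B ∧ MemLp f 2 F.measureK ∧
    ∀ v ∈ H.domain B,
      Tendsto (fun n : ℕ => H.energy n u v) atTop (𝓝 (-∫ x, f x * v x ∂F.measureK))

/-- The eigenspace of the Laplacian for `c`. (The set of all `u` with `Δ u = c u` is a linear
space, so the span adds nothing.) -/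
def eigenspace (B : Set (EuclideanSpace ℝ (Fin D))) (c : ℝ) : Submodule ℝ C(F.K, ℝ) :=
  Submodule.span ℝ {u | H.IsLaplacian B u fun x => c * u x}

open Classical in
/-- The multiplicity of `z` as an eigenvalue of the Laplacian (`0` if it is not an eigenvalue;
the Laplacian being symmetric, only real numbers are eigenvalues). -/
def eigenMult (B : Set (EuclideanSpace ℝ (Fin D))) (z : ℂ) : ℕ∞ :=
  if z.im = 0 then Cardinal.toENat (Module.rank ℝ (H.eigenspace B z.re)) else 0

/-- The summand of the spectral zeta function which belongs to the eigenvalue `-x` of `Δ`. -/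
def spectralZetaTerm (B : Set (EuclideanSpace ℝ (Fin D))) (s : ℂ) (x : {x : ℝ // x ≠ 0}) : ℂ :=
  ((H.eigenMult B (-((x : ℝ) : ℂ))).toNat : ℂ) * ((x : ℝ) : ℂ) ^ (-s)

/-- The spectral zeta function, the sum of `x ^ (-s)` over the non-zero eigenvalues `-x` of `Δ`,
counted with multiplicity. -/
def spectralZeta (B : Set (EuclideanSpace ℝ (Fin D))) (s : ℂ) : ℂ :=
  ∑' x, H.spectralZetaTerm B s x

end HarmonicStructure

/-! ### Polynomial iteration and the Poincaré function -/

/-- The Julia set of a polynomial: the boundary of the set of points with bounded orbit. -/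
def juliaSet (p : ℝ[X]) : Set ℂ :=
  frontier {z : ℂ | Bornology.IsBounded (Set.range fun n : ℕ => (fun x : ℂ => aeval x p)^[n] z)}

/-- The scaling factor `λ = p'(0)`. -/
def scaling (p : ℝ[X]) : ℝ := p.derivative.eval 0

/-- `ρ = log_λ d`. -/
def rho (p : ℝ[X]) : ℝ := Real.logb (scaling p) p.natDegree

/-- The Poincaré function `Φ(z) = lim p^{(n)}(λ^{-n} z)`. -/
def poincare (p : ℝ[X]) (z : ℂ) : ℂ :=
  limUnder atTop fun n : ℕ => (fun x : ℂ => aeval x p)^[n] (z / (scaling p : ℂ) ^ n)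

/-- The order of `z` as a zero of `Φ - w`. -/
def levelMult (p : ℝ[X]) (w z : ℂ) : ℕ∞ := analyticOrderAt (fun x => poincare p x - w) z

/-- All limits `lim λ^n x_n`, where `x_n` is a preimage of `w` under the `n`-th iterate of `p`. -/
def decimationLimits (p : ℝ[X]) (w : ℂ) : Set ℂ :=
  {z | ∃ x : ℕ → ℂ, (∀ n, (fun y : ℂ => aeval y p)^[n] (x n) = w) ∧
    Tendsto (fun n : ℕ => (scaling p : ℂ) ^ n * x n) atTop (𝓝 z)}

/-- Spectral decimation with the polynomial `p` and the finite set `A`, for an operator for which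
`mult z` is the multiplicity of `z` as an eigenvalue. Every non-zero eigenvalue has the form
`λ^m lim λ^n p^{(-n)}({w})` with `w ∈ A`. The multiplicities only depend on `w` and `m`: the
non-zero eigenvalues with multiplicity are the `λ^m z` with `m ∈ ℕ`, `w ∈ A`, `Φ(z) = w`, each of
them taken `β w m` times (and a multiple root `z` taken as often as its order says). If `z₀`
arises from only one pair `(w, m)` and from a simple root, then its multiplicity is `β w m`. The
generating function of `(β w m)_m` is the rational function `R w`. -/
structure HasSpectralDecimation (mult : ℂ → ℕ∞) (p : ℝ[X]) (A : Finset ℂ) (β : ℂ → ℕ → ℕ)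
    (R : ℂ → RatFunc ℂ) : Prop where
  eigenvalue_form : ∀ z₀ : ℂ, z₀ ≠ 0 → mult z₀ ≠ 0 →
    ∃ w ∈ A, ∃ m : ℕ, ∃ z ∈ decimationLimits p w, z₀ = (scaling p : ℂ) ^ m * z
  multiplicity : ∀ z₀ : ℂ, z₀ ≠ 0 →
    mult z₀ = ∑ w ∈ A, ∑' m : ℕ, (β w m : ℕ∞) * levelMult p w (z₀ / (scaling p : ℂ) ^ m)
  generating : ∀ w ∈ A,
    (PowerSeries.mk fun m => (β w m : ℂ)) * ((R w).denom : PowerSeries ℂ) =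
      ((R w).num : PowerSeries ℂ)

/-- The summand of the partial zeta function which belongs to `μ ≠ 0` with `Φ(-μ) = w`. -/
def partialZetaTerm (p : ℝ[X]) (w s : ℂ) (μ : {μ : ℂ // μ ≠ 0 ∧ poincare p (-μ) = w}) : ℂ :=
  ((levelMult p w (-(μ : ℂ))).toNat : ℂ) * (μ : ℂ) ^ (-s)

/-- The partial zeta function `ζ_{Φ,w}(s)`, the sum of `μ ^ (-s)` over `Φ(-μ) = w`, `μ ≠ 0`
(counted with multiplicity). -/
def partialZeta (p : ℝ[X]) (w s : ℂ) : ℂ := ∑' μ, partialZetaTerm p w s μ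

/-- `Ψ_w(z) = (p(Φ(z)) - w) / (a_d (Φ(z) - w)^d)`. -/
def Psi (p : ℝ[X]) (w z : ℂ) : ℂ :=
  (aeval (poincare p z) p - w) / ((p.leadingCoeff : ℂ) * (poincare p z - w) ^ p.natDegree)

/-- The points `log_λ d + 2kπi / log λ`. -/
def basePole (p : ℝ[X]) (k : ℤ) : ℂ :=
  (rho p : ℂ) + 2 * k * Real.pi * Complex.I / (Real.log (scaling p) : ℂ)

/-- The points `-log_λ c + 2kπi / log λ`. -/
def ratPole (p : ℝ[X]) (c : ℂ) (k : ℤ) : ℂ :=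
  -(Complex.log c / (Real.log (scaling p) : ℂ)) +
    2 * k * Real.pi * Complex.I / (Real.log (scaling p) : ℂ)

/-- `∑_{w ∈ A} R_w(λ^{-s}) Z_w(s)`. -/
def zetaSum (p : ℝ[X]) (A : Finset ℂ) (R : ℂ → RatFunc ℂ) (Z : ℂ → ℂ → ℂ) (s : ℂ) : ℂ :=
  ∑ w ∈ A, (R w).eval (RingHom.id ℂ) ((scaling p : ℂ) ^ (-s)) * Z w s

end

/-! The proof rests on real-rootedness of `p`, on the theory of entire functions of order less than
one, and on a Mellin transform of the functional equation of Φ.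

Geometry of `p`. The filled Julia set is bounded and its frontier misses the connected slit plane,
so it lies in (-∞, 0] (`notMem_slitPlane`). It is backward invariant; hence `p - v` splits over ℝ
for each of its points `v`, the roots of `p` are non-positive, and the coefficients of `p` are
non-negative. If -M is the least point of the filled Julia set, carrying [-M, 0] to [-1, 1] turns
`p` into a polynomial which takes the values ±1 only on [-1, 1]. The Chebyshev polynomials have the
least slope at the fixed point 1 among these (`sq_natDegree_le_derivative_eval_one`), so λ ≥ d²,
which is ρ ≤ 1/2.

The Poincaré function. The polynomials p^(n)(λ^{-n} z) have non-negative coefficients that increase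
with n, so a bound on the positive axis gives locally uniform convergence. The functional equation
shows that Φ has order at most ρ, and that on the positive axis it outgrows every power of x.

Partial zeta functions. Let F be Φ - w, divided by z if w = 0. Its order is below one, so F'/F is
the sum of m(μ)/(z + μ) over the zeros -μ (`hasSum_zeroMult_div`). Since 1/(x + μ) has the Mellin
transform π/sin(πs) · μ^(s-1), the transform of L = F'/F at 1 - s is π/sin(πs) · ζ_{Φ,w}(s) for ρ <
Re s < 1 (`mellin_logDeriv`). The combination λL(λx) - dL(x) multiplies this by λ^s - d. It is also
the derivative of log Ψ_w, apart from a term (d-1)/x when w = 0, and log Ψ_w decays faster than any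
power because Ψ_w - 1 = O(1/Φ). Its transform therefore continues to Re s < 1, and division by λ^s -
d continues the zeta function: poles only at the s_k, zeros from the sine, and the integral formula
after an integration by parts. The residues do not depend on w, because the difference of two
logarithmic derivatives has a transform that is finite at 1 - s_k, where the factor λ^s - d
vanishes.

The spectrum. The energy is non-negative and the measure has full support, so eigenvalues are
non-positive (`nonpos_of_isLaplacian`). Every w with some β_m(w) ≠ 0 is then real and non-positive,
and its μ are positive. For positive μ the power (λ^m μ)^(-s) splits, so the sum over the spectrum
factors into R_w(λ^{-s}) ζ_{Φ,w}(s) inside the first pole of R_w (`hasSum_level`). Continuation,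
pole order and boundedness pass to the finite sum over A. -/

open Filter Topology MeasureTheory Polynomial

noncomputable section

/-! ### The filled Julia set and real-rootedness of `p`. -/

/-- The polynomials which occur in spectral decimation. -/
structure IsDecimationPolynomial (p : ℝ[X]) : Prop where
  two_le : 2 ≤ p.natDegree
  eval_zero : p.eval 0 = 0
  one_lt_scaling : 1 < scaling p
  julia_nonpos : ∀ z ∈ juliaSet p, z.im = 0 ∧ z.re ≤ 0

/-- The action of a real polynomial on `ℂ`. -/
def cmap (p : ℝ[X]) (z : ℂ) : ℂ := aeval z p

/-- The filled Julia set. -/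
def filledJulia (p : ℝ[X]) : Set ℂ :=
  {z : ℂ | Bornology.IsBounded (Set.range fun n : ℕ => (cmap p)^[n] z)}

theorem mem_filledJulia {p : ℝ[X]} {z : ℂ} : z ∈ filledJulia p ↔
    Bornology.IsBounded (Set.range fun n : ℕ => (cmap p)^[n] z) := Iff.rfl

theorem cmap_ofReal (p : ℝ[X]) (x : ℝ) : cmap p x = (p.eval x : ℝ) := by
  exact aeval_algebraMap_apply_eq_algebraMap_eval x p

theorem continuous_cmap (p : ℝ[X]) : Continuous (cmap p) := p.continuous_aeval

theorem cmap_mem_filledJulia_iff (p : ℝ[X]) (z : ℂ) :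
    cmap p z ∈ filledJulia p ↔ z ∈ filledJulia p := by
  have h : (Set.range fun n : ℕ => (cmap p)^[n] z) =
      insert z (Set.range fun n : ℕ => (cmap p)^[n] (cmap p z)) := by
    ext y
    simp only [Set.mem_range, Set.mem_insert_iff]
    constructor
    · rintro ⟨n, rfl⟩
      cases n with
      | zero => exact Or.inl rfl
      | succ n => exact Or.inr ⟨n, rfl⟩
    · rintro (rfl | ⟨n, rfl⟩)
      · exact ⟨0, rfl⟩
      · exact ⟨n + 1, rfl⟩
  rw [mem_filledJulia, mem_filledJulia, h, Bornology.isBounded_insert]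

namespace IsDecimationPolynomial

variable {p : ℝ[X]} (hp : IsDecimationPolynomial p)
include hp

theorem ne_zero : p ≠ 0 := by
  rintro rfl
  simpa using hp.two_le

theorem cmap_zero : cmap p 0 = 0 := by
  have := cmap_ofReal p 0
  simpa [hp.eval_zero] using this

theorem zero_mem_filledJulia : (0 : ℂ) ∈ filledJulia p := by
  have h : ∀ n : ℕ, (cmap p)^[n] 0 = 0 := fun n => Function.iterate_fixed hp.cmap_zero n
  simp [filledJulia, h]

/-- Since `p = X * p.divX` with `p.divX` non-constant, the ratio of the two norms is the modulus of
`p.divX`, which tends to infinity. -/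
theorem exists_escape_radius : ∃ r : ℝ, 0 < r ∧ ∀ z : ℂ, r ≤ ‖z‖ → 2 * ‖z‖ ≤ ‖cmap p z‖ := by
  have hX : p = X * p.divX := by
    have h := p.X_mul_divX_add
    rw [coeff_zero_eq_eval_zero, hp.eval_zero, C_0, add_zero] at h
    exact h.symm
  have hd : 0 < p.divX.degree := by
    rw [← natDegree_pos_iff_degree_pos, natDegree_divX_eq_natDegree_tsub_one]
    have := hp.two_le
    omega
  have h := tendsto_abv_aeval_atTop (A := ℂ) norm p.divX hd
    (by
      have : p.divX ≠ 0 := by rintro h; simp [h] at hd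
      simpa using this) (l := comap norm atTop) (z := id) tendsto_comap
  have h2 := h.eventually_ge_atTop 2
  rw [eventually_comap] at h2
  obtain ⟨r, hr⟩ := eventually_atTop.1 h2
  refine ⟨max r 1, by positivity, fun z hz => ?_⟩
  have := hr ‖z‖ (le_trans (le_max_left _ _) hz) z rfl
  rw [cmap, hX, map_mul, aeval_X, norm_mul, mul_comm]
  exact mul_le_mul_of_nonneg_left this (norm_nonneg _)

/-- An orbit that leaves the disc of the escape radius doubles at every further step. One uniform
bound for all bounded orbits exhibits the set as an intersection of closed sets. -/
theorem exists_filledJulia_eq : ∃ r : ℝ, 0 < r ∧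
    filledJulia p = {z | ∀ n : ℕ, ‖(cmap p)^[n] z‖ ≤ r} := by
  obtain ⟨r, hr, h⟩ := hp.exists_escape_radius
  refine ⟨r, hr, Set.ext fun z => ⟨fun hz n => ?_, fun hz => ?_⟩⟩
  · by_contra! hn
    have hk : ∀ k : ℕ, 2 ^ k * r < ‖(cmap p)^[k + n] z‖ := by
      intro k
      induction k with
      | zero => simpa using hn
      | succ k ih =>
        have h1 : r ≤ ‖(cmap p)^[k + n] z‖ := by
          refine le_trans ?_ ih.le
          exact le_mul_of_one_le_left hr.le (one_le_pow₀ (by norm_num))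
        have h2 := h _ h1
        rw [← Function.iterate_succ_apply' (cmap p), Nat.succ_eq_add_one] at h2
        rw [show k + 1 + n = k + n + 1 by ring, pow_succ]
        linarith
    obtain ⟨b, hb⟩ := isBounded_iff_forall_norm_le.1 (mem_filledJulia.1 hz)
    obtain ⟨k, hk2⟩ := pow_unbounded_of_one_lt (b / r) (one_lt_two : (1 : ℝ) < 2)
    rw [div_lt_iff₀ hr] at hk2
    have := hb _ (Set.mem_range_self (k + n))
    linarith [hk k]
  · refine mem_filledJulia.2 (isBounded_iff_forall_norm_le.2 ⟨r, ?_⟩)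
    rintro _ ⟨n, rfl⟩
    exact hz n

theorem isClosed_filledJulia : IsClosed (filledJulia p) := by
  obtain ⟨r, -, h⟩ := hp.exists_filledJulia_eq
  rw [h, Set.ofPred_forall]
  exact isClosed_iInter fun n =>
    isClosed_le ((continuous_cmap p).iterate n).norm continuous_const

theorem isBounded_filledJulia : Bornology.IsBounded (filledJulia p) := by
  obtain ⟨r, -, h⟩ := hp.exists_filledJulia_eq
  exact isBounded_iff_forall_norm_le.2 ⟨r, fun z hz => by rw [h] at hz; exact hz 0⟩

/-- The slit plane is connected and misses the frontier, so it is contained in the interior of the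
filled Julia set as soon as it meets the set. Boundedness excludes this. -/
theorem notMem_slitPlane {z : ℂ} (hz : z ∈ filledJulia p) : z ∉ Complex.slitPlane := by
  intro hs
  have hpre : IsPreconnected Complex.slitPlane :=
    (Complex.starConvex_one_slitPlane.isPathConnected Complex.one_mem_slitPlane).isConnected.isPreconnected
  have hfr : ∀ y ∈ Complex.slitPlane, y ∉ frontier (filledJulia p) := by
    intro y hy hf
    have := hp.julia_nonpos y hf
    rcases hy with h | h
    · linarith [this.2]
    · exact h this.1
  have hsub : Complex.slitPlane ⊆ interior (filledJulia p) ∪ (filledJulia p)ᶜ := by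
    intro y hy
    by_cases h : y ∈ filledJulia p
    · left
      by_contra hi
      exact hfr y hy ⟨subset_closure h, hi⟩
    · exact Or.inr h
  have hall := hpre.subset_left_of_subset_union isOpen_interior
    hp.isClosed_filledJulia.isOpen_compl
    (Set.disjoint_left.2 fun x hx hxc => hxc (interior_subset hx)) hsub
    ⟨z, hs, by
      rcases hsub hs with h | h
      · exact h
      · exact absurd hz h⟩
  obtain ⟨b, hb⟩ := isBounded_iff_forall_norm_le.1 hp.isBounded_filledJulia
  have h1 : ((|b| + 1 : ℝ) : ℂ) ∈ Complex.slitPlane := by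
    rw [Complex.ofReal_mem_slitPlane]; positivity
  have h2 := hb _ (interior_subset (hall h1))
  rw [Complex.norm_real, Real.norm_eq_abs, abs_of_pos (by positivity)] at h2
  linarith [le_abs_self b]

theorem exists_ofReal {z : ℂ} (hz : z ∈ filledJulia p) : ∃ x : ℝ, x ≤ 0 ∧ z = x := by
  have h := hp.notMem_slitPlane hz
  rw [Complex.mem_slitPlane_iff, not_or, not_lt, not_not] at h
  exact ⟨z.re, h.1, Complex.ext (by simp) (by simp [h.2])⟩

theorem ofReal_nonpos {x : ℝ} (hx : (x : ℂ) ∈ filledJulia p) : x ≤ 0 := by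
  obtain ⟨y, hy, h⟩ := hp.exists_ofReal hx
  rwa [Complex.ofReal_inj.1 h]

omit hp in
theorem root_mem_filledJulia {v x : ℝ} (hv : (v : ℂ) ∈ filledJulia p) (hx : p.eval x = v) :
    (x : ℂ) ∈ filledJulia p := by
  rw [← cmap_mem_filledJulia_iff, cmap_ofReal, hx]
  exact hv

/-- Every complex root of `p - v` is a preimage of a point of the filled Julia set, so it belongs to
the set and is real. -/
theorem splits_sub_C {v : ℝ} (hv : (v : ℂ) ∈ filledJulia p) : (p - C v).Splits := by
  refine Splits.of_splits_map (algebraMap ℝ ℂ) (IsAlgClosed.splits _) fun a ha => ?_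
  have h := isRoot_of_mem_roots ha
  rw [IsRoot, eval_map_algebraMap, map_sub, aeval_C] at h
  have h2 : cmap p a ∈ filledJulia p := by
    rw [cmap, sub_eq_zero.1 h]; exact hv
  obtain ⟨x, -, rfl⟩ := hp.exists_ofReal ((cmap_mem_filledJulia_iff p a).1 h2)
  exact ⟨x, rfl⟩

theorem splits : p.Splits := by
  have := hp.splits_sub_C (v := 0) (by simpa using hp.zero_mem_filledJulia)
  simpa using this

theorem roots_nonpos {r : ℝ} (hr : r ∈ p.roots) : r ≤ 0 := by
  have h := isRoot_of_mem_roots hr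
  exact hp.ofReal_nonpos (root_mem_filledJulia (v := 0)
    (by simpa using hp.zero_mem_filledJulia) h)

theorem scaling_pos : 0 < scaling p := one_pos.trans hp.one_lt_scaling

/-- The positive number p'(0) is the leading coefficient times the product of -r over the remaining
roots r, and these factors are non-negative. -/
theorem leadingCoeff_pos : 0 < p.leadingCoeff := by
  have h0 : (0 : ℝ) ∈ p.roots := (mem_roots hp.ne_zero).2 hp.eval_zero
  have h := hp.splits.eq_prod_roots
  have h1 : scaling p = p.leadingCoeff * ((p.roots.erase 0).map (fun r => 0 - r)).prod := by
    rw [scaling]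
    conv_lhs => rw [h]
    rw [derivative_C_mul, eval_C_mul, eval_multiset_prod_X_sub_C_derivative h0]
  have h2 : 0 ≤ ((p.roots.erase 0).map (fun r => 0 - r)).prod := by
    refine Multiset.prod_nonneg fun a ha => ?_
    obtain ⟨r, hr, rfl⟩ := Multiset.mem_map.1 ha
    have := hp.roots_nonpos (Multiset.mem_of_mem_erase hr)
    linarith
  have h3 := hp.scaling_pos
  rw [h1] at h3
  exact pos_of_mul_pos_left h3 h2

/-- All linear factors `X - C r` have r ≤ 0. The monotonicity and majorant arguments for Φ depend on
this. -/
theorem coeff_nonneg (k : ℕ) : 0 ≤ p.coeff k := by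
  have key : ∀ s : Multiset ℝ, (∀ r ∈ s, r ≤ 0) →
      ∀ k, 0 ≤ ((s.map fun r => X - C r).prod).coeff k := by
    intro s
    induction s using Multiset.induction with
    | empty => intro _ k; simp only [Multiset.map_zero, Multiset.prod_zero, coeff_one]; positivity
    | cons a s ih =>
      intro hs k
      have ha := hs a (Multiset.mem_cons_self _ _)
      have ih' := ih fun r hr => hs r (Multiset.mem_cons_of_mem hr)
      rw [Multiset.map_cons, Multiset.prod_cons, sub_mul, coeff_sub, coeff_C_mul]
      have h2 : 0 ≤ (X * (s.map fun r => X - C r).prod).coeff k := by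
        cases k with
        | zero => simp
        | succ k => rw [coeff_X_mul]; exact ih' k
      nlinarith [ih' k]
  rw [hp.splits.eq_prod_roots, coeff_C_mul]
  exact mul_nonneg hp.leadingCoeff_pos.le (key _ (fun r hr => hp.roots_nonpos hr) k)

omit hp in
theorem scaling_eq_coeff : scaling p = p.coeff 1 := by
  rw [scaling, ← coeff_zero_eq_eval_zero, coeff_derivative]; simp

theorem coeff_zero : p.coeff 0 = 0 := by
  rw [coeff_zero_eq_eval_zero, hp.eval_zero]

end IsDecimationPolynomial

/-! ### Interlacing roots and the extremal property of Chebyshev polynomials. -/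

/-- Rolle's theorem with multiplicities, restricted to the roots in an order connected set. -/
theorem card_filter_roots_le_derivative (f : ℝ[X]) (S : Set ℝ) [S.OrdConnected]
    [DecidablePred (· ∈ S)] :
    (f.roots.filter (· ∈ S)).card ≤ ((derivative f).roots.filter (· ∈ S)).card + 1 := by
  rcases eq_or_ne (derivative f) 0 with hf' | hf'
  · rw [eq_C_of_derivative_eq_zero hf']
    simp
  have hf : f ≠ 0 := ne_of_apply_ne derivative (by rwa [derivative_zero])
  set A := (f.roots.filter (· ∈ S)).toFinset
  set B := ((derivative f).roots.filter (· ∈ S)).toFinset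
  have hA : ∀ x ∈ A, f.IsRoot x ∧ x ∈ S := by
    intro x hx
    simpa [A, hf, Multiset.mem_filter] using hx
  have hinter : A.card ≤ (B \ A).card + 1 := by
    refine Finset.card_le_sdiff_of_interleaved fun x hx y hy hxy _ => ?_
    obtain ⟨z, hz1, hz2⟩ := exists_deriv_eq_zero hxy f.continuousOn
      ((hA x hx).1.trans (hA y hy).1.symm)
    refine ⟨z, ?_, hz1⟩
    have hzS : z ∈ S := Set.OrdConnected.out ‹_› (hA x hx).2 (hA y hy).2 (Set.Ioo_subset_Icc_self hz1)
    simp only [B, Multiset.mem_toFinset, Multiset.mem_filter]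
    refine ⟨?_, hzS⟩
    rwa [mem_roots hf', IsRoot, ← f.deriv]
  have hcount : ∀ x ∈ S, (f.roots.filter (· ∈ S)).count x = f.rootMultiplicity x := by
    intro x hx
    rw [Multiset.count_filter_of_pos hx, count_roots]
  have hcount' : ∀ x ∈ S, ((derivative f).roots.filter (· ∈ S)).count x =
      (derivative f).rootMultiplicity x := by
    intro x hx
    rw [Multiset.count_filter_of_pos hx, count_roots]
  calc (f.roots.filter (· ∈ S)).card
      = ∑ x ∈ A, (f.roots.filter (· ∈ S)).count x := (Multiset.toFinset_sum_count_eq _).symm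
    _ = ∑ x ∈ A, (((f.roots.filter (· ∈ S)).count x - 1) + 1) :=
        (Finset.sum_congr rfl fun x hx => tsub_add_cancel_of_le <|
          Nat.succ_le_iff.2 <| Multiset.count_pos.2 <| Multiset.mem_toFinset.1 hx).symm
    _ = ∑ x ∈ A, ((f.roots.filter (· ∈ S)).count x - 1) + A.card := by
        simp only [Finset.sum_add_distrib, Finset.card_eq_sum_ones]
    _ ≤ ∑ x ∈ A, ((derivative f).roots.filter (· ∈ S)).count x + ((B \ A).card + 1) := by
        refine add_le_add (Finset.sum_le_sum fun x hx => ?_) hinter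
        rw [hcount x (hA x hx).2, hcount' x (hA x hx).2]
        exact rootMultiplicity_sub_one_le_derivative_rootMultiplicity _ _
    _ ≤ ∑ x ∈ A, ((derivative f).roots.filter (· ∈ S)).count x +
          (∑ x ∈ B \ A, ((derivative f).roots.filter (· ∈ S)).count x + 1) := by
        gcongr
        rw [Finset.card_eq_sum_ones]
        refine Finset.sum_le_sum fun x hx => ?_
        rw [Nat.succ_le_iff, Multiset.count_pos, ← Multiset.mem_toFinset]
        exact (Finset.mem_sdiff.1 hx).1
    _ = ((derivative f).roots.filter (· ∈ S)).card + 1 := by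
        rw [← add_assoc, ← Finset.sum_union Finset.disjoint_sdiff, Finset.union_sdiff_self_eq_union,
          ← Multiset.toFinset_sum_count_eq, ← Finset.sum_subset Finset.subset_union_right]
        intro x _ hx₂
        simpa only [B, Multiset.mem_toFinset, Multiset.count_eq_zero] using hx₂

/-- Two real-rooted polynomials with the same derivative have, up to one, the same number of roots
in every half line. -/
theorem card_filter_roots_ge_le {f g : ℝ[X]} (hf : 0 < f.natDegree)
    (hfg : derivative f = derivative g) (hg : g.Splits) (hd : f.natDegree = g.natDegree) (t : ℝ) :
    (f.roots.filter (t ≤ ·)).card ≤ (g.roots.filter (t ≤ ·)).card + 1 := by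
  -- Rolle is used for f on [t, ∞) and for g on (-∞, t). The common derivative has at most d - 1
  -- roots in all, so the two estimates share them.
  have h1 := card_filter_roots_le_derivative f (Set.Ici t)
  have h2 := card_filter_roots_le_derivative g (Set.Iio t)
  have h3 : g.roots.card = f.natDegree := by rw [hd, hg.natDegree_eq_card_roots]
  have h4 : (derivative g).roots.card ≤ f.natDegree - 1 := by
    refine (card_roots' _).trans ?_
    rw [← hfg]
    exact natDegree_derivative_le f
  have hsplit : ∀ s : Multiset ℝ,
      (s.filter (t ≤ ·)).card + (s.filter (· ∈ Set.Iio t)).card = s.card := by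
    intro s
    rw [← Multiset.card_add]
    conv_rhs => rw [← Multiset.filter_add_not (t ≤ ·) s]
    congr 2
    refine Multiset.filter_congr fun x _ => ?_
    simp
  have h5 := hsplit g.roots
  have h6 := hsplit (derivative g).roots
  simp only [Set.mem_Ici] at h1
  rw [hfg] at h1
  omega

/-- This and its converse below translate between numbers of roots in half lines and entries of
decreasingly sorted lists of roots. -/
theorem List.succ_le_countP_getElem {l : List ℝ} (hl : l.Pairwise (· ≥ ·)) {j : ℕ}
    (hj : j < l.length) : j + 1 ≤ l.countP (fun x => decide (l[j] ≤ x)) := by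
  induction l generalizing j with
  | nil => simp at hj
  | cons a l ih =>
    rw [List.pairwise_cons] at hl
    cases j with
    | zero => simp
    | succ j =>
      have hj' : j < l.length := by simpa using hj
      have h1 := ih hl.2 hj'
      have h2 : l[j] ≤ a := hl.1 _ (List.getElem_mem hj')
      simp only [List.getElem_cons_succ]
      rw [List.countP_cons_of_pos (by simpa using h2)]
      omega

theorem List.le_getElem_of_succ_le_countP {l : List ℝ} (hl : l.Pairwise (· ≥ ·)) {m : ℕ} {t : ℝ}
    (hm : m < l.length) (h : m + 1 ≤ l.countP (fun x => decide (t ≤ x))) : t ≤ l[m] := by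
  induction l generalizing m with
  | nil => simp at hm
  | cons a l ih =>
    rw [List.pairwise_cons] at hl
    by_cases ha : t ≤ a
    · cases m with
      | zero => simpa using ha
      | succ m =>
        rw [List.countP_cons_of_pos (by simpa using ha)] at h
        exact ih hl.2 (by simpa using hm) (by omega)
    · exfalso
      have : (a :: l).countP (fun x => decide (t ≤ x)) = 0 := by
        rw [List.countP_eq_zero]
        intro x hx
        rcases List.mem_cons.1 hx with rfl | hx
        · simpa using ha
        · have := hl.1 x hx
          simp only [decide_eq_true_eq]
          intro h
          exact ha (h.trans this)
      omega

/-- With t the entry of index j + 1 for f, at least j + 2 roots of f are ≥ t, hence at least j + 1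
roots of g are. -/
theorem sort_roots_interlace {f g : ℝ[X]} (hf0 : 0 < f.natDegree)
    (hfg : derivative f = derivative g) (hg : g.Splits)
    (hd : f.natDegree = g.natDegree) {j : ℕ}
    (h1 : j + 1 < (f.roots.sort (· ≥ ·)).length) (h2 : j < (g.roots.sort (· ≥ ·)).length) :
    (f.roots.sort (· ≥ ·))[j + 1] ≤ (g.roots.sort (· ≥ ·))[j] := by
  classical
  have a1 := List.succ_le_countP_getElem (Multiset.pairwise_sort f.roots (· ≥ ·)) h1
  refine List.le_getElem_of_succ_le_countP (Multiset.pairwise_sort g.roots (· ≥ ·)) h2 ?_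
  set t := (f.roots.sort (· ≥ ·))[j + 1]
  have hc : ∀ s : Multiset ℝ, (s.sort (· ≥ ·)).countP (fun x => decide (t ≤ x)) =
      (s.filter (t ≤ ·)).card := by
    intro s
    conv_rhs => rw [← Multiset.sort_eq s (· ≥ ·)]
    rw [← Multiset.countP_eq_card_filter, Multiset.coe_countP]
  rw [hc] at a1 ⊢
  have := card_filter_roots_ge_le hf0 hfg hg hd t
  omega

/-- A polynomial of degree less than `n` whose signs alternate at `n` points to the left of `c` is
non-negative at `c`, and vanishes there only if it is zero. -/
theorem eval_nonneg_of_alternating {n : ℕ} {y : ℕ → ℝ} {c : ℝ} {E : ℝ[X]}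
    (hy : ∀ i j, i < j → j < n → y j < y i) (hc : ∀ i < n, y i < c) (hE : E.degree < n)
    (hs : ∀ i < n, 0 ≤ (-1) ^ i * E.eval (y i)) :
    0 ≤ E.eval c ∧ (E.eval c = 0 → E = 0) := by
  classical
  have hinj : Set.InjOn y (Finset.range n) := by
    intro i hi j hj hij
    simp only [Finset.coe_range, Set.mem_Iio] at hi hj
    rcases lt_trichotomy i j with h | h | h
    · exact absurd hij (hy i j h hj).ne'
    · exact h
    · exact absurd hij (hy j i h hi).ne
  have hpos : ∀ i < n, 0 < (-1) ^ i * (Lagrange.basis (Finset.range n) y i).eval c := by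
    intro i hi
    -- Exactly the i nodes of smaller index lie to the right of `y i`; each contributes one negative
    -- factor to the Lagrange basis polynomial at c.
    have h1 : (-1 : ℝ) ^ i = ∏ j ∈ (Finset.range n).erase i, (if j < i then (-1 : ℝ) else 1) := by
      rw [Finset.prod_ite, Finset.prod_const, Finset.prod_const_one, mul_one]
      congr 1
      rw [show ((Finset.range n).erase i).filter (· < i) = Finset.range i by
        ext j; simp only [Finset.mem_filter, Finset.mem_erase, Finset.mem_range]; omega,
        Finset.card_range]
    rw [h1, Lagrange.basis, eval_prod, ← Finset.prod_mul_distrib]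
    refine Finset.prod_pos fun j hj => ?_
    rw [Finset.mem_erase, Finset.mem_range] at hj
    have h2 := hc j hj.2
    simp only [Lagrange.basisDivisor, eval_mul, eval_C, eval_sub, eval_X]
    have h4 : 0 < c - y j := sub_pos.2 h2
    split_ifs with h
    · have h3 : 0 < y j - y i := sub_pos.2 (hy j i h hi)
      have : (-1 : ℝ) * ((y i - y j)⁻¹ * (c - y j)) = (y j - y i)⁻¹ * (c - y j) := by
        rw [← neg_sub (y j) (y i), inv_neg]; ring
      rw [this]
      positivity
    · have h3 : 0 < y i - y j := sub_pos.2 (hy i j (by omega) hj.2)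
      positivity
  -- Interpolation at n nodes is exact in degree less than n. The two alternating signs cancel, so
  -- E(c) is a sum of non-negative terms.
  have hsum : E.eval c = ∑ i ∈ Finset.range n, ((-1) ^ i * E.eval (y i)) *
      ((-1) ^ i * (Lagrange.basis (Finset.range n) y i).eval c) := by
    have h := Lagrange.eq_interpolate hinj (f := E) (by simpa using hE)
    conv_lhs => rw [h]
    rw [Lagrange.interpolate_apply, eval_finsetSum]
    refine Finset.sum_congr rfl fun i _ => ?_
    rw [eval_C_mul]
    have : ((-1 : ℝ) ^ i) * (-1) ^ i = 1 := by rw [← mul_pow]; simp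
    linear_combination (-(eval (y i) E * eval c (Lagrange.basis (Finset.range n) y i))) * this
  have hterm : ∀ i ∈ Finset.range n, 0 ≤ ((-1) ^ i * E.eval (y i)) *
      ((-1) ^ i * (Lagrange.basis (Finset.range n) y i).eval c) := fun i hi =>
    mul_nonneg (hs i (Finset.mem_range.1 hi)) (hpos i (Finset.mem_range.1 hi)).le
  refine ⟨hsum ▸ Finset.sum_nonneg hterm, fun h0 => ?_⟩
  rw [hsum, Finset.sum_eq_zero_iff_of_nonneg hterm] at h0
  refine eq_zero_of_degree_lt_of_eval_index_eq_zero (s := Finset.range n) (v := y) hinj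
    (by simpa using hE) fun i hi => ?_
  rcases mul_eq_zero.1 (h0 i hi) with h | h
  · rcases mul_eq_zero.1 h with h | h
    · exact absurd h (pow_ne_zero _ (by norm_num))
    · exact h
  · exact absurd h (hpos i (Finset.mem_range.1 hi)).ne'

theorem derivative_T_eval_one (n : ℕ) : (derivative (Chebyshev.T ℝ (n : ℤ))).eval 1 = (n : ℝ) ^ 2 := by
  have := Chebyshev.iterate_derivative_T_eval_one_recurrence (R := ℝ) (n : ℤ) 0
  simpa using this

/-- Among the polynomials which take the values `±1` only on `[-1, 1]`, the Chebyshev polynomials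
have the least derivative at the fixed point `1`. -/
theorem sq_natDegree_le_derivative_eval_one {q : ℝ[X]} (hd : 0 < q.natDegree) (h1 : q.eval 1 = 1)
    (hsu : (q - C 1).Splits) (hsv : (q - C (-1)).Splits)
    (hu : ∀ x, q.eval x = 1 → |x| ≤ 1) (hv : ∀ x, q.eval x = -1 → |x| ≤ 1) :
    (q.natDegree : ℝ) ^ 2 ≤ q.derivative.eval 1 ∧
      (q.derivative.eval 1 = (q.natDegree : ℝ) ^ 2 → q = Chebyshev.T ℝ (q.natDegree : ℤ)) := by
  set d := q.natDegree with hdef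
  set lu := (q - C 1).roots.sort (· ≥ ·) with hlu
  set lv := (q - C (-1)).roots.sort (· ≥ ·) with hlv
  have hdu : (q - C 1).natDegree = d := natDegree_sub_C
  have hdv : (q - C (-1)).natDegree = d := natDegree_sub_C
  have lenu : lu.length = d := by
    rw [hlu, Multiset.length_sort, ← hsu.natDegree_eq_card_roots, hdu]
  have lenv : lv.length = d := by
    rw [hlv, Multiset.length_sort, ← hsv.natDegree_eq_card_roots, hdv]
  have hder : derivative (q - C 1) = derivative (q - C (-1)) := by simp
  have evu : ∀ i (h : i < lu.length), q.eval lu[i] = 1 := by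
    intro i h
    have := isRoot_of_mem_roots ((Multiset.mem_sort (r := (· ≥ ·))).1 (List.getElem_mem h))
    rw [IsRoot, eval_sub, eval_C] at this
    linarith
  have evv : ∀ i (h : i < lv.length), q.eval lv[i] = -1 := by
    intro i h
    have := isRoot_of_mem_roots ((Multiset.mem_sort (r := (· ≥ ·))).1 (List.getElem_mem h))
    rw [IsRoot, eval_sub, eval_C] at this
    linarith
  have iuv : ∀ j (h : j + 1 < d), lu[j + 1]'(by omega) ≤ lv[j]'(by omega) := fun j h =>
    sort_roots_interlace (by omega) hder hsv (by omega) _ _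
  have ivu : ∀ j (h : j + 1 < d), lv[j + 1]'(by omega) ≤ lu[j]'(by omega) := fun j h =>
    sort_roots_interlace (by omega) hder.symm hsu (by omega) _ _
  -- The nodes are taken alternately from the sorted solutions of q = -1 (even index) and q = 1 (odd
  -- index), so that q(y i) = (-1)^(i+1). Starting with q = -1 keeps all nodes strictly to the left
  -- of the fixed point 1. The value 0 for i ≥ d is never used.
  set y : ℕ → ℝ := fun i => if h : i < d then
    (if Even i then lv[i]'(by omega) else lu[i]'(by omega)) else 0 with hy
  have evy : ∀ i < d, q.eval (y i) = (-1) ^ (i + 1) := by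
    intro i hi
    simp only [hy, hi, dif_pos]
    split_ifs with he
    · rw [evv, Odd.neg_one_pow he.add_one]
    · rw [evu, Even.neg_one_pow (Nat.not_even_iff_odd.1 he).add_one]
  have habs : ∀ i < d, |y i| ≤ 1 := by
    intro i hi
    have := evy i hi
    rcases neg_one_pow_eq_or ℝ (i + 1) with h | h
    · exact hu _ (this.trans h)
    · exact hv _ (this.trans h)
  have hstep : ∀ i, i + 1 < d → y (i + 1) < y i := by
    intro i hi
    refine lt_of_le_of_ne ?_ fun h => ?_
    · simp only [hy, hi, show i < d by omega, dif_pos]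
      by_cases he : Even i
      · rw [if_pos he, if_neg (by simpa [Nat.even_add_one] using he)]
        exact iuv i hi
      · rw [if_neg he, if_pos (by simpa [Nat.even_add_one] using he)]
        exact ivu i hi
    · have e1 := evy (i + 1) hi
      have e2 := evy i (by omega)
      rw [h, e2, pow_succ _ (i + 1)] at e1
      have : ((-1 : ℝ)) ^ (i + 1) ≠ 0 := pow_ne_zero _ (by norm_num)
      apply this
      linarith
  have hanti : ∀ i j, i < j → j < d → y j < y i := by
    intro i j hij hj
    induction j, hij using Nat.le_induction with
    | base => exact hstep i hj
    | succ k hk ih => exact (hstep k hj).trans (ih (by omega))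
  have hy0 : y 0 < 1 := by
    refine lt_of_le_of_ne (le_of_abs_le (habs 0 hd)) fun h => ?_
    have := evy 0 hd
    rw [h, h1] at this
    norm_num at this
  have hlt : ∀ i < d, y i < 1 := by
    intro i hi
    rcases Nat.eq_zero_or_pos i with rfl | h
    · exact hy0
    · exact (hanti 0 i h hi).trans hy0
  set T := Chebyshev.T ℝ (d : ℤ)
  have hTdeg : T.natDegree = d := by simp [T]
  have hT1 : T.eval 1 = 1 := by simp [T]
  -- The value E(1) is q'(1) - d². At the nodes, (1 - y i)(-1)^i E(y i) = 1 + (-1)^i T(y i) ≥ 0,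
  -- because T is bounded by 1 on [-1, 1]; the lemma on alternating signs then gives E(1) ≥ 0.
  set E := (q - T) /ₘ (X - C 1) with hE
  have hD : q - T = (X - C 1) * E := by
    rw [hE, eq_comm, mul_divByMonic_eq_iff_isRoot, IsRoot, eval_sub, h1, hT1, sub_self]
  have hDdeg : (q - T).natDegree ≤ d := (natDegree_sub_le _ _).trans (by rw [hTdeg]; simp [hdef])
  have hEdeg : E.degree < d := by
    rcases eq_or_ne E 0 with h | h
    · rw [h, degree_zero]; exact WithBot.bot_lt_coe _
    · have := congrArg natDegree hD
      rw [natDegree_mul (X_sub_C_ne_zero 1) h, natDegree_X_sub_C] at this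
      rw [degree_eq_natDegree h]
      exact_mod_cast (by omega : E.natDegree < d)
  have hEs : ∀ i < d, 0 ≤ (-1) ^ i * E.eval (y i) := by
    intro i hi
    have h2 := congrArg (eval (y i)) hD
    rw [eval_sub, evy i hi, eval_mul, eval_sub, eval_X, eval_C, pow_succ] at h2
    have h3 := abs_le.1 (Chebyshev.abs_eval_T_real_le_one d (habs i hi))
    have h4 := hlt i hi
    have h5 : ((-1 : ℝ) ^ i) * (-1) ^ i = 1 := by rw [← mul_pow]; simp
    have h6 : (1 - y i) * ((-1) ^ i * E.eval (y i)) = 1 + (-1) ^ i * eval (y i) T := by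
      linear_combination (-1 : ℝ) ^ i * h2 + h5
    have h7 : 0 ≤ 1 + (-1) ^ i * eval (y i) T := by
      rcases neg_one_pow_eq_or ℝ i with h | h <;> rw [h] <;> linarith [h3.1, h3.2]
    rw [← h6] at h7
    exact nonneg_of_mul_nonneg_right h7 (by linarith)
  obtain ⟨r1, r2⟩ := eval_nonneg_of_alternating hanti hlt hEdeg hEs
  have hE1 : E.eval 1 = q.derivative.eval 1 - (d : ℝ) ^ 2 := by
    have := congrArg (fun f => (derivative f).eval 1) hD
    simp only [derivative_sub, eval_sub, derivative_mul, derivative_X, derivative_C, eval_add,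
      eval_mul, eval_X, eval_C, sub_self, zero_mul, add_zero, sub_zero, one_mul] at this
    rw [← this, derivative_T_eval_one]
  rw [hE1] at r1 r2
  refine ⟨by linarith, fun h => ?_⟩
  have := r2 (by linarith)
  rw [this, mul_zero, sub_eq_zero] at hD
  exact hD

/-! ### The inequality λ ≥ d² and the exponent ρ. -/

namespace IsDecimationPolynomial

variable {p : ℝ[X]} (hp : IsDecimationPolynomial p)
include hp

/-- Otherwise `p` would be a multiple of X^d, with vanishing derivative at 0. The negative root
provides a point of the filled Julia set other than 0. -/
theorem exists_root_neg : ∃ r < 0, p.eval r = 0 := by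
  by_contra! h
  have h0 : p.roots = Multiset.replicate p.natDegree 0 := by
    rw [Multiset.eq_replicate]
    refine ⟨hp.splits.natDegree_eq_card_roots.symm, fun r hr => ?_⟩
    by_contra hr0
    exact h r (lt_of_le_of_ne (hp.roots_nonpos hr) hr0) (isRoot_of_mem_roots hr)
  have h1 := hp.splits.eq_prod_roots
  rw [h0, Multiset.map_replicate, Multiset.prod_replicate, C_0, sub_zero] at h1
  have h2 := hp.scaling_pos
  rw [scaling_eq_coeff, h1, coeff_C_mul, coeff_X_pow,
    if_neg (by have := hp.two_le; omega), mul_zero] at h2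
  exact lt_irrefl _ h2

theorem exists_min_filledJulia : ∃ M : ℝ, 0 < M ∧ ((-M : ℝ) : ℂ) ∈ filledJulia p ∧
    ∀ x : ℝ, (x : ℂ) ∈ filledJulia p → -M ≤ x := by
  have hc : IsCompact (filledJulia p) :=
    Metric.isCompact_of_isClosed_isBounded hp.isClosed_filledJulia hp.isBounded_filledJulia
  obtain ⟨z, hz, hmin⟩ := hc.exists_isMinOn ⟨0, hp.zero_mem_filledJulia⟩
    Complex.continuous_re.continuousOn
  obtain ⟨x, -, rfl⟩ := hp.exists_ofReal hz
  have hle : ∀ y : ℝ, (y : ℂ) ∈ filledJulia p → x ≤ y := fun y hy => by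
    simpa using isMinOn_iff.1 hmin y hy
  obtain ⟨r, hr, hr0⟩ := hp.exists_root_neg
  have := hle r (root_mem_filledJulia (v := 0) (by simpa using hp.zero_mem_filledJulia) hr0)
  exact ⟨-x, by linarith, by simpa using hz, fun y hy => by simpa using hle y hy⟩

/-- Conjugate `p` by the affine map L from [-1, 1] to [-M, 0]. Both end points of [-M, 0] are in the
filled Julia set, so their preimages stay in [-M, 0], and the conjugate q takes the values ±1 only
on [-1, 1]. Conjugation preserves the derivative at the fixed point. -/
theorem sq_natDegree_le_scaling : (p.natDegree : ℝ) ^ 2 ≤ scaling p ∧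
    (scaling p = (p.natDegree : ℝ) ^ 2 → ∃ a b : ℝ, a ≠ 0 ∧
      (C a * X + C b).comp p =
        (Chebyshev.T ℝ (p.natDegree : ℤ)).comp (C a * X + C b)) := by
  obtain ⟨M, hM, hMK, hmin⟩ := hp.exists_min_filledJulia
  have h0K : ((0 : ℝ) : ℂ) ∈ filledJulia p := by simpa using hp.zero_mem_filledJulia
  set L : ℝ[X] := C (M / 2) * X + C (-(M / 2)) with hL
  have hM2 : M / 2 ≠ 0 := by positivity
  have hLd : L.natDegree = 1 := natDegree_linear hM2
  have hLe : ∀ x, L.eval x = M / 2 * (x - 1) := by intro x; simp [hL]; ring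
  set q : ℝ[X] := C (2 / M) * p.comp L + C 1 with hq
  have hqe : ∀ x, q.eval x = 2 / M * p.eval (M / 2 * (x - 1)) + 1 := by
    intro x; simp [hq, hLe]
  have hqd : q.natDegree = p.natDegree := by
    rw [hq, natDegree_add_C, natDegree_C_mul (by positivity), natDegree_comp, hLd, mul_one]
  have hsp : ∀ v : ℝ, (v : ℂ) ∈ filledJulia p → ((p - C v).comp L).Splits := fun v hv =>
    (hp.splits_sub_C hv).comp_of_natDegree_le_one hLd.le
  have hrange : ∀ x v : ℝ, (v : ℂ) ∈ filledJulia p → p.eval (M / 2 * (x - 1)) = v → |x| ≤ 1 := by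
    intro x v hv hx
    have hk := root_mem_filledJulia hv hx
    have h1 := hmin _ hk
    have h2 := hp.ofReal_nonpos hk
    rw [abs_le]
    constructor <;> nlinarith
  have hder : q.derivative.eval 1 = scaling p := by
    rw [hq, derivative_add, derivative_C, add_zero, derivative_C_mul, derivative_comp, eval_C_mul,
      eval_mul, eval_comp, hLe, hL, scaling]
    simp
    field_simp
  have key := sq_natDegree_le_derivative_eval_one (q := q) (by rw [hqd]; have := hp.two_le; omega)
    (by rw [hqe]; simp [hp.eval_zero])
    (by
      have : q - C 1 = C (2 / M) * (p - C 0).comp L := by rw [hq]; simp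
      rw [this]
      exact (Splits.C _).mul (hsp 0 h0K))
    (by
      have : q - C (-1) = C (2 / M) * (p - C (-M)).comp L := by
        rw [hq, sub_comp, C_comp, mul_sub, ← C_mul, show 2 / M * -M = -2 by field_simp, add_sub_assoc,
          ← C_sub, sub_eq_add_neg _ (C (-2)), ← C_neg]
        norm_num
      rw [this]
      exact (Splits.C _).mul (hsp _ hMK))
    (fun x hx => hrange x 0 h0K (by
      rw [hqe] at hx
      have : 2 / M ≠ 0 := by positivity
      have h : 2 / M * p.eval (M / 2 * (x - 1)) = 0 := by linarith
      exact (mul_eq_zero.1 h).resolve_left this))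
    (fun x hx => hrange x (-M) hMK (by
      rw [hqe] at hx
      field_simp at hx ⊢
      linarith))
  rw [hqd, hder] at key
  refine ⟨key.1, fun h => ⟨2 / M, 1, by positivity, ?_⟩⟩
  rw [← key.2 h, hq]
  have hLc : L.comp (C (2 / M) * X + C 1) = X := by
    rw [hL]
    simp only [add_comp, mul_comp, C_comp, X_comp]
    rw [mul_add, ← mul_assoc, ← C_mul, ← C_mul, show M / 2 * (2 / M) = 1 by field_simp, C_1, one_mul,
      mul_one, add_assoc, ← C_add, add_neg_cancel, C_0, add_zero]
  rw [add_comp, mul_comp, C_comp, X_comp, add_comp, mul_comp, C_comp, C_comp, comp_assoc, hLc,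
    comp_X]
  simp

theorem rho_pos : 0 < rho p :=
  Real.logb_pos hp.one_lt_scaling (by exact_mod_cast hp.two_le)

theorem rho_le_half : rho p ≤ 1 / 2 := by
  have h := hp.sq_natDegree_le_scaling.1
  have hd : (0 : ℝ) < p.natDegree := by exact_mod_cast (by have := hp.two_le; omega : 0 < p.natDegree)
  rw [rho, Real.logb, div_le_iff₀ (Real.log_pos hp.one_lt_scaling)]
  have := Real.log_le_log (by positivity) h
  rw [Real.log_pow] at this
  push_cast at this
  linarith

theorem scaling_eq_of_rho_eq_half (h : rho p = 1 / 2) : scaling p = (p.natDegree : ℝ) ^ 2 := by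
  have hd : (0 : ℝ) < p.natDegree := by exact_mod_cast (by have := hp.two_le; omega : 0 < p.natDegree)
  have hl := Real.log_pos hp.one_lt_scaling
  rw [rho, Real.logb, div_eq_iff hl.ne'] at h
  refine Real.log_injOn_pos hp.scaling_pos (by positivity : (0 : ℝ) < (p.natDegree : ℝ) ^ 2) ?_
  rw [Real.log_pow, h]
  push_cast
  ring

theorem scaling_rpow_rho : scaling p ^ rho p = p.natDegree :=
  Real.rpow_logb hp.scaling_pos hp.one_lt_scaling.ne'
    (by exact_mod_cast (by have := hp.two_le; omega : 0 < p.natDegree))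

end IsDecimationPolynomial

/-! ### Non-negative coefficients and convergence to the Poincaré function. -/

/-- Real polynomials with non-negative coefficients. -/
def HasNonnegCoeff (f : ℝ[X]) : Prop := ∀ k, 0 ≤ f.coeff k

namespace HasNonnegCoeff

variable {f g h : ℝ[X]}

theorem add (hf : HasNonnegCoeff f) (hg : HasNonnegCoeff g) : HasNonnegCoeff (f + g) :=
  fun k => by rw [coeff_add]; exact add_nonneg (hf k) (hg k)

theorem mul (hf : HasNonnegCoeff f) (hg : HasNonnegCoeff g) : HasNonnegCoeff (f * g) :=
  fun k => by
    rw [coeff_mul]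
    exact Finset.sum_nonneg fun x _ => mul_nonneg (hf _) (hg _)

theorem const {c : ℝ} (hc : 0 ≤ c) : HasNonnegCoeff (C c) := fun k => by
  rw [coeff_C]; split_ifs <;> simp [hc]

theorem X : HasNonnegCoeff (X : ℝ[X]) := fun k => by
  rw [coeff_X]; split_ifs <;> simp

theorem pow (hf : HasNonnegCoeff f) (n : ℕ) : HasNonnegCoeff (f ^ n) := by
  induction n with
  | zero => rw [pow_zero, ← C_1]; exact const zero_le_one
  | succ n ih => rw [pow_succ]; exact ih.mul hf

theorem sum {ι : Type*} {s : Finset ι} {F : ι → ℝ[X]} (h : ∀ i ∈ s, HasNonnegCoeff (F i)) :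
    HasNonnegCoeff (∑ i ∈ s, F i) := fun k => by
  rw [finsetSum_coeff]; exact Finset.sum_nonneg fun i hi => h i hi k

theorem comp (hf : HasNonnegCoeff f) (hg : HasNonnegCoeff g) : HasNonnegCoeff (f.comp g) := by
  rw [comp_eq_sum_left, Polynomial.sum]
  exact sum fun i _ => (const (hf i)).mul (hg.pow i)

theorem pow_sub_pow (hf : HasNonnegCoeff f) (hg : HasNonnegCoeff (g - f)) (n : ℕ) :
    HasNonnegCoeff (g ^ n - f ^ n) := by
  have hg' : HasNonnegCoeff g := by simpa using hf.add hg
  induction n with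
  | zero => simpa using const (le_refl 0)
  | succ n ih =>
    rw [show g ^ (n + 1) - f ^ (n + 1) = (g ^ n - f ^ n) * g + f ^ n * (g - f) by ring]
    exact (ih.mul hg').add ((hf.pow n).mul hg)

/-- Outer composition with `h` is monotone for the coefficientwise order; this transports the growth
of the approximations from one step of the recursion to the next. -/
theorem comp_sub_comp (hh : HasNonnegCoeff h) (hf : HasNonnegCoeff f)
    (hg : HasNonnegCoeff (g - f)) : HasNonnegCoeff (h.comp g - h.comp f) := by
  rw [comp_eq_sum_left, comp_eq_sum_left, Polynomial.sum, Polynomial.sum, ← Finset.sum_sub_distrib]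
  refine sum fun i _ => ?_
  rw [← mul_sub]
  exact (const (hh i)).mul (hf.pow_sub_pow hg i)

theorem norm_aeval_le (hf : HasNonnegCoeff f) (z : ℂ) {r : ℝ} (hz : ‖z‖ ≤ r) :
    ‖aeval z f‖ ≤ f.eval r := by
  rw [aeval_eq_sum_range, eval_eq_sum_range]
  refine (norm_sum_le _ _).trans (Finset.sum_le_sum fun i _ => ?_)
  rw [norm_smul, norm_pow, Real.norm_of_nonneg (hf i)]
  gcongr
  exact hf i

theorem eval_nonneg (hf : HasNonnegCoeff f) {x : ℝ} (hx : 0 ≤ x) : 0 ≤ f.eval x := by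
  rw [eval_eq_sum_range]
  exact Finset.sum_nonneg fun i _ => mul_nonneg (hf i) (pow_nonneg hx i)

theorem eval_le_eval (hf : HasNonnegCoeff f) {x y : ℝ} (hx : 0 ≤ x) (hxy : x ≤ y) :
    f.eval x ≤ f.eval y := by
  rw [eval_eq_sum_range, eval_eq_sum_range]
  refine Finset.sum_le_sum fun i _ => ?_
  gcongr
  exact hf i

theorem divX (hf : HasNonnegCoeff f) : HasNonnegCoeff f.divX := fun k => by
  rw [coeff_divX]; exact hf _

end HasNonnegCoeff

/-- The polynomials `p^{(n)}(λ^{-n} z)`. -/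
def poincareApprox (p : ℝ[X]) : ℕ → ℝ[X]
  | 0 => X
  | n + 1 => p.comp ((poincareApprox p n).comp (C (scaling p)⁻¹ * X))

theorem eval_poincareApprox_succ (p : ℝ[X]) (n : ℕ) (x : ℝ) :
    (poincareApprox p (n + 1)).eval x = p.eval ((poincareApprox p n).eval ((scaling p)⁻¹ * x)) := by
  simp [poincareApprox]

theorem aeval_poincareApprox (p : ℝ[X]) (n : ℕ) (z : ℂ) :
    aeval z (poincareApprox p n) = (cmap p)^[n] (z / (scaling p : ℂ) ^ n) := by
  induction n generalizing z with
  | zero => simp [poincareApprox]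
  | succ n ih =>
    rw [poincareApprox, aeval_comp, aeval_comp, ih, Function.iterate_succ_apply', ← cmap]
    congr 2
    simp only [map_mul, aeval_C, aeval_X, Complex.coe_algebraMap, Complex.ofReal_inv, pow_succ]
    rw [mul_comm, ← div_eq_mul_inv, div_div, mul_comm]

namespace IsDecimationPolynomial

variable {p : ℝ[X]} (hp : IsDecimationPolynomial p)
include hp

theorem hasNonnegCoeff : HasNonnegCoeff p := hp.coeff_nonneg

theorem hasNonnegCoeff_scale : HasNonnegCoeff (C (scaling p)⁻¹ * X) :=
  (HasNonnegCoeff.const (inv_nonneg.2 hp.scaling_pos.le)).mul HasNonnegCoeff.X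

theorem hasNonnegCoeff_approx (n : ℕ) : HasNonnegCoeff (poincareApprox p n) := by
  induction n with
  | zero => exact HasNonnegCoeff.X
  | succ n ih => exact hp.hasNonnegCoeff.comp (ih.comp hp.hasNonnegCoeff_scale)

/-- In p(z/λ) - z the linear terms cancel because λ = p'(0), and the other coefficients are those of
`p`, rescaled. The recursion preserves the order. -/
theorem hasNonnegCoeff_approx_sub (n : ℕ) :
    HasNonnegCoeff (poincareApprox p (n + 1) - poincareApprox p n) := by
  induction n with
  | zero =>
    intro k
    simp only [poincareApprox, X_comp, coeff_sub]
    rw [comp_C_mul_X_coeff, coeff_X]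
    split_ifs with h
    · subst h
      rw [← scaling_eq_coeff, pow_one, mul_inv_cancel₀ hp.scaling_pos.ne', sub_self]
    · rw [sub_zero]
      exact mul_nonneg (hp.coeff_nonneg k) (pow_nonneg (inv_nonneg.2 hp.scaling_pos.le) k)
  | succ n ih =>
    refine hp.hasNonnegCoeff.comp_sub_comp
      ((hp.hasNonnegCoeff_approx n).comp hp.hasNonnegCoeff_scale) ?_
    rw [← sub_comp]
    exact ih.comp hp.hasNonnegCoeff_scale

theorem hasNonnegCoeff_approx_sub_X (n : ℕ) : HasNonnegCoeff (poincareApprox p n - X) := by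
  induction n with
  | zero => simpa [poincareApprox] using HasNonnegCoeff.const (le_refl 0)
  | succ n ih => simpa using (hp.hasNonnegCoeff_approx_sub n).add ih

theorem eval_eq_mul (y : ℝ) :
    p.eval y = y * (scaling p + y * p.divX.divX.eval y) := by
  have h := p.X_mul_divX_add
  rw [hp.coeff_zero, C_0, add_zero] at h
  have h2 := p.divX.X_mul_divX_add
  rw [coeff_divX, zero_add, ← scaling_eq_coeff] at h2
  conv_lhs => rw [← h, ← h2]
  simp only [eval_mul, eval_add, eval_X, eval_C]
  ring

theorem scaling_mul_le_eval {y : ℝ} (hy : 0 ≤ y) : scaling p * y ≤ p.eval y := by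
  rw [hp.eval_eq_mul]
  have : 0 ≤ p.divX.divX.eval y := hp.hasNonnegCoeff.divX.divX.eval_nonneg hy
  have : 0 ≤ y * (y * p.divX.divX.eval y) := by positivity
  linarith

/-- The bound x + kx² on [0, 1/k] is reproduced by the recursion; it is at most 2x there. -/
theorem exists_approx_bound_near_zero : ∃ δ > 0, ∀ (n : ℕ) (x : ℝ), 0 ≤ x → x ≤ δ →
    (poincareApprox p n).eval x ≤ 2 * x := by
  have hl := hp.one_lt_scaling
  set l := scaling p with hldef
  set c := p.divX.divX.eval 2
  have hc : 0 ≤ c := hp.hasNonnegCoeff.divX.divX.eval_nonneg (by norm_num)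
  have hpb : ∀ y, 0 ≤ y → y ≤ 2 → p.eval y ≤ l * y + c * y ^ 2 := by
    intro y hy hy2
    have := hp.hasNonnegCoeff.divX.divX.eval_le_eval hy hy2
    rw [hp.eval_eq_mul]
    have h3 : y * y * p.divX.divX.eval y ≤ y * y * c := by gcongr
    nlinarith
  -- With x = λu, the recursion gives at most λu + λku² + 4cu², and the target is λu + kλ²u². The
  -- gain kλ(λ - 1)u² absorbs the quadratic error 4cu² once 4c ≤ k(λ - 1). The summand 1 ensures k ≥
  -- 1.
  set k := 4 * c / (l - 1) + 1
  have hk1 : 1 ≤ k := by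
    have : 0 ≤ 4 * c / (l - 1) := div_nonneg (by positivity) (by linarith)
    linarith
  have hk : 4 * c ≤ k * (l - 1) := by
    have : 4 * c / (l - 1) * (l - 1) = 4 * c := div_mul_cancel₀ _ (by linarith)
    nlinarith
  have key : ∀ (n : ℕ) (x : ℝ), 0 ≤ x → x ≤ 1 / k →
      (poincareApprox p n).eval x ≤ x + k * x ^ 2 := by
    intro n
    induction n with
    | zero => intro x hx _; simp [poincareApprox]; positivity
    | succ n ih =>
      intro x hx hxk
      rw [eval_poincareApprox_succ, ← hldef]
      set u := l⁻¹ * x with hu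
      have hxu : x = l * u := by rw [hu]; field_simp
      have hu0 : 0 ≤ u := by positivity
      have hux : u ≤ x := by rw [hxu]; nlinarith
      have huk : k * u ≤ 1 := by
        have : k * x ≤ 1 := by rwa [le_div_iff₀ (by linarith), mul_comm] at hxk
        nlinarith
      have hu1 : u ≤ 1 := by nlinarith
      have h1 := ih u hu0 (hux.trans hxk)
      have h0 := (hp.hasNonnegCoeff_approx n).eval_nonneg hu0
      have h2 : u + k * u ^ 2 ≤ 2 * u := by nlinarith
      have h3 := hp.hasNonnegCoeff.eval_le_eval h0 h1
      have h4 := hpb (u + k * u ^ 2) (by positivity) (by linarith)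
      have h5 : (u + k * u ^ 2) ^ 2 ≤ (2 * u) ^ 2 := by
        apply pow_le_pow_left₀ (by positivity) h2
      have h6 : c * (u + k * u ^ 2) ^ 2 ≤ c * (2 * u) ^ 2 := by gcongr
      have h7 : 4 * c * u ^ 2 ≤ k * (l - 1) * u ^ 2 := by gcongr
      have h8 : 0 ≤ k * (l - 1) * (l - 1) * u ^ 2 := by
        have : 0 ≤ l - 1 := by linarith
        positivity
      rw [hxu]
      nlinarith
  refine ⟨1 / k, by positivity, fun n x hx hxk => (key n x hx hxk).trans ?_⟩
  have : k * x ≤ 1 := by rwa [le_div_iff₀ (by linarith), mul_comm] at hxk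
  nlinarith

theorem monotone_approx {x : ℝ} (hx : 0 ≤ x) :
    Monotone fun n => (poincareApprox p n).eval x :=
  monotone_nat_of_le_succ fun n => by
    have := (hp.hasNonnegCoeff_approx_sub n).eval_nonneg hx
    rw [eval_sub] at this
    linarith

/-- A bound b at x/λ gives the bound p(b) at x, so boundedness spreads from [0, δ] to [0, λ^k δ] for
every k. -/
theorem exists_approx_bound {x : ℝ} (hx : 0 ≤ x) :
    ∃ b, ∀ n, (poincareApprox p n).eval x ≤ b := by
  obtain ⟨δ, hδ, h⟩ := hp.exists_approx_bound_near_zero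
  have key : ∀ (k : ℕ) (y : ℝ), 0 ≤ y → y ≤ scaling p ^ k * δ →
      ∃ b, ∀ n, (poincareApprox p n).eval y ≤ b := by
    intro k
    induction k with
    | zero => intro y hy hyk; exact ⟨2 * y, fun n => h n y hy (by simpa using hyk)⟩
    | succ k ih =>
      intro y hy hyk
      obtain ⟨b, hb⟩ := ih ((scaling p)⁻¹ * y)
        (mul_nonneg (inv_nonneg.2 hp.scaling_pos.le) hy) (by
          rw [inv_mul_le_iff₀ hp.scaling_pos]
          refine hyk.trans (le_of_eq ?_)
          rw [pow_succ]; ring)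
      refine ⟨p.eval b, fun n => ?_⟩
      refine (hp.monotone_approx hy (Nat.le_succ n)).trans ?_
      simp only [Nat.succ_eq_add_one]
      rw [eval_poincareApprox_succ]
      exact hp.hasNonnegCoeff.eval_le_eval ((hp.hasNonnegCoeff_approx n).eval_nonneg
        (mul_nonneg (inv_nonneg.2 hp.scaling_pos.le) hy)) (hb n)
  obtain ⟨k, hk⟩ := pow_unbounded_of_one_lt (x / δ) hp.one_lt_scaling
  rw [div_lt_iff₀ hδ] at hk
  exact key k x hx hk.le

theorem summable_approx_sub {x : ℝ} (hx : 0 ≤ x) : Summable fun n =>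
    (poincareApprox p (n + 1)).eval x - (poincareApprox p n).eval x := by
  obtain ⟨b, hb⟩ := hp.exists_approx_bound hx
  refine summable_of_sum_range_le (c := b - x) (fun n => ?_) fun n => ?_
  · exact sub_nonneg.2 (hp.monotone_approx hx (Nat.le_succ n))
  · rw [Finset.sum_range_sub fun n => (poincareApprox p n).eval x]
    have := hb n
    simp only [poincareApprox, eval_X]
    linarith

/-- Weierstrass M-test: on the disc of radius R each increment is dominated by its value at R, and
those values telescope to a bounded sum. The limit appears as a series because `poincare` is a
`limUnder`, which can be identified only after convergence is known. -/
theorem tendstoLocallyUniformlyOn_approx_tsum :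
    TendstoLocallyUniformlyOn (fun (n : ℕ) (z : ℂ) => aeval z (poincareApprox p n))
      (fun z => z + ∑' n, (aeval z (poincareApprox p (n + 1)) - aeval z (poincareApprox p n)))
      atTop Set.univ := by
  have h : ∀ R : ℝ, 0 ≤ R → TendstoUniformlyOn
      (fun (n : ℕ) (z : ℂ) => aeval z (poincareApprox p n))
      (fun z => z + ∑' n, (aeval z (poincareApprox p (n + 1)) - aeval z (poincareApprox p n)))
      atTop (Metric.ball 0 R) := by
    intro R hR
    have h1 := tendstoUniformlyOn_tsum_nat (hp.summable_approx_sub hR)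
      (f := fun n (z : ℂ) => aeval z (poincareApprox p (n + 1)) - aeval z (poincareApprox p n))
      (s := Metric.ball 0 R) fun n z hz => by
        rw [← map_sub, ← eval_sub]
        exact (hp.hasNonnegCoeff_approx_sub n).norm_aeval_le z (mem_ball_zero_iff.1 hz).le
    rw [Metric.tendstoUniformlyOn_iff] at h1 ⊢
    intro ε hε
    filter_upwards [h1 ε hε] with n hn z hz
    have h2 := hn z hz
    rw [Finset.sum_range_sub (fun n => aeval z (poincareApprox p n))] at h2
    rw [dist_eq_norm] at h2 ⊢
    convert h2 using 2
    simp [poincareApprox]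
    ring
  rw [tendstoLocallyUniformlyOn_iff_forall_isCompact isOpen_univ]
  intro K _ hK
  obtain ⟨R, hR⟩ := hK.isBounded.subset_ball 0
  exact (h (max R 0) (le_max_right _ _)).mono
    (hR.trans (Metric.ball_subset_ball (le_max_left _ _)))

theorem tendsto_approx (z : ℂ) :
    Tendsto (fun n => aeval z (poincareApprox p n)) atTop (𝓝 (poincare p z)) := by
  have h := hp.tendstoLocallyUniformlyOn_approx_tsum.tendsto_at (Set.mem_univ z)
  have h2 : poincare p z =
      z + ∑' n, (aeval z (poincareApprox p (n + 1)) - aeval z (poincareApprox p n)) := by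
    rw [poincare]
    refine Tendsto.limUnder_eq ?_
    simp only [aeval_poincareApprox] at h ⊢
    exact h
  rwa [h2]

theorem tendstoLocallyUniformlyOn_approx :
    TendstoLocallyUniformlyOn (fun (n : ℕ) (z : ℂ) => aeval z (poincareApprox p n))
      (poincare p) atTop Set.univ := by
  refine hp.tendstoLocallyUniformlyOn_approx_tsum.congr_right fun z _ => ?_
  exact tendsto_nhds_unique
    (hp.tendstoLocallyUniformlyOn_approx_tsum.tendsto_at (Set.mem_univ z)) (hp.tendsto_approx z)

theorem differentiable_poincare : Differentiable ℂ (poincare p) := by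
  rw [← differentiableOn_univ]
  exact hp.tendstoLocallyUniformlyOn_approx.differentiableOn
    (Eventually.of_forall fun n => (poincareApprox p n).differentiable_aeval.differentiableOn)
    isOpen_univ

theorem poincare_scaling_mul (z : ℂ) :
    poincare p ((scaling p : ℂ) * z) = aeval (poincare p z) p := by
  have h1 := (hp.tendsto_approx ((scaling p : ℂ) * z)).comp (tendsto_add_atTop_nat 1)
  have h2 := ((continuous_cmap p).tendsto _).comp (hp.tendsto_approx z)
  refine tendsto_nhds_unique h1 (h2.congr fun n => ?_)
  have hl : (scaling p : ℂ) ≠ 0 := by exact_mod_cast hp.scaling_pos.ne'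
  simp only [Function.comp_apply, poincareApprox, cmap, aeval_comp, map_mul, aeval_C, aeval_X,
    Complex.coe_algebraMap, Complex.ofReal_inv, inv_mul_cancel_left₀ hl]

theorem eval_zero_approx (n : ℕ) : (poincareApprox p n).eval 0 = 0 := by
  induction n with
  | zero => simp [poincareApprox]
  | succ n ih => rw [eval_poincareApprox_succ, mul_zero, ih, hp.eval_zero]

theorem derivative_approx_eval_zero (n : ℕ) : (derivative (poincareApprox p n)).eval 0 = 1 := by
  induction n with
  | zero => simp [poincareApprox]
  | succ n ih =>
    rw [poincareApprox, derivative_comp, eval_mul, eval_comp, eval_comp]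
    simp only [eval_mul, eval_C, eval_X, mul_zero, hp.eval_zero_approx, derivative_comp, eval_comp,
      ih, derivative_mul, derivative_C, zero_mul, derivative_X, mul_one, zero_add]
    rw [← scaling, inv_mul_cancel₀ hp.scaling_pos.ne']

theorem poincare_zero : poincare p 0 = 0 := by
  refine tendsto_nhds_unique (hp.tendsto_approx 0) (tendsto_const_nhds.congr fun n => ?_)
  have := aeval_algebraMap_apply_eq_algebraMap_eval (A := ℂ) (0 : ℝ) (poincareApprox p n)
  rw [hp.eval_zero_approx] at this
  simpa using this.symm

theorem deriv_poincare_zero : deriv (poincare p) 0 = 1 := by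
  have h := hp.tendstoLocallyUniformlyOn_approx.deriv
    (Eventually.of_forall fun n => (poincareApprox p n).differentiable_aeval.differentiableOn)
    isOpen_univ
  refine tendsto_nhds_unique (h.tendsto_at (Set.mem_univ 0)) (tendsto_const_nhds.congr fun n => ?_)
  simp only [Function.comp_apply, Polynomial.deriv_aeval]
  have := aeval_algebraMap_apply_eq_algebraMap_eval (A := ℂ) (0 : ℝ) (derivative (poincareApprox p n))
  rw [hp.derivative_approx_eval_zero] at this
  simpa using this.symm

end IsDecimationPolynomial

/-! ### Size and growth of the Poincaré function. -/

/-- A real-rooted polynomial without positive roots is least at `0` in the right half plane. -/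
theorem abs_eval_zero_le_norm_aeval {f : ℝ[X]} (hf : f.Splits) (hr : ∀ r ∈ f.roots, r ≤ 0) {z : ℂ}
    (hz : 0 ≤ z.re) : |f.eval 0| ≤ ‖aeval z f‖ := by
  have key : ∀ s : Multiset ℝ, (∀ r ∈ s, r ≤ 0) →
      |((s.map fun r => X - C r).prod).eval 0| ≤ ‖aeval z (s.map fun r => X - C r).prod‖ := by
    intro s
    induction s using Multiset.induction with
    | empty => simp
    | cons a s ih =>
      intro hs
      have ha := hs a (Multiset.mem_cons_self _ _)
      rw [Multiset.map_cons, Multiset.prod_cons, eval_mul, abs_mul, map_mul, norm_mul]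
      refine mul_le_mul ?_ (ih fun r hr => hs r (Multiset.mem_cons_of_mem hr)) (abs_nonneg _)
        (norm_nonneg _)
      simp only [eval_sub, eval_X, eval_C, zero_sub, map_sub, aeval_X, aeval_C,
        Complex.coe_algebraMap]
      rw [abs_neg, abs_of_nonpos ha]
      refine le_trans ?_ (Complex.re_le_norm _)
      simp
      exact hz
  rw [hf.eq_prod_roots, eval_C_mul, abs_mul, map_mul, aeval_C, norm_mul, Complex.coe_algebraMap,
    Complex.norm_real, Real.norm_eq_abs]
  exact mul_le_mul_of_nonneg_left (key _ hr) (abs_nonneg _)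

/-- The restriction of the Poincaré function to the real line. -/
def poincareReal (p : ℝ[X]) (x : ℝ) : ℝ := (poincare p x).re

namespace IsDecimationPolynomial

variable {p : ℝ[X]} (hp : IsDecimationPolynomial p)
include hp

theorem tendsto_approx_real (x : ℝ) :
    Tendsto (fun n => (poincareApprox p n).eval x) atTop (𝓝 (poincareReal p x)) := by
  have h := (Complex.continuous_re.tendsto _).comp (hp.tendsto_approx x)
  refine h.congr fun n => ?_
  rw [Function.comp_apply]
  have := aeval_algebraMap_apply_eq_algebraMap_eval (A := ℂ) x (poincareApprox p n)
  rw [Complex.coe_algebraMap] at this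
  rw [this, Complex.ofReal_re]

theorem poincare_ofReal (x : ℝ) : poincare p x = poincareReal p x := by
  have h := (Complex.continuous_ofReal.tendsto _).comp (hp.tendsto_approx_real x)
  refine tendsto_nhds_unique (hp.tendsto_approx x) (h.congr fun n => ?_)
  exact (aeval_algebraMap_apply_eq_algebraMap_eval (A := ℂ) x (poincareApprox p n)).symm

theorem poincareReal_zero : poincareReal p 0 = 0 := by
  simp [poincareReal, hp.poincare_zero]

theorem poincareReal_scaling_mul (x : ℝ) :
    poincareReal p (scaling p * x) = p.eval (poincareReal p x) := by
  have h := hp.poincare_scaling_mul x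
  rw [← Complex.ofReal_mul, hp.poincare_ofReal, hp.poincare_ofReal, ← cmap, cmap_ofReal] at h
  exact_mod_cast h

/-- The approximations minus `X` have non-negative coefficients, so they increase on the positive
axis. Monotonicity of Φ and Φ(x) ≥ x follow. -/
theorem sub_le_poincareReal_sub {x y : ℝ} (hx : 0 ≤ x) (hxy : x ≤ y) :
    y - x ≤ poincareReal p y - poincareReal p x := by
  refine ge_of_tendsto' ((hp.tendsto_approx_real y).sub (hp.tendsto_approx_real x)) fun n => ?_
  have h := (hp.hasNonnegCoeff_approx_sub_X n).eval_le_eval hx hxy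
  rw [eval_sub, eval_sub, eval_X, eval_X] at h
  linarith

theorem le_poincareReal {x : ℝ} (hx : 0 ≤ x) : x ≤ poincareReal p x := by
  have := hp.sub_le_poincareReal_sub le_rfl hx
  rw [hp.poincareReal_zero] at this
  linarith

theorem poincareReal_pos {x : ℝ} (hx : 0 < x) : 0 < poincareReal p x :=
  hx.trans_le (hp.le_poincareReal hx.le)

theorem poincareReal_nonneg {x : ℝ} (hx : 0 ≤ x) : 0 ≤ poincareReal p x :=
  hx.trans (hp.le_poincareReal hx)

theorem poincareReal_mono {x y : ℝ} (hx : 0 ≤ x) (hxy : x ≤ y) :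
    poincareReal p x ≤ poincareReal p y := by
  have := hp.sub_le_poincareReal_sub hx hxy
  linarith

theorem norm_poincare_le {z : ℂ} {r : ℝ} (hz : ‖z‖ ≤ r) : ‖poincare p z‖ ≤ poincareReal p r :=
  le_of_tendsto_of_tendsto' (hp.tendsto_approx z).norm (hp.tendsto_approx_real r) fun n =>
    (hp.hasNonnegCoeff_approx n).norm_aeval_le z hz

theorem mem_filledJulia_of_approx_eq_zero {n : ℕ} {z : ℂ} (h : aeval z (poincareApprox p n) = 0) :
    ∃ x : ℝ, x ≤ 0 ∧ z = x := by
  have hk : ∀ (n : ℕ) (y : ℂ), (cmap p)^[n] y = 0 → y ∈ filledJulia p := by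
    intro n
    induction n with
    | zero => rintro y rfl; exact hp.zero_mem_filledJulia
    | succ n ih => intro y hy; exact (cmap_mem_filledJulia_iff p y).1 (ih _ hy)
  rw [aeval_poincareApprox] at h
  obtain ⟨x, hx, h2⟩ := hp.exists_ofReal (hk n _ h)
  have hl : (scaling p : ℂ) ^ n ≠ 0 := pow_ne_zero _ (by exact_mod_cast hp.scaling_pos.ne')
  refine ⟨x * scaling p ^ n, mul_nonpos_of_nonpos_of_nonneg hx (pow_nonneg hp.scaling_pos.le n), ?_⟩
  rw [div_eq_iff hl] at h2
  rw [h2]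
  push_cast
  ring

/-- After division by `X` each approximation is real-rooted with non-positive roots and has the
value 1 at 0, so its modulus is at least 1 in the right half plane. Consequently only finitely many
solutions of Φ = w lie in that half plane. -/
theorem norm_le_norm_poincare {z : ℂ} (hz : 0 ≤ z.re) : ‖z‖ ≤ ‖poincare p z‖ := by
  refine ge_of_tendsto' (hp.tendsto_approx z).norm fun n => ?_
  set f := poincareApprox p n with hf
  have hX : X * f.divX = f := by
    have h := f.X_mul_divX_add
    rwa [coeff_zero_eq_eval_zero, hp.eval_zero_approx, C_0, add_zero] at h
  have h1 : f.divX.eval 0 = 1 := by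
    have h := hp.derivative_approx_eval_zero n
    rw [← hf, ← hX] at h
    simpa using h
  have hne : f.divX ≠ 0 := by rintro h; rw [h] at h1; simp at h1
  have hroot : ∀ a : ℂ, aeval a f.divX = 0 → ∃ x : ℝ, x ≤ 0 ∧ a = x := by
    intro a ha
    refine hp.mem_filledJulia_of_approx_eq_zero (n := n) ?_
    rw [← hf, ← hX, map_mul, ha, mul_zero]
  have hs : f.divX.Splits := by
    refine Splits.of_splits_map (algebraMap ℝ ℂ) (IsAlgClosed.splits _) fun a ha => ?_
    have h := isRoot_of_mem_roots ha
    rw [IsRoot, eval_map_algebraMap] at h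
    obtain ⟨x, -, rfl⟩ := hroot a h
    exact ⟨x, rfl⟩
  have hr : ∀ r ∈ f.divX.roots, r ≤ 0 := by
    intro r hr
    have h := isRoot_of_mem_roots hr
    obtain ⟨x, hx, h3⟩ := hroot r (by
      have := aeval_algebraMap_apply_eq_algebraMap_eval (A := ℂ) r f.divX
      rw [Complex.coe_algebraMap] at this
      rw [this, h.eq_zero, Complex.ofReal_zero])
    rw [Complex.ofReal_inj.1 h3]
    exact hx
  have := abs_eval_zero_le_norm_aeval hs hr hz
  rw [h1, abs_one] at this
  rw [← hX, map_mul, aeval_X, norm_mul]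
  exact le_mul_of_one_le_right (norm_nonneg _) this

theorem exists_eval_le : ∃ b : ℝ, 1 ≤ b ∧ ∀ y, 1 ≤ y → p.eval y ≤ b * y ^ p.natDegree := by
  refine ⟨p.eval 1, ?_, fun y hy => ?_⟩
  · have := hp.scaling_mul_le_eval zero_le_one
    linarith [hp.one_lt_scaling]
  · rw [eval_eq_sum_range, eval_eq_sum_range, Finset.sum_mul]
    refine Finset.sum_le_sum fun i hi => ?_
    rw [one_pow, mul_one]
    have := pow_le_pow_right₀ hy (Nat.lt_succ_iff.1 (Finset.mem_range.1 hi))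
    exact mul_le_mul_of_nonneg_left this (hp.coeff_nonneg i)

/-- From p(y) ≤ b y^d for y ≥ 1, the quantity b · max(1, Φ) is at most raised to the power d when x
is replaced by λx. After n steps the exponent is d^n = (λ^n)^ρ. -/
theorem exists_poincareReal_le : ∃ c : ℝ, 0 < c ∧ ∀ r : ℝ, 0 ≤ r →
    poincareReal p r ≤ Real.exp (c * (1 + r) ^ rho p) := by
  obtain ⟨b, hb, hpb⟩ := hp.exists_eval_le
  have hl := hp.one_lt_scaling
  have hl0 := hp.scaling_pos
  -- This bounds b · max(1, Φ) on [0, λ]; the added 1 makes log W positive.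
  set W := b * max 1 (poincareReal p (scaling p)) + 1 with hW
  have hW1 : 1 < W := by
    have : 0 < max 1 (poincareReal p (scaling p)) := by positivity
    have : 0 < b * max 1 (poincareReal p (scaling p)) := by positivity
    linarith
  have key : ∀ (n : ℕ) (x : ℝ), 0 ≤ x → x ≤ scaling p →
      b * max 1 (poincareReal p (scaling p ^ n * x)) ≤ W ^ (p.natDegree ^ n) := by
    intro n
    induction n with
    | zero =>
      intro x hx hxl
      have := hp.poincareReal_mono hx hxl
      simp only [pow_zero, one_mul, pow_one]
      have : b * max 1 (poincareReal p x) ≤ b * max 1 (poincareReal p (scaling p)) := by gcongr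
      linarith
    | succ n ih =>
      intro x hx hxl
      have h1 := ih x hx hxl
      rw [pow_succ', mul_assoc, hp.poincareReal_scaling_mul]
      set y := poincareReal p (scaling p ^ n * x)
      have hy0 : 0 ≤ y := hp.poincareReal_nonneg (by positivity)
      set m := max 1 y
      have hm : 1 ≤ m := le_max_left _ _
      have h2 : max 1 (p.eval y) ≤ b * m ^ p.natDegree := by
        refine max_le ?_ ((hp.hasNonnegCoeff.eval_le_eval hy0 (le_max_right _ _)).trans (hpb m hm))
        have := one_le_pow₀ hm (n := p.natDegree)
        nlinarith
      have h3 : b * b ≤ b ^ p.natDegree := by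
        rw [← sq]; exact pow_le_pow_right₀ hb hp.two_le
      calc b * max 1 (p.eval y) ≤ b * (b * m ^ p.natDegree) := by gcongr
        _ = b * b * m ^ p.natDegree := by ring
        _ ≤ b ^ p.natDegree * m ^ p.natDegree := by gcongr
        _ = (b * m) ^ p.natDegree := (mul_pow _ _ _).symm
        _ ≤ (W ^ (p.natDegree ^ n)) ^ p.natDegree := by gcongr
        _ = W ^ (p.natDegree ^ (n + 1)) := by rw [← pow_mul, pow_succ]
  refine ⟨Real.log W, Real.log_pos hW1, fun r hr => ?_⟩
  have hle : ∀ t : ℝ, max 1 t ≤ b * max 1 t := fun t => le_mul_of_one_le_left (by positivity) hb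
  have hρ := hp.rho_pos
  rcases le_or_gt r 1 with h1 | h1
  · have h2 := key 0 r hr (h1.trans hl.le)
    simp only [pow_zero, one_mul, pow_one] at h2
    have h3 : poincareReal p r ≤ W := (le_max_right _ _).trans ((hle _).trans h2)
    refine h3.trans ?_
    conv_lhs => rw [← Real.exp_log (by linarith : 0 < W)]
    apply Real.exp_le_exp.2
    exact le_mul_of_one_le_right (Real.log_pos hW1).le
      (Real.one_le_rpow (by linarith) hρ.le)
  · obtain ⟨n, hn1, hn2⟩ := exists_nat_pow_near h1.le hl
    have hpos : 0 < scaling p ^ n := by positivity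
    have h2 := key n (r / scaling p ^ n) (by positivity) (by
      rw [div_le_iff₀ hpos, ← pow_succ']; exact hn2.le)
    rw [mul_div_cancel₀ _ hpos.ne'] at h2
    have h3 : poincareReal p r ≤ W ^ (p.natDegree ^ n) := (le_max_right _ _).trans ((hle _).trans h2)
    refine h3.trans ?_
    rw [← Real.rpow_natCast, Real.rpow_def_of_pos (by linarith)]
    apply Real.exp_le_exp.2
    refine mul_le_mul_of_nonneg_left ?_ (Real.log_pos hW1).le
    push_cast
    rw [← hp.scaling_rpow_rho, ← Real.rpow_natCast, ← Real.rpow_mul hl0.le, mul_comm,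
      Real.rpow_mul hl0.le, Real.rpow_natCast]
    exact Real.rpow_le_rpow hpos.le (by linarith) hρ.le

theorem exists_norm_poincare_le : ∃ c : ℝ, 0 < c ∧ ∀ z : ℂ,
    ‖poincare p z‖ ≤ Real.exp (c * (1 + ‖z‖) ^ rho p) := by
  obtain ⟨c, hc, h⟩ := hp.exists_poincareReal_le
  exact ⟨c, hc, fun z => (hp.norm_poincare_le le_rfl).trans (h _ (norm_nonneg z))⟩

theorem eventually_mul_le_eval (b : ℝ) : ∀ᶠ y in atTop, b * y ≤ p.eval y := by
  have hd : 0 < p.divX.degree := by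
    rw [← natDegree_pos_iff_degree_pos, natDegree_divX_eq_natDegree_tsub_one]
    have := hp.two_le
    omega
  have h0 : 0 ≤ p.divX.leadingCoeff := hp.hasNonnegCoeff.divX _
  filter_upwards [(tendsto_atTop_of_leadingCoeff_nonneg _ hd h0).eventually_ge_atTop b,
    eventually_ge_atTop 0] with y hy hy0
  have hX : X * p.divX = p := by
    have h := p.X_mul_divX_add
    rwa [hp.coeff_zero, C_0, add_zero] at h
  rw [← hX, eval_mul, eval_X, mul_comm]
  exact mul_le_mul_of_nonneg_left hy hy0

/-- For large y one has p(y) ≥ λ^(N+1) y, so scaling x by λ multiplies Φ by at least λ^(N+1). The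
surplus power over N pays for the constant (λY)^(N+1). -/
theorem eventually_pow_le_poincareReal (N : ℕ) : ∀ᶠ x in atTop, x ^ N ≤ poincareReal p x := by
  obtain ⟨Y', hY'⟩ := eventually_atTop.1 (hp.eventually_mul_le_eval (scaling p ^ (N + 1)))
  set Y := max Y' 1
  have hY1 : 1 ≤ Y := le_max_right _ _
  have hl := hp.one_lt_scaling
  have hl0 := hp.scaling_pos
  have key : ∀ (n : ℕ) (x : ℝ), Y ≤ x →
      scaling p ^ (n * (N + 1)) * Y ≤ poincareReal p (scaling p ^ n * x) := by
    intro n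
    induction n with
    | zero =>
      intro x hx
      have := hp.le_poincareReal (x := x) (by linarith)
      simp only [zero_mul, pow_zero, one_mul]
      linarith
    | succ n ih =>
      intro x hx
      have h1 := ih x hx
      rw [pow_succ', mul_assoc, hp.poincareReal_scaling_mul]
      have h2 : Y ≤ scaling p ^ (n * (N + 1)) * Y :=
        le_mul_of_one_le_left (by linarith) (one_le_pow₀ hl.le)
      refine le_trans ?_ (hY' _ ((le_max_left _ _).trans (h2.trans h1)))
      rw [add_mul, one_mul, pow_add, mul_comm (scaling p ^ (n * (N + 1))), mul_assoc]
      gcongr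
  filter_upwards [eventually_ge_atTop ((scaling p * Y) ^ (N + 1)), eventually_ge_atTop Y] with t ht htY
  have hYpos : 0 < Y := by linarith
  obtain ⟨n, hn1, hn2⟩ := exists_nat_pow_near (x := t / Y) ((one_le_div hYpos).2 htY) hl
  have hpos : 0 < scaling p ^ n := by positivity
  have h1 := key n (t / scaling p ^ n) (by
    rw [le_div_iff₀ hpos, mul_comm]; rwa [le_div_iff₀ hYpos] at hn1)
  rw [mul_div_cancel₀ _ hpos.ne'] at h1
  refine le_trans ?_ h1
  rw [div_lt_iff₀ hYpos, pow_succ] at hn2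
  have ht0 : 0 ≤ t := hYpos.le.trans htY
  have h2 : t ^ (N + 1) ≤ (scaling p ^ n * (scaling p * Y)) ^ (N + 1) := by
    refine pow_le_pow_left₀ ht0 ?_ _
    linarith
  rw [mul_pow, ← pow_mul] at h2
  have hW : 0 < (scaling p * Y) ^ (N + 1) := by positivity
  have h3 : t ^ N * (scaling p * Y) ^ (N + 1) ≤
      scaling p ^ (n * (N + 1)) * (scaling p * Y) ^ (N + 1) := by
    refine le_trans ?_ h2
    rw [pow_succ t]
    exact mul_le_mul_of_nonneg_left ht (by positivity)
  have h4 := le_of_mul_le_mul_right h3 hW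
  exact h4.trans (le_mul_of_one_le_right (by positivity) hY1)

end IsDecimationPolynomial

/-! ### Entire functions of order less than one and their zeros. -/

/-- Entire functions with `F 0 ≠ 0` whose order of growth is at most `ρ < 1`. -/
structure IsEntireOfOrder (F : ℂ → ℂ) (ρ : ℝ) : Prop where
  differentiable : Differentiable ℂ F
  ne_zero : F 0 ≠ 0
  pos : 0 < ρ
  lt_one : ρ < 1
  growth : ∃ c : ℝ, 0 < c ∧ ∀ z, ‖F z‖ ≤ Real.exp (c * (1 + ‖z‖) ^ ρ)

/-- The multiplicity of `-μ` as a zero of `F`. -/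
def zeroMult (F : ℂ → ℂ) (μ : ℂ) : ℕ := analyticOrderNatAt F (-μ)

/-- Division of an entire function by the maximal power of a linear factor. -/
theorem exists_differentiable_eq_mul_pow {F : ℂ → ℂ} (hF : Differentiable ℂ F) {a : ℂ} (ha : a ≠ 0)
    (ho : analyticOrderAt F (-a) ≠ ⊤) :
    ∃ G : ℂ → ℂ, Differentiable ℂ G ∧ (∀ z, F z = (1 + z / a) ^ zeroMult F a * G z) ∧ G (-a) ≠ 0 := by
  obtain ⟨g, hg, hg0, hev⟩ :=
    ((hF.analyticAt (-a)).analyticOrderNatAt_eq_iff ho (n := zeroMult F a)).1 rfl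
  set n := zeroMult F a
  have hl : ∀ z, 1 + z / a = (z - -a) / a := fun z => by field_simp; ring
  have hne : ∀ z, z ≠ -a → 1 + z / a ≠ 0 := fun z hz => by
    rw [hl]; exact div_ne_zero (sub_ne_zero.2 hz) ha
  set G : ℂ → ℂ := Function.update (fun z => F z / (1 + z / a) ^ n) (-a) (a ^ n * g (-a)) with hG
  have hGloc : G =ᶠ[𝓝 (-a)] fun z => a ^ n * g z := by
    filter_upwards [hev] with z hz
    by_cases h : z = -a
    · subst h; simp [hG]
    · rw [hG, Function.update_of_ne h, hz, hl, div_pow, smul_eq_mul]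
      have := pow_ne_zero n (sub_ne_zero.2 h)
      field_simp
  refine ⟨G, fun z => ?_, fun z => ?_, ?_⟩
  · by_cases h : z = -a
    · subst h
      exact (hg.differentiableAt.const_mul _).congr_of_eventuallyEq hGloc
    · have : G =ᶠ[𝓝 z] fun z => F z / (1 + z / a) ^ n := by
        filter_upwards [isOpen_ne.mem_nhds h] with y hy
        rw [hG, Function.update_of_ne hy]
      refine DifferentiableAt.congr_of_eventuallyEq ?_ this
      exact (hF z).div (by fun_prop) (pow_ne_zero _ (hne z h))
  · by_cases h : z = -a
    · subst h
      have h1 := hev.self_of_nhds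
      rw [h1]
      simp only [hG, Function.update_self, hl, smul_eq_mul, sub_self, zero_div]
      rcases Nat.eq_zero_or_pos n with h0 | h0
      · simp [h0]
      · simp [h0.ne']
    · rw [hG, Function.update_of_ne h]
      rw [mul_div_cancel₀ _ (pow_ne_zero n (hne z h))]
  · rw [hG, Function.update_self]
    exact mul_ne_zero (pow_ne_zero _ ha) hg0

namespace IsEntireOfOrder

variable {F : ℂ → ℂ} {ρ : ℝ} (hF : IsEntireOfOrder F ρ)
include hF

theorem order_ne_top (z : ℂ) : analyticOrderAt F z ≠ ⊤ := by
  refine AnalyticOnNhd.analyticOrderAt_ne_top_of_isPreconnected (U := Set.univ) (x := 0)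
    (fun z _ => hF.differentiable.analyticAt z) isPreconnected_univ trivial trivial ?_
  rw [(hF.differentiable.analyticAt 0).analyticOrderAt_eq_zero.2 hF.ne_zero]
  exact ENat.zero_ne_top

theorem zeroMult_eq_zero_iff {μ : ℂ} : zeroMult F μ = 0 ↔ F (-μ) ≠ 0 := by
  rw [← (hF.differentiable.analyticAt (-μ)).analyticOrderAt_eq_zero,
    ← Nat.cast_analyticOrderNatAt (hF.order_ne_top (-μ))]
  exact (Nat.cast_eq_zero (R := ℕ∞)).symm

theorem zeroMult_zero : zeroMult F 0 = 0 := by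
  rw [hF.zeroMult_eq_zero_iff, neg_zero]; exact hF.ne_zero

/-- Zeros are removed one at a time; the last clause keeps the multiplicities of the remaining
zeros, which the induction needs. -/
theorem exists_factorization (S : Finset ℂ) (hS : ∀ μ ∈ S, μ ≠ 0) :
    ∃ G : ℂ → ℂ, Differentiable ℂ G ∧
      (∀ z, F z = (∏ μ ∈ S, (1 + z / μ) ^ zeroMult F μ) * G z) ∧ (∀ μ ∈ S, G (-μ) ≠ 0) ∧
      ∀ ν ∉ S, analyticOrderAt G (-ν) = analyticOrderAt F (-ν) := by
  induction S using Finset.induction_on with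
  | empty => exact ⟨F, hF.differentiable, by simp, by simp, by simp⟩
  | insert a S haS ih =>
    obtain ⟨G, hG, hFG, hne, hord⟩ := ih fun μ hμ => hS μ (Finset.mem_insert_of_mem hμ)
    have ha := hS a (Finset.mem_insert_self _ _)
    obtain ⟨G', hG', hGG', ha'⟩ := exists_differentiable_eq_mul_pow hG ha
      (by rw [hord a haS]; exact hF.order_ne_top _)
    have hm : zeroMult G a = zeroMult F a := by
      rw [zeroMult, zeroMult, analyticOrderNatAt, hord a haS, analyticOrderNatAt]
    refine ⟨G', hG', fun z => ?_, fun μ hμ => ?_, fun ν hν => ?_⟩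
    · rw [hFG, hGG', hm, Finset.prod_insert haS]; ring
    · rcases Finset.mem_insert.1 hμ with rfl | hμ
      · exact ha'
      · have := hne μ hμ
        rw [hGG'] at this
        exact right_ne_zero_of_mul this
    · rw [Finset.mem_insert, not_or] at hν
      rw [← hord ν hν.2]
      have h1 : G = (fun z => (1 + z / a) ^ zeroMult G a) * G' := funext hGG'
      have h2 : AnalyticAt ℂ (fun z => (1 + z / a) ^ zeroMult G a) (-ν) :=
        Differentiable.analyticAt (by fun_prop) _
      have h3 : analyticOrderAt (fun z => (1 + z / a) ^ zeroMult G a) (-ν) = 0 := by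
        rw [h2.analyticOrderAt_eq_zero]
        refine pow_ne_zero _ fun h => hν.1 ?_
        have : (-ν) / a = -1 := by linear_combination h
        rw [div_eq_iff ha] at this
        linear_combination -this
      conv_rhs => rw [h1]
      rw [analyticOrderAt_mul h2 (hG'.analyticAt _), h3, zero_add]

theorem finite_zeros (T : ℝ) : {μ : ℂ | F (-μ) = 0 ∧ ‖μ‖ ≤ T}.Finite := by
  by_contra hinf
  obtain ⟨x, -, hx⟩ := Set.Infinite.exists_accPt_of_subset_isCompact hinf
    (isCompact_closedBall (0 : ℂ) T) (fun μ hμ => mem_closedBall_zero_iff.2 hμ.2)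
  rw [accPt_iff_frequently_nhdsNE] at hx
  have h := AnalyticOnNhd.eqOn_zero_of_preconnected_of_frequently_eq_zero
    (f := fun z => F (-z)) (U := Set.univ)
    (fun z _ => Differentiable.analyticAt (hF.differentiable.comp differentiable_neg) z)
    isPreconnected_univ (Set.mem_univ x) (hx.mono fun y hy => hy.1) (Set.mem_univ 0)
  simp only [neg_zero, Pi.zero_apply] at h
  exact hF.ne_zero h

/-- The negatives of the zeros of `F` in the disk of radius `T`. -/
def zeros (T : ℝ) : Finset ℂ := (hF.finite_zeros T).toFinset

theorem mem_zeros {T : ℝ} {μ : ℂ} : μ ∈ hF.zeros T ↔ F (-μ) = 0 ∧ ‖μ‖ ≤ T := by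
  rw [zeros, Set.Finite.mem_toFinset]; rfl

theorem ne_zero_of_mem_zeros {T : ℝ} {μ : ℂ} (h : μ ∈ hF.zeros T) : μ ≠ 0 := by
  rintro rfl
  have := (hF.mem_zeros.1 h).1
  rw [neg_zero] at this
  exact hF.ne_zero this

/-- On the circle of radius 3T every factor 1 + z/μ with ‖μ‖ ≤ T has modulus at least 2, so G gains
a factor 2^N over F there, and the maximum principle carries this inside. At z = 0 it bounds the
number of zeros, in place of Jensen's formula; on the disc it bounds a logarithm of G from above. -/
theorem exists_bounded_quotient : ∃ c : ℝ, 0 < c ∧ ∀ T : ℝ, 1 ≤ T → ∃ G : ℂ → ℂ, Differentiable ℂ G ∧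
    (∀ z, F z = (∏ μ ∈ hF.zeros T, (1 + z / μ) ^ zeroMult F μ) * G z) ∧
    (∀ z, ‖z‖ ≤ T → G z ≠ 0) ∧ G 0 = F 0 ∧
    ∀ z, ‖z‖ ≤ T → 2 ^ (∑ μ ∈ hF.zeros T, zeroMult F μ) * ‖G z‖ ≤ Real.exp (c * T ^ ρ) := by
  obtain ⟨c, hc, hgr⟩ := hF.growth
  have hρ := hF.pos
  refine ⟨c * 4 ^ ρ, by positivity, fun T hT => ?_⟩
  obtain ⟨G, hG, hFG, hne, -⟩ := hF.exists_factorization (hF.zeros T)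
    fun μ hμ => hF.ne_zero_of_mem_zeros hμ
  refine ⟨G, hG, hFG, fun z hz h0 => ?_, ?_, fun z hz => ?_⟩
  · have h1 : F z = 0 := by rw [hFG, h0, mul_zero]
    have h2 := hne (-z) (hF.mem_zeros.2 ⟨by rwa [neg_neg], by rwa [norm_neg]⟩)
    rw [neg_neg] at h2
    exact h2 h0
  · have := hFG 0
    simpa using this.symm
  · set N := ∑ μ ∈ hF.zeros T, zeroMult F μ
    have hfr : ∀ w ∈ frontier (Metric.ball (0 : ℂ) (3 * T)),
        ‖G w‖ ≤ Real.exp (c * 4 ^ ρ * T ^ ρ) / 2 ^ N := by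
      intro w hw
      rw [frontier_ball _ (by positivity), mem_sphere_zero_iff_norm] at hw
      rw [le_div_iff₀ (by positivity)]
      have h1 : (2 : ℝ) ^ N ≤ ‖∏ μ ∈ hF.zeros T, (1 + w / μ) ^ zeroMult F μ‖ := by
        rw [norm_prod, ← Finset.prod_pow_eq_pow_sum]
        refine Finset.prod_le_prod (fun _ _ => by positivity) fun μ hμ => ?_
        rw [norm_pow]
        refine pow_le_pow_left₀ (by norm_num) ?_ _
        have h2 := (hF.mem_zeros.1 hμ).2
        have h3 : 0 < ‖μ‖ := norm_pos_iff.2 (hF.ne_zero_of_mem_zeros hμ)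
        have h4 : 3 ≤ ‖w / μ‖ := by
          rw [norm_div, hw, le_div_iff₀ h3]; linarith
        have h5 := norm_sub_norm_le (w / μ) (-1)
        rw [norm_neg, norm_one, sub_neg_eq_add, add_comm] at h5
        linarith
      have h6 := hgr w
      rw [hFG, norm_mul, hw] at h6
      calc ‖G w‖ * 2 ^ N ≤ ‖G w‖ * ‖∏ μ ∈ hF.zeros T, (1 + w / μ) ^ zeroMult F μ‖ := by gcongr
        _ ≤ Real.exp (c * (1 + 3 * T) ^ ρ) := by rw [mul_comm]; exact h6
        _ ≤ Real.exp (c * 4 ^ ρ * T ^ ρ) := by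
            apply Real.exp_le_exp.2
            rw [mul_assoc, ← Real.mul_rpow (by norm_num) (by linarith)]
            have : 1 + 3 * T ≤ 4 * T := by linarith
            gcongr
    have h := Complex.norm_le_of_forall_mem_frontier_norm_le Metric.isBounded_ball
      hG.diffContOnCl hfr (z := z) (subset_closure (mem_ball_zero_iff.2 (by linarith)))
    rw [le_div_iff₀ (by positivity)] at h
    linarith

theorem exists_counting_bound : ∃ c : ℝ, 0 < c ∧ ∀ T : ℝ, 1 ≤ T →
    ((∑ μ ∈ hF.zeros T, zeroMult F μ : ℕ) : ℝ) ≤ c * T ^ ρ := by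
  obtain ⟨c, hc, h⟩ := hF.exists_bounded_quotient
  have hl : 0 < Real.log 2 := Real.log_pos (by norm_num)
  refine ⟨(c + |Real.log ‖F 0‖|) / Real.log 2, by positivity, fun T hT => ?_⟩
  obtain ⟨G, -, -, -, hG0, hb⟩ := h T hT
  have h1 := hb 0 (by rw [norm_zero]; linarith)
  set N := ∑ μ ∈ hF.zeros T, zeroMult F μ
  have hF0 : 0 < ‖F 0‖ := norm_pos_iff.2 hF.ne_zero
  rw [hG0] at h1
  have h2 := Real.log_le_log (by positivity) h1
  rw [Real.log_exp, Real.log_mul (by positivity) hF0.ne', Real.log_pow] at h2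
  have h3 : 1 ≤ T ^ ρ := Real.one_le_rpow hT hF.pos.le
  rw [div_mul_eq_mul_div, le_div_iff₀ hl]
  have h4 := neg_abs_le (Real.log ‖F 0‖)
  have h5 : |Real.log ‖F 0‖| ≤ |Real.log ‖F 0‖| * T ^ ρ := le_mul_of_one_le_right (abs_nonneg _) h3
  linarith

theorem exists_norm_lower_bound : ∃ δ : ℝ, 0 < δ ∧ δ ≤ 1 ∧ ∀ μ, F (-μ) = 0 → δ ≤ ‖μ‖ := by
  have h : ∀ᶠ z in 𝓝 (0 : ℂ), F (-z) ≠ 0 := by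
    have : Tendsto (fun z => F (-z)) (𝓝 0) (𝓝 (F 0)) := by
      have := (hF.differentiable.comp differentiable_neg).continuous.tendsto (0 : ℂ)
      simpa [Function.comp_def] using this
    exact this.eventually_ne hF.ne_zero
  obtain ⟨δ, hδ, hb⟩ := Metric.eventually_nhds_iff.1 h
  refine ⟨min δ 1, by positivity, min_le_right _ _, fun μ hμ => ?_⟩
  by_contra! hlt
  refine hb (y := μ) ?_ hμ
  rw [dist_zero_right]
  exact hlt.trans_le (min_le_left _ _)

/-- The zeros are grouped in dyadic shells. By the counting bound, shell k contributes a constant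
times 2^(k(ρ-σ)), a convergent geometric series. -/
theorem summable_zeroMult_mul_rpow {σ : ℝ} (hσ : ρ < σ) :
    Summable fun μ : ℂ => (zeroMult F μ : ℝ) * ‖μ‖ ^ (-σ) := by
  obtain ⟨c, hc, hcount⟩ := hF.exists_counting_bound
  obtain ⟨δ, hδ, hδ1, hlow⟩ := hF.exists_norm_lower_bound
  have hσ0 : 0 < σ := hF.pos.trans hσ
  -- Zeros in shell 0 satisfy ‖μ‖ ≥ δ. In shell k ≥ 1 one has ‖μ‖ ≥ 2^(k-1), which costs a factor
  -- 2^σ against 2^k.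
  set A := max (δ ^ (-σ)) (2 ^ σ)
  have hA : 0 < A := by positivity
  have hex : ∀ μ : ℂ, ∃ k : ℕ, ‖μ‖ ≤ 2 ^ k := fun μ => by
    obtain ⟨k, hk⟩ := pow_unbounded_of_one_lt ‖μ‖ (one_lt_two : (1 : ℝ) < 2)
    exact ⟨k, hk.le⟩
  set κ : ℂ → ℕ := fun μ => Nat.find (hex μ)
  have hκ : ∀ μ, ‖μ‖ ≤ 2 ^ κ μ := fun μ => Nat.find_spec (hex μ)
  have hterm : ∀ μ, (zeroMult F μ : ℝ) * ‖μ‖ ^ (-σ) ≤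
      A * (zeroMult F μ * ((2 : ℝ) ^ (-σ)) ^ κ μ) := by
    intro μ
    rcases Nat.eq_zero_or_pos (zeroMult F μ) with h0 | h0
    · simp [h0]
    have hz : F (-μ) = 0 := by
      by_contra h; exact h0.ne' (hF.zeroMult_eq_zero_iff.2 h)
    have hμ := hlow μ hz
    rw [mul_left_comm]
    refine mul_le_mul_of_nonneg_left ?_ (by positivity)
    rcases Nat.eq_zero_or_pos (κ μ) with hk | hk
    · rw [hk, pow_zero, mul_one]
      exact (Real.rpow_le_rpow_of_nonpos hδ hμ (by linarith)).trans (le_max_left _ _)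
    · have h1 : (2 : ℝ) ^ (κ μ - 1) ≤ ‖μ‖ := by
        by_contra! h
        have := Nat.find_min (hex μ) (m := κ μ - 1) (by simp only [κ] at hk ⊢; omega)
        exact this h.le
      have h2 := Real.rpow_le_rpow_of_nonpos (by positivity) h1 (by linarith : -σ ≤ 0)
      refine h2.trans ?_
      have h3 : ((2 : ℝ) ^ (κ μ - 1)) ^ (-σ) = 2 ^ σ * (2 ^ (-σ)) ^ κ μ := by
        obtain ⟨j, hj⟩ := Nat.exists_eq_succ_of_ne_zero hk.ne'
        rw [hj, Nat.succ_eq_add_one, Nat.add_sub_cancel, pow_succ, mul_left_comm,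
          ← Real.rpow_add (by norm_num), add_neg_cancel, Real.rpow_zero, mul_one,
          ← Real.rpow_natCast, ← Real.rpow_natCast, ← Real.rpow_mul (by norm_num),
          ← Real.rpow_mul (by norm_num), mul_comm]
      rw [h3]
      exact mul_le_mul_of_nonneg_right (le_max_right _ _) (by positivity)
  set q : ℝ := (2 : ℝ) ^ (-σ) * 2 ^ ρ
  have hq0 : 0 < q := by positivity
  have hq1 : q < 1 := by
    have : q = 2 ^ (-σ + ρ) := (Real.rpow_add (by norm_num) _ _).symm
    rw [this]
    exact Real.rpow_lt_one_of_one_lt_of_neg (by norm_num) (by linarith)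
  have hgeo := summable_geometric_of_lt_one hq0.le hq1
  refine summable_of_sum_le (c := A * (c * ∑' k, q ^ k)) (fun μ => by positivity) fun s => ?_
  classical
  have hfib : ∑ μ ∈ s, (zeroMult F μ : ℝ) * ((2 : ℝ) ^ (-σ)) ^ κ μ =
      ∑ k ∈ s.image κ, ∑ μ ∈ s with κ μ = k, (zeroMult F μ : ℝ) * ((2 : ℝ) ^ (-σ)) ^ κ μ :=
    (Finset.sum_fiberwise_of_maps_to (fun i hi => Finset.mem_image_of_mem κ hi) _).symm
  calc ∑ μ ∈ s, (zeroMult F μ : ℝ) * ‖μ‖ ^ (-σ)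
      ≤ ∑ μ ∈ s, A * (zeroMult F μ * ((2 : ℝ) ^ (-σ)) ^ κ μ) := Finset.sum_le_sum fun μ _ => hterm μ
    _ = A * ∑ k ∈ s.image κ, ∑ μ ∈ s with κ μ = k, (zeroMult F μ : ℝ) * ((2 : ℝ) ^ (-σ)) ^ κ μ := by
        rw [← Finset.mul_sum, hfib]
    _ ≤ A * ∑ k ∈ s.image κ, c * q ^ k := by
        gcongr with k hk
        have h1 : ∑ μ ∈ s with κ μ = k, (zeroMult F μ : ℝ) * ((2 : ℝ) ^ (-σ)) ^ κ μ =
            (∑ μ ∈ s with κ μ = k, (zeroMult F μ : ℝ)) * ((2 : ℝ) ^ (-σ)) ^ k := by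
          rw [Finset.sum_mul]
          refine Finset.sum_congr rfl fun μ hμ => ?_
          rw [(Finset.mem_filter.1 hμ).2]
        have h2 : ∑ μ ∈ s with κ μ = k, (zeroMult F μ : ℝ) ≤ c * ((2 : ℝ) ^ k) ^ ρ := by
          refine le_trans ?_ (hcount (2 ^ k) (one_le_pow₀ (by norm_num)))
          push_cast
          rw [← Finset.sum_filter_ne_zero]
          refine Finset.sum_le_sum_of_subset_of_nonneg (fun μ hμ => ?_) fun _ _ _ => by positivity
          simp only [Finset.mem_filter, ne_eq, Nat.cast_eq_zero] at hμ
          refine hF.mem_zeros.2 ⟨?_, hμ.1.2 ▸ hκ μ⟩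
          by_contra h
          exact hμ.2 (hF.zeroMult_eq_zero_iff.2 h)
        rw [h1]
        refine (mul_le_mul_of_nonneg_right h2 (by positivity)).trans (le_of_eq ?_)
        rw [mul_pow, mul_assoc, mul_comm (((2 : ℝ) ^ k) ^ ρ)]
        congr 2
        rw [← Real.rpow_natCast, ← Real.rpow_natCast, ← Real.rpow_mul (by norm_num),
          ← Real.rpow_mul (by norm_num), mul_comm]
    _ = A * (c * ∑ k ∈ s.image κ, q ^ k) := by simp_rw [Finset.mul_sum]
    _ ≤ A * (c * ∑' k, q ^ k) := by
        gcongr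
        exact hgeo.sum_le_tsum _ fun _ _ => by positivity

theorem summable_zeroMult_div (z : ℂ) : Summable fun μ : ℂ => (zeroMult F μ : ℂ) / (z + μ) := by
  have h1 := (hF.summable_zeroMult_mul_rpow hF.lt_one).mul_left 2
  refine Summable.of_norm_bounded_eventually h1 ?_
  have hfin := hF.finite_zeros (2 * ‖z‖ + 1)
  filter_upwards [hfin.compl_mem_cofinite] with μ hμ
  rcases Nat.eq_zero_or_pos (zeroMult F μ) with h0 | h0
  · simp [h0]
  have hz : F (-μ) = 0 := by
    by_contra h; exact h0.ne' (hF.zeroMult_eq_zero_iff.2 h)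
  have hμ2 : 2 * ‖z‖ + 1 < ‖μ‖ := by
    by_contra! h
    exact hμ ⟨hz, h⟩
  have hz0 := norm_nonneg z
  have h3 : ‖μ‖ / 2 ≤ ‖z + μ‖ := by
    have := norm_sub_norm_le μ (-z)
    rw [norm_neg, sub_neg_eq_add, add_comm] at this
    linarith
  have h4 : 0 < ‖μ‖ := by linarith
  rw [norm_div, Complex.norm_natCast, Real.rpow_neg_one, mul_left_comm]
  refine (div_le_div_of_nonneg_left (by positivity) (by positivity) h3).trans (le_of_eq ?_)
  field_simp

/-- Hadamard's product in logarithmic form. Once the zeros of modulus at most n are divided out, the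
quotient is F(0) e^h on the disc of radius n, with Re h = O(n^ρ). Borel-Carathéodory and Cauchy's
estimate give h'(z) = O(n^(ρ-1)), which tends to 0 as ρ < 1. -/
theorem hasSum_zeroMult_div {z : ℂ} (hz : F z ≠ 0) :
    HasSum (fun μ : ℂ => (zeroMult F μ : ℂ) / (z + μ)) (logDeriv F z) := by
  obtain ⟨c, hc, hq⟩ := hF.exists_bounded_quotient
  have hs := hF.summable_zeroMult_div z
  have hFz : ∀ μ : ℂ, zeroMult F μ ≠ 0 → F (-μ) = 0 := by
    intro μ hμ
    by_contra h
    exact hμ (hF.zeroMult_eq_zero_iff.2 h)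
  have hlim1 : Tendsto (fun n : ℕ => ∑ μ ∈ hF.zeros n, (zeroMult F μ : ℂ) / (z + μ)) atTop
      (𝓝 (∑' μ, (zeroMult F μ : ℂ) / (z + μ))) := by
    have h := tendsto_tsum_of_dominated_convergence (𝓕 := atTop)
      (f := fun (n : ℕ) (μ : ℂ) => if μ ∈ hF.zeros n then (zeroMult F μ : ℂ) / (z + μ) else 0)
      (g := fun μ => (zeroMult F μ : ℂ) / (z + μ)) hs.norm
      (fun μ => by
        refine tendsto_const_nhds.congr' ?_
        filter_upwards [eventually_ge_atTop ⌈‖μ‖⌉₊] with n hn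
        split_ifs with h
        · rfl
        · have : zeroMult F μ = 0 := by
            by_contra h0
            exact h (hF.mem_zeros.2 ⟨hFz μ h0, (Nat.le_ceil _).trans (by exact_mod_cast hn)⟩)
          simp [this])
      (Eventually.of_forall fun n μ => by
        split_ifs
        · exact le_rfl
        · rw [norm_zero]; positivity)
    refine h.congr fun n => ?_
    rw [tsum_eq_sum (s := hF.zeros n) fun μ hμ => if_neg hμ]
    exact Finset.sum_congr rfl fun μ hμ => if_pos hμ
  have hlim2 : Tendsto (fun n : ℕ => logDeriv F z - ∑ μ ∈ hF.zeros n, (zeroMult F μ : ℂ) / (z + μ))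
      atTop (𝓝 0) := by
    set b := |Real.log ‖F 0‖| + 1
    have hbd : ∀ᶠ n : ℕ in atTop,
        ‖logDeriv F z - ∑ μ ∈ hF.zeros n, (zeroMult F μ : ℂ) / (z + μ)‖ ≤
          8 * (c * (n : ℝ) ^ (ρ - 1) + b * (n : ℝ)⁻¹) := by
      filter_upwards [eventually_ge_atTop (max 1 ⌈4 * ‖z‖⌉₊)] with n hn
      have hn1 : (1 : ℝ) ≤ n := by exact_mod_cast (le_max_left _ _).trans hn
      have hnz : 4 * ‖z‖ ≤ n :=
        (Nat.le_ceil _).trans (by exact_mod_cast (le_max_right _ _).trans hn)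
      set T : ℝ := (n : ℝ)
      have hT0 : 0 < T := by linarith
      obtain ⟨G, hG, hFG, hne, hG0, hb⟩ := hq T hn1
      have hzn : ‖z‖ ≤ T := by linarith [norm_nonneg z]
      have hGz := hne z hzn
      have hfac : ∀ μ ∈ hF.zeros T, 1 + z / μ ≠ 0 := by
        intro μ hμ h
        have hμ0 := hF.ne_zero_of_mem_zeros hμ
        have : z = -μ := by
          have h1 : z / μ = -1 := by linear_combination h
          rw [div_eq_iff hμ0] at h1
          linear_combination h1
        exact hz (this ▸ (hF.mem_zeros.1 hμ).1)
      have hld : logDeriv F z - ∑ μ ∈ hF.zeros T, (zeroMult F μ : ℂ) / (z + μ) = logDeriv G z := by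
        have h1 : F = fun z => (∏ μ ∈ hF.zeros T, (1 + z / μ) ^ zeroMult F μ) * G z := funext hFG
        have h2 : logDeriv F z =
            logDeriv (fun z => ∏ μ ∈ hF.zeros T, (1 + z / μ) ^ zeroMult F μ) z + logDeriv G z := by
          conv_lhs => rw [h1]
          exact logDeriv_mul z (Finset.prod_ne_zero_iff.2 fun μ hμ => pow_ne_zero _ (hfac μ hμ)) hGz
            (by fun_prop) (hG z)
        rw [h2, logDeriv_prod (f := fun μ z => (1 + z / μ) ^ zeroMult F μ) (fun μ hμ => pow_ne_zero _ (hfac μ hμ)) fun μ hμ => by fun_prop,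
          add_sub_right_comm, sub_eq_zero.2, zero_add]
        refine Finset.sum_congr rfl fun μ hμ => ?_
        rw [logDeriv_fun_pow (by fun_prop), logDeriv_apply, mul_div_assoc']
        have hμ0 := hF.ne_zero_of_mem_zeros hμ
        have h3 := hfac μ hμ
        have h4 : z + μ = μ * (1 + z / μ) := by field_simp; ring
        rw [h4]
        have h5 : deriv (fun x => 1 + x / μ) z = 1 / μ := by
          simp
        rw [h5]
        field_simp
      rw [hld]
      have hF0 : 0 < ‖F 0‖ := norm_pos_iff.2 hF.ne_zero
      -- A primitive of G'/G on the disc, normalised by h(0) = 0, is a logarithm of G / F(0).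
      obtain ⟨h, hh0, hh⟩ := (DifferentiableOn.isExactOn_ball (c := 0) (r := T)
        (f := fun w => deriv G w / G w) (fun w hw => by
          refine DifferentiableAt.differentiableWithinAt ?_
          exact ((hG.analyticAt w).deriv.differentiableAt).div (hG w)
            (hne w (mem_ball_zero_iff.1 hw).le))).with_val_at 0 0
      have hexp : ∀ w ∈ Metric.ball (0 : ℂ) T, G w = F 0 * Complex.exp (h w) := by
        have hd : ∀ w ∈ Metric.ball (0 : ℂ) T,
            HasDerivAt (fun w => G w * Complex.exp (-h w)) 0 w := by
          intro w hw
          have h1 := (hG w).hasDerivAt.mul ((hh w hw).neg.cexp)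
          refine HasDerivAt.congr_deriv h1 ?_
          have := hne w (mem_ball_zero_iff.1 hw).le
          field_simp
          ring
        intro w hw
        have h2 := Metric.isOpen_ball.is_const_of_deriv_eq_zero
          (convex_ball (0 : ℂ) T).isPreconnected
          (fun w hw => (hd w hw).differentiableAt.differentiableWithinAt)
          (fun w hw => (hd w hw).deriv) hw (Metric.mem_ball_self hT0)
        simp only [hh0, neg_zero, Complex.exp_zero, mul_one, hG0] at h2
        rw [← h2, mul_assoc, ← Complex.exp_add, neg_add_cancel, Complex.exp_zero, mul_one]
      set M := c * T ^ ρ + b with hM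
      have hM0 : 0 < M := by positivity
      have hre : Set.MapsTo h (Metric.ball 0 T) {z | z.re ≤ M} := by
        intro w hw
        have h1 := hb w (mem_ball_zero_iff.1 hw).le
        have h2 : ‖G w‖ ≤ Real.exp (c * T ^ ρ) :=
          le_trans (le_mul_of_one_le_left (norm_nonneg _) (one_le_pow₀ (by norm_num))) h1
        rw [hexp w hw, norm_mul, Complex.norm_exp] at h2
        have h3 := Real.log_le_log (by positivity) h2
        rw [Real.log_exp, Real.log_mul hF0.ne' (Real.exp_pos _).ne', Real.log_exp] at h3
        have h4 := neg_abs_le (Real.log ‖F 0‖)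
        change (h w).re ≤ M
        simp only [hM, b]
        linarith
      have hhd : DifferentiableOn ℂ h (Metric.ball 0 T) := fun w hw =>
        (hh w hw).differentiableAt.differentiableWithinAt
      have hhb : ∀ w, ‖w‖ ≤ T / 2 → ‖h w‖ ≤ 2 * M := by
        intro w hw
        have h1 := Complex.borelCaratheodory_zero hM0 hhd hre hT0
          (mem_ball_zero_iff.2 (by linarith : ‖w‖ < T)) hh0
        refine h1.trans ?_
        rw [div_le_iff₀ (by linarith)]
        have : ‖w‖ ≤ T - ‖w‖ := by linarith
        gcongr
      have hsub : Metric.closedBall z (T / 4) ⊆ Metric.ball 0 T := by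
        intro w hw
        rw [mem_closedBall_iff_norm] at hw
        rw [mem_ball_zero_iff]
        have := norm_le_norm_add_norm_sub' w z
        linarith
      -- Since ‖z‖ ≤ T/4, the circle of radius T/4 about z stays in the disc of radius T/2, where h
      -- is bounded by 2M. Cauchy's estimate is then 8M/T.
      have hder := Complex.norm_deriv_le_of_forall_mem_sphere_norm_le (c := z) (R := T / 4)
        (C := 2 * M) (f := h) (by positivity)
        ((hhd.mono (by
          rw [closure_ball z (by positivity)]
          exact hsub)).diffContOnCl) (fun w hw => hhb w (by
            rw [mem_sphere_iff_norm] at hw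
            have := norm_le_norm_add_norm_sub' w z
            linarith))
      rw [(hh z (mem_ball_zero_iff.2 (by linarith [norm_nonneg z]))).deriv] at hder
      rw [logDeriv_apply]
      refine hder.trans (le_of_eq ?_)
      rw [Real.rpow_sub_one hT0.ne']
      field_simp
      ring
    refine squeeze_zero_norm' hbd ?_
    have h1 : Tendsto (fun n : ℕ => (n : ℝ) ^ (ρ - 1)) atTop (𝓝 0) := by
      have := tendsto_rpow_neg_atTop (y := 1 - ρ) (by linarith [hF.lt_one])
      simp only [neg_sub] at this
      exact this.comp tendsto_natCast_atTop_atTop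
    have h2 : Tendsto (fun n : ℕ => (n : ℝ)⁻¹) atTop (𝓝 0) := tendsto_inv_atTop_nhds_zero_nat
    have := ((h1.const_mul c).add (h2.const_mul b)).const_mul 8
    simpa using this
  have h3 := hlim2.add hlim1
  simp only [sub_add_cancel, zero_add] at h3
  rw [tendsto_nhds_unique tendsto_const_nhds h3]
  exact hs.hasSum

/-- An entire function of order less than one without zeros is constant. -/
theorem eq_const_of_forall_ne_zero (h : ∀ z, F z ≠ 0) (z : ℂ) : F z = F 0 := by
  have hm : ∀ μ, zeroMult F μ = 0 := fun μ => hF.zeroMult_eq_zero_iff.2 (h _)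
  refine is_const_of_deriv_eq_zero hF.differentiable (fun w => ?_) z 0
  have h1 := (hF.hasSum_zeroMult_div (h w)).tsum_eq
  simp only [hm, Nat.cast_zero, zero_div, tsum_zero, logDeriv_apply] at h1
  exact (div_eq_zero_iff.1 h1.symm).resolve_right (h w)

end IsEntireOfOrder

/-! ### The Mellin transform of x ↦ 1/(x + μ). -/

/-- The difference of the two sides is (‖μ‖ - Re μ)(x - ‖μ‖)². -/
theorem norm_ofReal_add_ge (x : ℝ) (μ : ℂ) :
    (‖μ‖ + μ.re) * (x + ‖μ‖) ^ 2 ≤ 2 * ‖μ‖ * ‖(x : ℂ) + μ‖ ^ 2 := by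
  have h1 : ‖(x : ℂ) + μ‖ ^ 2 = x ^ 2 + 2 * x * μ.re + ‖μ‖ ^ 2 := by
    rw [Complex.sq_norm, Complex.sq_norm, Complex.normSq_apply, Complex.normSq_apply]
    simp
    ring
  have h2 := Complex.re_le_norm μ
  have h3 : 0 ≤ (‖μ‖ - μ.re) * (x - ‖μ‖) ^ 2 := mul_nonneg (by linarith) (sq_nonneg _)
  rw [h1]
  nlinarith

theorem norm_add_re_pos {μ : ℂ} (hμ : μ ∈ Complex.slitPlane) : 0 < ‖μ‖ + μ.re := by
  rcases hμ with h | h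
  · linarith [norm_nonneg μ]
  · have := Complex.abs_re_lt_norm.2 h
    linarith [neg_abs_le μ.re]

/-- A point of the slit plane stays away from the negative real axis. -/
theorem exists_mul_add_le_norm_add {μ : ℂ} (hμ : μ ∈ Complex.slitPlane) :
    ∃ c : ℝ, 0 < c ∧ ∀ x : ℝ, 0 ≤ x → c * (x + ‖μ‖) ≤ ‖(x : ℂ) + μ‖ := by
  have h0 : 0 < ‖μ‖ := norm_pos_iff.2 (Complex.slitPlane_ne_zero hμ)
  have h1 := norm_add_re_pos hμ
  refine ⟨Real.sqrt ((‖μ‖ + μ.re) / (2 * ‖μ‖)), by positivity, fun x hx => ?_⟩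
  rw [← sq_le_sq₀ (by positivity) (norm_nonneg _), mul_pow, Real.sq_sqrt (by positivity),
    div_mul_eq_mul_div, div_le_iff₀ (by positivity)]
  linarith [norm_ofReal_add_ge x μ]

/-- In the right half plane the constant does not depend on μ, which allows infinitely many zeros at
once. -/
theorem add_le_two_mul_norm_add {μ : ℂ} (hμ : 0 ≤ μ.re) {x : ℝ} (hx : 0 ≤ x) :
    1 / 2 * (x + ‖μ‖) ≤ ‖(x : ℂ) + μ‖ := by
  rcases eq_or_ne μ 0 with rfl | h
  · simp [abs_of_nonneg hx]; linarith
  have h0 : 0 < ‖μ‖ := norm_pos_iff.2 h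
  have h1 := norm_ofReal_add_ge x μ
  rw [← sq_le_sq₀ (by positivity) (norm_nonneg _)]
  have h2 : ‖μ‖ * (x + ‖μ‖) ^ 2 ≤ ‖μ‖ * (2 * ‖(x : ℂ) + μ‖ ^ 2) := by
    have : 0 ≤ μ.re * (x + ‖μ‖) ^ 2 := by positivity
    linarith
  have h3 := le_of_mul_le_mul_left h2 h0
  rw [mul_pow]
  nlinarith [sq_nonneg ‖(x : ℂ) + μ‖]

theorem ofReal_add_ne_zero {μ : ℂ} (hμ : μ ∈ Complex.slitPlane) {x : ℝ} (hx : 0 ≤ x) :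
    (x : ℂ) + μ ≠ 0 := by
  obtain ⟨c, hc, h⟩ := exists_mul_add_le_norm_add hμ
  have h0 : 0 < ‖μ‖ := norm_pos_iff.2 (Complex.slitPlane_ne_zero hμ)
  have := h x hx
  have h1 : 0 < c * (x + ‖μ‖) := by positivity
  exact norm_pos_iff.1 (h1.trans_le this)

theorem continuousOn_ofReal_add_inv {μ : ℂ} (hμ : μ ∈ Complex.slitPlane) :
    ContinuousOn (fun x : ℝ => ((x : ℂ) + μ)⁻¹) (Set.Ici 0) :=
  ContinuousOn.inv₀ (by fun_prop) fun _ hx => ofReal_add_ne_zero hμ hx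

theorem mellinConvergent_ofReal_add_inv {μ : ℂ} (hμ : μ ∈ Complex.slitPlane) {s : ℂ}
    (h0 : 0 < s.re) (h1 : s.re < 1) : MellinConvergent (fun x : ℝ => ((x : ℂ) + μ)⁻¹) s := by
  obtain ⟨c, hc, h⟩ := exists_mul_add_le_norm_add hμ
  have hμ0 : 0 < ‖μ‖ := norm_pos_iff.2 (Complex.slitPlane_ne_zero hμ)
  refine mellinConvergent_of_isBigO_rpow (a := 1) (b := 0)
    (((continuousOn_ofReal_add_inv hμ).mono Set.Ioi_subset_Ici_self).locallyIntegrableOn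
      measurableSet_Ioi) ?_ h1 ?_ h0
  · refine Asymptotics.IsBigO.of_bound c⁻¹ ?_
    filter_upwards [eventually_gt_atTop 0] with x hx
    rw [norm_inv, Real.rpow_neg_one, norm_inv, Real.norm_of_nonneg hx.le, ← mul_inv]
    refine inv_anti₀ (by positivity) (le_trans ?_ (h x hx.le))
    gcongr
    linarith
  · refine Asymptotics.IsBigO.of_bound (c * ‖μ‖)⁻¹ ?_
    filter_upwards [self_mem_nhdsWithin] with x hx
    have hx0 : 0 < x := hx
    rw [norm_inv, neg_zero, Real.rpow_zero, norm_one, mul_one]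
    refine inv_anti₀ (by positivity) (le_trans ?_ (h x hx0.le))
    gcongr
    linarith

/-- Write 1/(x + a) as the integral of e^{-t(x+a)} over t > 0. Fubini turns the transform into
Γ(s)Γ(1-s)a^(s-1), and the reflection formula finishes. -/
theorem mellin_ofReal_add_inv_of_pos {a : ℝ} (ha : 0 < a) {s : ℂ} (h0 : 0 < s.re)
    (h1 : s.re < 1) : mellin (fun x : ℝ => ((x : ℂ) + a)⁻¹) s =
      Real.pi / Complex.sin (Real.pi * s) * (a : ℂ) ^ (s - 1) := by
  have ha' : (a : ℂ) ∈ Complex.slitPlane := Complex.ofReal_mem_slitPlane.2 ha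
  set f : ℝ → ℝ → ℂ := fun x t => (x : ℂ) ^ (s - 1) * Real.exp (-(t * (x + a)))
  have hexp : ∀ r : ℝ, 0 < r → ∫ t in Set.Ioi (0 : ℝ), Real.exp (-(t * r)) = r⁻¹ := by
    intro r hr
    have := integral_exp_mul_Ioi (a := -r) (by linarith) 0
    simp only [mul_zero, Real.exp_zero] at this
    rw [neg_div_neg_eq, one_div] at this
    rw [← this]
    refine setIntegral_congr_fun measurableSet_Ioi fun t _ => ?_
    congr 1
    ring
  have hint : ∀ r : ℝ, 0 < r → IntegrableOn (fun t => Real.exp (-(t * r))) (Set.Ioi 0) := by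
    intro r hr
    have := integrableOn_exp_mul_Ioi (a := -r) (by linarith) 0
    refine this.congr_fun (fun t _ => ?_) measurableSet_Ioi
    simp only; congr 1; ring
  have hmeas : AEStronglyMeasurable (Function.uncurry f)
      ((volume.restrict (Set.Ioi 0)).prod (volume.restrict (Set.Ioi 0))) := by
    have : Measurable (Function.uncurry f) := by
      simp only [f, Function.uncurry_def]
      fun_prop
    exact this.aestronglyMeasurable
  have hprod : Integrable (Function.uncurry f)
      ((volume.restrict (Set.Ioi 0)).prod (volume.restrict (Set.Ioi 0))) := by
    rw [integrable_prod_iff hmeas]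
    constructor
    · filter_upwards [ae_restrict_mem measurableSet_Ioi] with x hx
      have hx0 : (0 : ℝ) < x := hx
      have hxa : 0 < x + a := by linarith
      exact ((hint (x + a) hxa).ofReal (𝕜 := ℂ)).const_mul ((x : ℂ) ^ (s - 1))
    · have hm := (mellinConvergent_ofReal_add_inv ha' h0 h1).norm
      refine hm.congr ?_
      filter_upwards [ae_restrict_mem measurableSet_Ioi] with x hx
      have hx0 : (0 : ℝ) < x := hx
      simp only [f, Function.uncurry_apply_pair, norm_mul, smul_eq_mul, norm_inv]
      rw [integral_const_mul]
      congr 1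
      have : ∀ t : ℝ, ‖((Real.exp (-(t * (x + a))) : ℝ) : ℂ)‖ = Real.exp (-(t * (x + a))) := fun t => by
        rw [Complex.norm_real, Real.norm_of_nonneg (Real.exp_pos _).le]
      simp_rw [this]
      rw [hexp _ (by linarith), ← Complex.ofReal_add, Complex.norm_real, Real.norm_of_nonneg (by linarith)]
  have hswap := integral_integral_swap hprod
  have hL : ∫ x in Set.Ioi (0 : ℝ), ∫ t in Set.Ioi (0 : ℝ), f x t =
      mellin (fun x : ℝ => ((x : ℂ) + a)⁻¹) s := by
    refine setIntegral_congr_fun measurableSet_Ioi fun x hx => ?_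
    have hx0 : (0 : ℝ) < x := hx
    simp only [f, smul_eq_mul]
    rw [integral_const_mul, integral_complex_ofReal, hexp _ (by linarith)]
    push_cast
    rfl
  have hR : ∫ t in Set.Ioi (0 : ℝ), ∫ x in Set.Ioi (0 : ℝ), f x t =
      Complex.Gamma s * Complex.Gamma (1 - s) * (a : ℂ) ^ (s - 1) := by
    have h2 : ∀ t ∈ Set.Ioi (0 : ℝ), ∫ x in Set.Ioi (0 : ℝ), f x t =
        Complex.Gamma s * ((t : ℂ) ^ ((1 - s) - 1) * Complex.exp (-(a * t))) := by
      intro t ht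
      have ht0 : (0 : ℝ) < t := ht
      have h3 := Complex.integral_cpow_mul_exp_neg_mul_Ioi h0 (r := t) (by simpa using ht0)
      have h4 : ∀ x : ℝ, f x t = (x : ℂ) ^ (s - 1) * Complex.exp (-(t * x)) * Complex.exp (-(a * t)) := by
        intro x
        simp only [f]
        rw [mul_assoc, ← Complex.exp_add, Complex.ofReal_exp]
        push_cast
        congr 2
        ring
      simp_rw [h4]
      rw [integral_mul_const, h3, one_div, Complex.inv_cpow _ _ (by
        rw [Complex.arg_ofReal_of_nonneg ht0.le]; exact Real.pi_pos.ne), ← Complex.cpow_neg,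
        show (1 : ℂ) - s - 1 = -s by ring]
      ring
    rw [setIntegral_congr_fun measurableSet_Ioi h2, integral_const_mul,
      Complex.integral_cpow_mul_exp_neg_mul_Ioi (a := 1 - s) (by simpa using h1)
        (r := a) (by simpa using ha), one_div, Complex.inv_cpow _ _ (by
        rw [Complex.arg_ofReal_of_nonneg ha.le]; exact Real.pi_pos.ne), ← Complex.cpow_neg, neg_sub]
    ring
  rw [← hL, hswap, hR, Complex.Gamma_mul_Gamma_one_sub]

theorem differentiableOn_mellin_ofReal_add_inv {s : ℂ} (h0 : 0 < s.re) (h1 : s.re < 1) :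
    DifferentiableOn ℂ (fun μ : ℂ => mellin (fun x : ℝ => ((x : ℂ) + μ)⁻¹) s) Complex.slitPlane := by
  intro μ hμ
  refine DifferentiableAt.differentiableWithinAt ?_
  obtain ⟨c, hc, h⟩ := exists_mul_add_le_norm_add hμ
  have hμ0 : 0 < ‖μ‖ := norm_pos_iff.2 (Complex.slitPlane_ne_zero hμ)
  set ε := c * ‖μ‖ / 2 with hε
  have hε0 : 0 < ε := by positivity
  have hlow : ∀ ν ∈ Metric.ball μ ε, ∀ x : ℝ, 0 ≤ x → c / 2 * (x + ‖μ‖) ≤ ‖(x : ℂ) + ν‖ := by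
    intro ν hν x hx
    rw [mem_ball_iff_norm] at hν
    have h2 := h x hx
    have h3 : ‖(x : ℂ) + μ‖ ≤ ‖(x : ℂ) + ν‖ + ‖ν - μ‖ := by
      have := norm_sub_le ((x : ℂ) + ν) (ν - μ)
      rwa [show (x : ℂ) + ν - (ν - μ) = x + μ by ring] at this
    have : 0 ≤ c * x := by positivity
    nlinarith
  set C := (c / 2)⁻¹ ^ 2 * ‖μ‖⁻¹
  have hbi : IntegrableOn (fun x : ℝ => C * ‖(x : ℂ) ^ (s - 1) • ((x : ℂ) + (‖μ‖ : ℝ))⁻¹‖)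
      (Set.Ioi 0) :=
    ((mellinConvergent_ofReal_add_inv (Complex.ofReal_mem_slitPlane.2 hμ0) h0 h1).norm).const_mul C
  have hcp : ContinuousOn (fun x : ℝ => (x : ℂ) ^ (s - 1)) (Set.Ioi 0) := fun x hx =>
    (Complex.continuousAt_ofReal_cpow_const _ _ (Or.inr (ne_of_gt hx))).continuousWithinAt
  have key := hasDerivAt_integral_of_dominated_loc_of_deriv_le (𝕜 := ℂ)
    (μ := volume.restrict (Set.Ioi (0 : ℝ))) (x₀ := μ)
    (F := fun ν (x : ℝ) => (x : ℂ) ^ (s - 1) • ((x : ℂ) + ν)⁻¹)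
    (F' := fun ν (x : ℝ) => (x : ℂ) ^ (s - 1) • (-1 / ((x : ℂ) + ν) ^ 2))
    (bound := fun x : ℝ => C * ‖(x : ℂ) ^ (s - 1) • ((x : ℂ) + (‖μ‖ : ℝ))⁻¹‖)
    (Metric.ball_mem_nhds μ hε0)
    (by
      filter_upwards [Complex.isOpen_slitPlane.mem_nhds hμ] with ν hν
      exact (hcp.smul ((continuousOn_ofReal_add_inv hν).mono
        Set.Ioi_subset_Ici_self)).aestronglyMeasurable measurableSet_Ioi)
    (mellinConvergent_ofReal_add_inv hμ h0 h1)
    (by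
      refine ContinuousOn.aestronglyMeasurable ?_ measurableSet_Ioi
      refine hcp.smul (ContinuousOn.div (by fun_prop) (by fun_prop) fun x hx => ?_)
      exact pow_ne_zero _ (ofReal_add_ne_zero hμ (le_of_lt hx)))
    (by
      filter_upwards [ae_restrict_mem measurableSet_Ioi] with x hx ν hν
      have hx0 : (0 : ℝ) < x := hx
      have h2 := hlow ν hν x hx0.le
      rw [norm_smul, norm_smul, mul_left_comm]
      refine mul_le_mul_of_nonneg_left ?_ (norm_nonneg _)
      rw [norm_div, norm_neg, norm_one, norm_pow, norm_inv, ← Complex.ofReal_add, Complex.norm_real,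
        Real.norm_of_nonneg (by positivity), one_div, ← inv_pow]
      have h3 : ‖(x : ℂ) + ν‖⁻¹ ≤ (c / 2)⁻¹ * (x + ‖μ‖)⁻¹ := by
        rw [← mul_inv]; exact inv_anti₀ (by positivity) h2
      calc ‖(x : ℂ) + ν‖⁻¹ ^ 2 ≤ ((c / 2)⁻¹ * (x + ‖μ‖)⁻¹) ^ 2 := by gcongr
        _ = (c / 2)⁻¹ ^ 2 * (x + ‖μ‖)⁻¹ * (x + ‖μ‖)⁻¹ := by ring
        _ ≤ (c / 2)⁻¹ ^ 2 * ‖μ‖⁻¹ * (x + ‖μ‖)⁻¹ := by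
            gcongr
            linarith)
    hbi
    (by
      filter_upwards [ae_restrict_mem measurableSet_Ioi] with x hx ν hν
      have hx0 : (0 : ℝ) < x := hx
      have h2 := hlow ν hν x hx0.le
      have h3 : (x : ℂ) + ν ≠ 0 := by
        refine norm_pos_iff.1 (lt_of_lt_of_le ?_ h2)
        positivity
      exact (((hasDerivAt_id ν).const_add (x : ℂ)).inv h3).const_mul ((x : ℂ) ^ (s - 1)))
  exact key.2.differentiableAt

/-- Both sides are holomorphic in μ on the connected slit plane and agree at positive reals
accumulating at 1. -/
theorem mellin_ofReal_add_inv {μ : ℂ} (hμ : μ ∈ Complex.slitPlane) {s : ℂ} (h0 : 0 < s.re)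
    (h1 : s.re < 1) : mellin (fun x : ℝ => ((x : ℂ) + μ)⁻¹) s =
      Real.pi / Complex.sin (Real.pi * s) * μ ^ (s - 1) := by
  have hA : AnalyticOnNhd ℂ (fun μ : ℂ => mellin (fun x : ℝ => ((x : ℂ) + μ)⁻¹) s)
      Complex.slitPlane :=
    (differentiableOn_mellin_ofReal_add_inv h0 h1).analyticOnNhd Complex.isOpen_slitPlane
  have hB : AnalyticOnNhd ℂ (fun μ : ℂ => Real.pi / Complex.sin (Real.pi * s) * μ ^ (s - 1))
      Complex.slitPlane := by
    refine DifferentiableOn.analyticOnNhd (fun ν hν => ?_) Complex.isOpen_slitPlane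
    exact ((differentiableAt_id.cpow_const hν).const_mul _).differentiableWithinAt
  have hpre : IsPreconnected Complex.slitPlane :=
    (Complex.starConvex_one_slitPlane.isPathConnected
      Complex.one_mem_slitPlane).isConnected.isPreconnected
  refine hA.eqOn_of_preconnected_of_frequently_eq hB hpre Complex.one_mem_slitPlane ?_ hμ
  have ht : Tendsto (fun n : ℕ => ((1 + 1 / ((n : ℝ) + 1) : ℝ) : ℂ)) atTop (𝓝[≠] 1) := by
    refine tendsto_nhdsWithin_iff.2 ⟨?_, Eventually.of_forall fun n => ?_⟩
    · have h2 : Tendsto (fun n : ℕ => (1 + 1 / ((n : ℝ) + 1) : ℝ)) atTop (𝓝 (1 + 0)) :=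
        tendsto_const_nhds.add tendsto_one_div_add_atTop_nhds_zero_nat
      rw [add_zero] at h2
      have := (Complex.continuous_ofReal.tendsto 1).comp h2
      simpa [Function.comp_def] using this
    · simp only [Set.mem_compl_iff, Set.mem_singleton_iff]
      rw [← Complex.ofReal_one, Complex.ofReal_inj]
      have : (0 : ℝ) < 1 / ((n : ℝ) + 1) := by positivity
      linarith
  refine ht.frequently (Frequently.of_forall fun n => ?_)
  exact mellin_ofReal_add_inv_of_pos (by positivity) h0 h1

theorem integral_norm_cpow_smul_inv {a : ℝ} (ha : 0 < a) {s : ℂ} (h0 : 0 < s.re) (h1 : s.re < 1) :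
    ∫ x in Set.Ioi (0 : ℝ), ‖(x : ℂ) ^ (s - 1) • ((x : ℂ) + a)⁻¹‖ =
      ‖(Real.pi : ℂ) / Complex.sin (Real.pi * s.re)‖ * a ^ (s.re - 1) := by
  have h := mellin_ofReal_add_inv_of_pos ha (s := (s.re : ℂ)) (by simpa using h0) (by simpa using h1)
  have h2 : mellin (fun x : ℝ => ((x : ℂ) + a)⁻¹) (s.re : ℂ) =
      ((∫ x in Set.Ioi (0 : ℝ), ‖(x : ℂ) ^ (s - 1) • ((x : ℂ) + a)⁻¹‖ : ℝ) : ℂ) := by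
    rw [mellin, ← integral_complex_ofReal]
    refine setIntegral_congr_fun measurableSet_Ioi fun x hx => ?_
    have hx0 : (0 : ℝ) < x := hx
    simp only [norm_smul, norm_inv]
    rw [Complex.norm_cpow_eq_rpow_re_of_pos hx0, ← Complex.ofReal_add, Complex.norm_real,
      Real.norm_of_nonneg (by positivity), smul_eq_mul]
    push_cast [Complex.ofReal_cpow hx0.le]
    simp
  rw [h2] at h
  have h3 := congrArg norm h
  rw [Complex.norm_real, Real.norm_of_nonneg (integral_nonneg fun _ => norm_nonneg _), norm_mul,
    Complex.norm_cpow_eq_rpow_re_of_pos ha] at h3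
  simpa using h3

/-! ### The Mellin transform of a logarithmic derivative. -/

/-- The zeros `-μ` of `F` keep away from the positive real axis. -/
def HasSectorialZeros (F : ℂ → ℂ) : Prop :=
  (∀ μ, F (-μ) = 0 → μ ∈ Complex.slitPlane) ∧
    ∃ c : ℝ, 0 < c ∧ ∀ μ, F (-μ) = 0 → ∀ x : ℝ, 0 ≤ x → c * (x + ‖μ‖) ≤ ‖(x : ℂ) + μ‖

theorem HasSectorialZeros.ne_zero_of_nonneg {F : ℂ → ℂ} (hs : HasSectorialZeros F) {x : ℝ} (hx : 0 ≤ x) : F x ≠ 0 := by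
  intro h
  have h1 := hs.1 (-(x : ℂ)) (by rwa [neg_neg])
  rw [← Complex.ofReal_neg, Complex.ofReal_mem_slitPlane] at h1
  linarith

theorem isBigO_rpow_neg_zero_of_continuousOn {f : ℝ → ℂ} (hf : ContinuousOn f (Set.Ici 0)) :
    f =O[𝓝[>] 0] fun x : ℝ => x ^ (-(0 : ℝ)) := by
  simp only [neg_zero, Real.rpow_zero]
  have h := (hf 0 Set.self_mem_Ici).mono_left (nhdsWithin_mono 0 Set.Ioi_subset_Ici_self)
  exact h.isBigO_one ℝ

theorem norm_cpow_le {μ : ℂ} (hμ : μ ≠ 0) (s : ℂ) :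
    ‖μ ^ (-s)‖ ≤ ‖μ‖ ^ (-s.re) * Real.exp (Real.pi * |s.im|) := by
  rw [Complex.norm_cpow_of_ne_zero hμ, Complex.neg_re, Complex.neg_im, div_eq_mul_inv,
    ← Real.exp_neg]
  gcongr
  have := Complex.abs_arg_le_pi μ
  calc -(μ.arg * -s.im) = μ.arg * s.im := by ring
    _ ≤ |μ.arg * s.im| := le_abs_self _
    _ = |μ.arg| * |s.im| := abs_mul _ _
    _ ≤ Real.pi * |s.im| := by gcongr

namespace IsEntireOfOrder

variable {F : ℂ → ℂ} {ρ : ℝ} (hF : IsEntireOfOrder F ρ)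
include hF

theorem eq_zero_of_zeroMult_ne_zero {μ : ℂ} (h : zeroMult F μ ≠ 0) : F (-μ) = 0 := by
  by_contra h0
  exact h (hF.zeroMult_eq_zero_iff.2 h0)

theorem countable_zeros : Countable {μ : ℂ // F (-μ) = 0} := by
  have h : {μ : ℂ | F (-μ) = 0} = ⋃ n : ℕ, {μ : ℂ | F (-μ) = 0 ∧ ‖μ‖ ≤ n} := by
    ext μ
    simp only [Set.mem_iUnion]
    exact ⟨fun h => ⟨⌈‖μ‖⌉₊, h, Nat.le_ceil _⟩, fun ⟨_, h⟩ => h.1⟩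
  have h2 : {μ : ℂ | F (-μ) = 0}.Countable := by
    rw [h]
    exact Set.countable_iUnion fun n => (hF.finite_zeros n).countable
  exact h2.to_subtype

variable (hs : HasSectorialZeros F)
include hs

theorem continuousOn_logDeriv : ContinuousOn (fun x : ℝ => logDeriv F x) (Set.Ici 0) := by
  have h : (fun x : ℝ => logDeriv F x) = fun x : ℝ => deriv F x / F x := rfl
  rw [h]
  refine ContinuousOn.div ?_ ?_ fun x hx => hs.ne_zero_of_nonneg hx
  · have : Continuous (deriv F) := by
      have h2 : Differentiable ℂ (deriv F) := fun z =>
        (hF.differentiable.analyticAt z).deriv.differentiableAt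
      exact h2.continuous
    exact (this.comp Complex.continuous_ofReal).continuousOn
  · exact (hF.differentiable.continuous.comp Complex.continuous_ofReal).continuousOn

theorem locallyIntegrableOn_logDeriv :
    LocallyIntegrableOn (fun x : ℝ => logDeriv F x) (Set.Ioi 0) :=
  ((hF.continuousOn_logDeriv hs).mono Set.Ioi_subset_Ici_self).locallyIntegrableOn measurableSet_Ioi

/-- Interpolation gives x^(1-σ) ‖μ‖^σ ≤ x + ‖μ‖, so the series of m(μ)/(x + μ) is dominated by
x^(σ-1) times the convergent sum of m(μ)‖μ‖^(-σ). The sectorial condition compares ‖x + μ‖ with x +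
‖μ‖. -/
theorem exists_logDeriv_bound {σ : ℝ} (hσ : ρ < σ) (hσ1 : σ < 1) : ∃ C : ℝ, 0 < C ∧
    ∀ x : ℝ, 0 < x → ‖logDeriv F x‖ ≤ C * x ^ (σ - 1) := by
  have hs' := hs
  obtain ⟨-, c, hc, h⟩ := hs'
  have hsum := hF.summable_zeroMult_mul_rpow hσ
  have hσ0 : 0 < σ := hF.pos.trans hσ
  refine ⟨c⁻¹ * (∑' μ : ℂ, (zeroMult F μ : ℝ) * ‖μ‖ ^ (-σ)) + 1, ?_, fun x hx => ?_⟩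
  · have : 0 ≤ ∑' μ : ℂ, (zeroMult F μ : ℝ) * ‖μ‖ ^ (-σ) := tsum_nonneg fun _ => by positivity
    positivity
  have hterm : ∀ μ : ℂ, ‖(zeroMult F μ : ℂ) / (x + μ)‖ ≤
      c⁻¹ * x ^ (σ - 1) * ((zeroMult F μ : ℝ) * ‖μ‖ ^ (-σ)) := by
    intro μ
    rcases Nat.eq_zero_or_pos (zeroMult F μ) with h0 | h0
    · simp [h0]
    have hz := hF.eq_zero_of_zeroMult_ne_zero h0.ne'
    have hμ : 0 < ‖μ‖ := by
      rw [norm_pos_iff]; rintro rfl; rw [neg_zero] at hz; exact hF.ne_zero hz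
    have h1 := h μ hz x hx.le
    have h2 : x ^ (1 - σ) * ‖μ‖ ^ σ ≤ x + ‖μ‖ := by
      have h3 : x ^ (1 - σ) ≤ (x + ‖μ‖) ^ (1 - σ) :=
        Real.rpow_le_rpow hx.le (by linarith) (by linarith)
      have h4 : ‖μ‖ ^ σ ≤ (x + ‖μ‖) ^ σ := Real.rpow_le_rpow hμ.le (by linarith) hσ0.le
      calc x ^ (1 - σ) * ‖μ‖ ^ σ ≤ (x + ‖μ‖) ^ (1 - σ) * (x + ‖μ‖) ^ σ := by gcongr
        _ = x + ‖μ‖ := by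
            rw [← Real.rpow_add (by positivity), sub_add_cancel, Real.rpow_one]
    rw [norm_div, Complex.norm_natCast]
    have h5 : c * (x ^ (1 - σ) * ‖μ‖ ^ σ) ≤ ‖(x : ℂ) + μ‖ := le_trans (by gcongr) h1
    refine (div_le_div_of_nonneg_left (by positivity) (by positivity) h5).trans (le_of_eq ?_)
    rw [← neg_sub 1 σ, Real.rpow_neg hx.le, Real.rpow_neg hμ.le]
    field_simp
  have hne := hs.ne_zero_of_nonneg hx.le
  rw [← (hF.hasSum_zeroMult_div hne).tsum_eq]
  refine (tsum_of_norm_bounded (hsum.mul_left (c⁻¹ * x ^ (σ - 1))).hasSum hterm).trans ?_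
  rw [tsum_mul_left]
  have : 0 < x ^ (σ - 1) := by positivity
  linarith

theorem mellinConvergent_logDeriv {s : ℂ} (h0 : 0 < s.re) (h1 : s.re < 1 - ρ) :
    MellinConvergent (fun x : ℝ => logDeriv F x) s := by
  obtain ⟨σ, hσ1, hσ2⟩ := exists_between (lt_sub_comm.1 h1)
  obtain ⟨C, hC, hb⟩ := hF.exists_logDeriv_bound hs hσ1 (by linarith)
  refine mellinConvergent_of_isBigO_rpow (a := 1 - σ) (b := 0)
    (hF.locallyIntegrableOn_logDeriv hs) ?_ (by linarith)
    (isBigO_rpow_neg_zero_of_continuousOn (hF.continuousOn_logDeriv hs)) h0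
  refine Asymptotics.IsBigO.of_bound C ?_
  filter_upwards [eventually_gt_atTop 0] with x hx
  rw [neg_sub, Real.norm_of_nonneg (by positivity)]
  exact hb x hx

/-- The partial fraction series is integrated term by term. The sectorial bound reduces absolute
convergence to the positive poles ‖μ‖, where the integral of the modulus is explicit; Re s < 1 - ρ
makes the resulting series converge. -/
theorem mellin_logDeriv {s : ℂ} (h0 : 0 < s.re) (h1 : s.re < 1 - ρ) :
    mellin (fun x : ℝ => logDeriv F x) s = Real.pi / Complex.sin (Real.pi * s) *
      ∑' μ : ℂ, (zeroMult F μ : ℂ) * μ ^ (s - 1) := by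
  have hs' := hs
  obtain ⟨hslit, c, hc, h⟩ := hs'
  have := hF.countable_zeros
  have h1' : s.re < 1 := by linarith [hF.pos]
  set G : {μ : ℂ // F (-μ) = 0} → ℝ → ℂ := fun μ x =>
    (zeroMult F μ : ℂ) * ((x : ℂ) ^ (s - 1) • ((x : ℂ) + μ)⁻¹)
  have hint : ∀ μ, Integrable (G μ) (volume.restrict (Set.Ioi 0)) := fun μ =>
    (mellinConvergent_ofReal_add_inv (hslit μ μ.2) h0 h1').const_mul _
  set K := c⁻¹ * ‖(Real.pi : ℂ) / Complex.sin (Real.pi * s.re)‖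
  have hsumC := hF.summable_zeroMult_mul_rpow (lt_sub_comm.1 h1)
  have hsum : Summable fun μ => ∫ x in Set.Ioi (0 : ℝ), ‖G μ x‖ := by
    refine Summable.of_nonneg_of_le (fun μ => integral_nonneg fun _ => norm_nonneg _) (fun μ => ?_)
      ((hsumC.mul_left K).comp_injective Subtype.val_injective)
    have hμ0 : (μ : ℂ) ≠ 0 := Complex.slitPlane_ne_zero (hslit μ μ.2)
    have hμ : 0 < ‖(μ : ℂ)‖ := norm_pos_iff.2 hμ0
    have hI := (mellinConvergent_ofReal_add_inv (Complex.ofReal_mem_slitPlane.2 hμ) h0 h1').norm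
    calc ∫ x in Set.Ioi (0 : ℝ), ‖G μ x‖
        ≤ ∫ x in Set.Ioi (0 : ℝ), (zeroMult F μ : ℝ) * c⁻¹ *
            ‖(x : ℂ) ^ (s - 1) • ((x : ℂ) + (‖(μ : ℂ)‖ : ℝ))⁻¹‖ := by
          refine setIntegral_mono_on (hint μ).norm (hI.const_mul _) measurableSet_Ioi fun x hx => ?_
          have hx0 : (0 : ℝ) < x := hx
          simp only [G, norm_mul, norm_smul, Complex.norm_natCast, norm_inv]
          rw [← Complex.ofReal_add, Complex.norm_real, Real.norm_of_nonneg (by positivity)]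
          have h2 : ‖(x : ℂ) + μ‖⁻¹ ≤ c⁻¹ * (x + ‖(μ : ℂ)‖)⁻¹ := by
            rw [← mul_inv]
            exact inv_anti₀ (by positivity) (h μ μ.2 x hx0.le)
          calc (zeroMult F μ : ℝ) * (‖(x : ℂ) ^ (s - 1)‖ * ‖(x : ℂ) + μ‖⁻¹)
              ≤ (zeroMult F μ : ℝ) * (‖(x : ℂ) ^ (s - 1)‖ * (c⁻¹ * (x + ‖(μ : ℂ)‖)⁻¹)) := by gcongr
            _ = _ := by ring
      _ = K * ((zeroMult F μ : ℝ) * ‖(μ : ℂ)‖ ^ (-(1 - s.re))) := by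
          rw [integral_const_mul, integral_norm_cpow_smul_inv hμ h0 h1', neg_sub]
          ring
  have key := hasSum_integral_of_summable_integral_norm hint hsum
  have hL : ∫ x in Set.Ioi (0 : ℝ), ∑' μ, G μ x = mellin (fun x : ℝ => logDeriv F x) s := by
    refine setIntegral_congr_fun measurableSet_Ioi fun x hx => ?_
    have hx0 : (0 : ℝ) < x := hx
    have h2 := hF.hasSum_zeroMult_div (hs.ne_zero_of_nonneg hx0.le)
    have h3 : ∑' μ : {μ : ℂ // F (-μ) = 0}, (zeroMult F μ : ℂ) / (x + μ) = logDeriv F x := by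
      rw [← h2.tsum_eq]
      exact tsum_subtype_eq_of_support_subset (s := {μ : ℂ | F (-μ) = 0})
        (f := fun μ : ℂ => (zeroMult F μ : ℂ) / (x + μ)) fun μ hμ => by
          refine hF.eq_zero_of_zeroMult_ne_zero fun h0 => hμ ?_
          simp [h0]
    simp only [G]
    rw [← h3, smul_eq_mul, ← tsum_mul_left]
    refine tsum_congr fun μ => ?_
    rw [smul_eq_mul, div_eq_mul_inv]
    ring
  rw [← hL, ← key.tsum_eq, ← tsum_mul_left]
  have h4 : ∀ μ : {μ : ℂ // F (-μ) = 0}, ∫ x in Set.Ioi (0 : ℝ), G μ x =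
      Real.pi / Complex.sin (Real.pi * s) * ((zeroMult F μ : ℂ) * (μ : ℂ) ^ (s - 1)) := by
    intro μ
    have := mellin_ofReal_add_inv (hslit μ μ.2) h0 h1'
    rw [mellin] at this
    simp only [G]
    rw [integral_const_mul, this]
    ring
  simp_rw [h4]
  exact tsum_subtype_eq_of_support_subset (s := {μ : ℂ | F (-μ) = 0})
    (f := fun μ : ℂ => Real.pi / Complex.sin (Real.pi * s) *
      ((zeroMult F μ : ℂ) * (μ : ℂ) ^ (s - 1))) fun μ hμ => by
      refine hF.eq_zero_of_zeroMult_ne_zero fun h0 => hμ ?_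
      simp [h0]

omit hs in
theorem summable_zeroMult_mul_cpow {s : ℂ} (h : ρ < s.re) :
    Summable fun μ : ℂ => (zeroMult F μ : ℂ) * μ ^ (-s) := by
  refine Summable.of_norm_bounded
    ((hF.summable_zeroMult_mul_rpow h).mul_right (Real.exp (Real.pi * |s.im|))) fun μ => ?_
  rcases eq_or_ne μ 0 with rfl | hμ
  · simp [hF.zeroMult_zero]
  rw [norm_mul, Complex.norm_natCast, mul_assoc]
  exact mul_le_mul_of_nonneg_left (norm_cpow_le hμ s) (by positivity)

omit hs in
theorem differentiableOn_tsum_zeroMult_mul_cpow :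
    DifferentiableOn ℂ (fun s : ℂ => ∑' μ : ℂ, (zeroMult F μ : ℂ) * μ ^ (-s))
      {s : ℂ | ρ < s.re} := by
  obtain ⟨δ, hδ, hδ1, hlow⟩ := hF.exists_norm_lower_bound
  intro s₀ hs₀
  have hs₀' : ρ < s₀.re := hs₀
  obtain ⟨σ, hσ1, hσ2⟩ := exists_between hs₀'
  set U : Set ℂ := {s | σ < s.re ∧ s.re < s₀.re + 1 ∧ |s.im| < |s₀.im| + 1}
  have hU : IsOpen U := by
    refine (isOpen_lt continuous_const Complex.continuous_re).inter
      ((isOpen_lt Complex.continuous_re continuous_const).inter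
        (isOpen_lt Complex.continuous_im.abs continuous_const))
  have hmem : s₀ ∈ U := ⟨hσ2, by linarith, by linarith⟩
  set K := δ ^ (-(s₀.re + 1 - σ)) * Real.exp (Real.pi * (|s₀.im| + 1))
  have h := Complex.differentiableOn_tsum_of_summable_norm (F := fun (μ s : ℂ) => (zeroMult F μ : ℂ) * μ ^ (-s))
    ((hF.summable_zeroMult_mul_rpow hσ1).mul_right K) (U := U)
    (fun μ s _ => by
      rcases eq_or_ne μ 0 with rfl | hμ
      · simp only [hF.zeroMult_zero, Nat.cast_zero, zero_mul]
        exact (differentiableAt_const _).differentiableWithinAt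
      · exact ((differentiableAt_id.neg.const_cpow (Or.inl hμ)).const_mul _).differentiableWithinAt)
    hU (fun μ s hs => by
      rcases Nat.eq_zero_or_pos (zeroMult F μ) with h0 | h0
      · simp [h0]
      have hz := hF.eq_zero_of_zeroMult_ne_zero h0.ne'
      have hμ := hlow μ hz
      have hμ0 : μ ≠ 0 := by rintro rfl; simp at hμ; linarith
      have hμ1 : 0 < ‖μ‖ := norm_pos_iff.2 hμ0
      obtain ⟨hs1, hs2, hs3⟩ : σ < s.re ∧ s.re < s₀.re + 1 ∧ |s.im| < |s₀.im| + 1 := hs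
      rw [norm_mul, Complex.norm_natCast, mul_assoc]
      refine mul_le_mul_of_nonneg_left ((norm_cpow_le hμ0 s).trans ?_) (by positivity)
      rw [← mul_assoc]
      have h2 : ‖μ‖ ^ (-s.re) ≤ ‖μ‖ ^ (-σ) * δ ^ (-(s₀.re + 1 - σ)) := by
        rw [show -s.re = -σ + -(s.re - σ) by ring, Real.rpow_add hμ1]
        refine mul_le_mul_of_nonneg_left ?_ (by positivity)
        refine (Real.rpow_le_rpow_of_nonpos hδ hμ (by linarith)).trans ?_
        exact Real.rpow_le_rpow_of_exponent_ge hδ hδ1 (by linarith)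
      gcongr)
  exact (h.differentiableAt (hU.mem_nhds hmem)).differentiableWithinAt

end IsEntireOfOrder

/-! ### The entire functions Φ - w. -/

/-- `Φ - w`, with the zero at the origin divided out if `w = 0`. -/
def levelFun (p : ℝ[X]) (w : ℂ) : ℂ → ℂ :=
  open Classical in if w = 0 then dslope (poincare p) 0 else fun z => poincare p z - w

theorem levelFun_of_ne {p : ℝ[X]} {w : ℂ} (hw : w ≠ 0) :
    levelFun p w = fun z => poincare p z - w := if_neg hw

theorem levelFun_zero (p : ℝ[X]) : levelFun p 0 = dslope (poincare p) 0 := if_pos rfl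

namespace IsDecimationPolynomial

variable {p : ℝ[X]} (hp : IsDecimationPolynomial p)
include hp

theorem mul_levelFun_zero (z : ℂ) : z * levelFun p 0 z = poincare p z := by
  have := sub_smul_dslope (poincare p) 0 z
  rwa [sub_zero, hp.poincare_zero, sub_zero, smul_eq_mul, ← levelFun_zero] at this

theorem differentiable_levelFun (w : ℂ) : Differentiable ℂ (levelFun p w) := by
  rcases eq_or_ne w 0 with rfl | hw
  · rw [levelFun_zero]
    rw [← differentiableOn_univ, Complex.differentiableOn_dslope univ_mem, differentiableOn_univ]
    exact hp.differentiable_poincare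
  · rw [levelFun_of_ne hw]
    exact hp.differentiable_poincare.sub_const w

theorem levelFun_apply_zero (w : ℂ) : levelFun p w 0 ≠ 0 := by
  rcases eq_or_ne w 0 with rfl | hw
  · rw [levelFun_zero, dslope_same, hp.deriv_poincare_zero]
    exact one_ne_zero
  · rw [levelFun_of_ne hw]
    simpa [hp.poincare_zero] using hw

omit hp in
theorem isEntireOfOrder_of_le_mul {F : ℂ → ℂ} {ρ c M : ℝ} (hF : Differentiable ℂ F) (h0 : F 0 ≠ 0)
    (hρ : 0 < ρ) (hρ1 : ρ < 1) (hc : 0 < c)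
    (hb : ∀ z, ‖F z‖ ≤ M * Real.exp (c * (1 + ‖z‖) ^ ρ)) : IsEntireOfOrder F ρ := by
  refine ⟨hF, h0, hρ, hρ1, c + |M|, by positivity, fun z => (hb z).trans ?_⟩
  have h1 : 1 ≤ (1 + ‖z‖) ^ ρ := Real.one_le_rpow (by linarith [norm_nonneg z]) hρ.le
  have h2 : M ≤ Real.exp |M| := (le_abs_self M).trans (by linarith [Real.add_one_le_exp |M|])
  calc M * Real.exp (c * (1 + ‖z‖) ^ ρ) ≤ Real.exp |M| * Real.exp (c * (1 + ‖z‖) ^ ρ) := by gcongr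
    _ = Real.exp (|M| * 1 + c * (1 + ‖z‖) ^ ρ) := by rw [← Real.exp_add, mul_one]
    _ ≤ Real.exp ((c + |M|) * (1 + ‖z‖) ^ ρ) := by
        rw [add_mul, add_comm]
        gcongr

theorem rho_lt_one : rho p < 1 := by linarith [hp.rho_le_half]

theorem isEntireOfOrder_levelFun (w : ℂ) : IsEntireOfOrder (levelFun p w) (rho p) := by
  obtain ⟨c, hc, hb⟩ := hp.exists_norm_poincare_le
  have h1 : ∀ z : ℂ, 1 ≤ Real.exp (c * (1 + ‖z‖) ^ rho p) := fun z =>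
    Real.one_le_exp (by positivity)
  rcases eq_or_ne w 0 with rfl | hw
  · have hcont := (hp.differentiable_levelFun 0).continuous
    obtain ⟨M, hM⟩ := (isCompact_closedBall (0 : ℂ) 1).exists_bound_of_continuousOn hcont.continuousOn
    refine isEntireOfOrder_of_le_mul (M := max M 1) (hp.differentiable_levelFun 0)
      (hp.levelFun_apply_zero 0) hp.rho_pos hp.rho_lt_one hc fun z => ?_
    rcases le_total ‖z‖ 1 with h | h
    · calc ‖levelFun p 0 z‖ ≤ M := hM z (by simpa using h)
        _ ≤ max M 1 * 1 := by rw [mul_one]; exact le_max_left _ _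
        _ ≤ _ := by gcongr; exact h1 z
    · calc ‖levelFun p 0 z‖ ≤ ‖z‖ * ‖levelFun p 0 z‖ :=
          le_mul_of_one_le_left (norm_nonneg _) h
        _ = ‖poincare p z‖ := by rw [← norm_mul, hp.mul_levelFun_zero]
        _ ≤ Real.exp (c * (1 + ‖z‖) ^ rho p) := hb z
        _ ≤ max M 1 * Real.exp (c * (1 + ‖z‖) ^ rho p) :=
          le_mul_of_one_le_left (Real.exp_pos _).le (le_max_right _ _)
  · refine isEntireOfOrder_of_le_mul (M := 1 + ‖w‖) (hp.differentiable_levelFun w)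
      (hp.levelFun_apply_zero w) hp.rho_pos hp.rho_lt_one hc fun z => ?_
    rw [levelFun_of_ne hw]
    calc ‖poincare p z - w‖ ≤ ‖poincare p z‖ + ‖w‖ := norm_sub_le _ _
      _ ≤ Real.exp (c * (1 + ‖z‖) ^ rho p) + ‖w‖ * Real.exp (c * (1 + ‖z‖) ^ rho p) :=
          add_le_add (hb z) (le_mul_of_one_le_right (norm_nonneg w) (h1 z))
      _ = _ := by ring

theorem levelFun_eq_zero_iff {w z : ℂ} : levelFun p w z = 0 ↔ z ≠ 0 ∧ poincare p z = w := by
  rcases eq_or_ne z 0 with rfl | hz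
  · simp [hp.levelFun_apply_zero w]
  rcases eq_or_ne w 0 with rfl | hw
  · rw [← hp.mul_levelFun_zero z]
    simp [hz]
  · rw [levelFun_of_ne hw]
    simp [hz, sub_eq_zero]

theorem levelMult_eq {w μ : ℂ} (hμ : μ ≠ 0) :
    levelMult p w (-μ) = (zeroMult (levelFun p w) μ : ℕ∞) := by
  have hne := (hp.isEntireOfOrder_levelFun w).order_ne_top (-μ)
  rw [zeroMult, Nat.cast_analyticOrderNatAt hne]
  rcases eq_or_ne w 0 with rfl | hw
  · have h : (fun x => poincare p x - 0) = (fun z : ℂ => z) * levelFun p 0 := by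
      ext z
      simp [hp.mul_levelFun_zero]
    have h2 : analyticOrderAt (fun z : ℂ => z) (-μ) = 0 :=
      (analyticAt_id.analyticOrderAt_eq_zero).2 (neg_ne_zero.2 hμ)
    rw [levelMult, h, analyticOrderAt_mul (f := fun z : ℂ => z) analyticAt_id
      ((hp.differentiable_levelFun 0).analyticAt _), h2, zero_add]
  · rw [levelMult, ← levelFun_of_ne hw]

theorem zeroMult_levelFun_neg_ne_zero {w μ : ℂ} (h : zeroMult (levelFun p w) μ ≠ 0) :
    μ ≠ 0 ∧ poincare p (-μ) = w := by
  have := hp.levelFun_eq_zero_iff.1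
    ((hp.isEntireOfOrder_levelFun w).eq_zero_of_zeroMult_ne_zero h)
  exact ⟨neg_ne_zero.1 this.1, this.2⟩

theorem partialZetaTerm_eq (w s : ℂ) : partialZetaTerm p w s =
    (fun μ : ℂ => (zeroMult (levelFun p w) μ : ℂ) * μ ^ (-s)) ∘ Subtype.val := by
  ext μ
  simp only [partialZetaTerm, Function.comp, hp.levelMult_eq μ.2.1, ENat.toNat_natCast]

theorem summable_partialZetaTerm (w : ℂ) {s : ℂ} (h : rho p < s.re) :
    Summable (partialZetaTerm p w s) := by
  rw [hp.partialZetaTerm_eq]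
  exact ((hp.isEntireOfOrder_levelFun w).summable_zeroMult_mul_cpow h).subtype _

theorem partialZeta_eq_tsum (w s : ℂ) :
    partialZeta p w s = ∑' μ : ℂ, (zeroMult (levelFun p w) μ : ℂ) * μ ^ (-s) := by
  rw [partialZeta, hp.partialZetaTerm_eq]
  refine tsum_subtype_eq_of_support_subset (s := {μ : ℂ | μ ≠ 0 ∧ poincare p (-μ) = w})
    (f := fun μ : ℂ => (zeroMult (levelFun p w) μ : ℂ) * μ ^ (-s)) fun μ hμ => ?_
  refine hp.zeroMult_levelFun_neg_ne_zero fun h0 => hμ ?_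
  simp [h0]

theorem differentiableOn_partialZeta (w : ℂ) :
    DifferentiableOn ℂ (partialZeta p w) {s : ℂ | rho p < s.re} := by
  have h : partialZeta p w = _ := funext (hp.partialZeta_eq_tsum w)
  rw [h]
  exact (hp.isEntireOfOrder_levelFun w).differentiableOn_tsum_zeroMult_mul_cpow

/-- On the positive axis Φ is positive, so it cannot take the value w ≤ 0 there. -/
theorem neg_mem_slitPlane {w : ℝ} (hw : w ≤ 0) {z : ℂ} (hz : levelFun p w z = 0) :
    -z ∈ Complex.slitPlane := by
  obtain ⟨h0, h1⟩ := hp.levelFun_eq_zero_iff.1 hz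
  rw [Complex.mem_slitPlane_iff, or_iff_not_imp_right, not_not, Complex.neg_im, neg_eq_zero,
    Complex.neg_re]
  intro him
  by_contra! hre
  obtain ⟨x, rfl⟩ : ∃ x : ℝ, (x : ℂ) = z := ⟨z.re, Complex.ext rfl him.symm⟩
  have hx : 0 < x := lt_of_le_of_ne (by simpa using hre) fun h => h0 (by simp [← h])
  rw [hp.poincare_ofReal, Complex.ofReal_inj] at h1
  linarith [hp.poincareReal_pos hx]

/-- For Re μ ≥ 0 the constant 1/2 serves. If Re μ ≤ 0, then ‖μ‖ ≤ ‖Φ(-μ)‖ = |w|, which leaves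
finitely many points, each with its own constant. -/
theorem hasSectorialZeros_levelFun {w : ℝ} (hw : w ≤ 0) : HasSectorialZeros (levelFun p w) := by
  have hslit : ∀ μ, levelFun p w (-μ) = 0 → μ ∈ Complex.slitPlane := fun μ h => by
    simpa using hp.neg_mem_slitPlane hw h
  refine ⟨hslit, ?_⟩
  set S : Set ℂ := {μ | levelFun p w (-μ) = 0 ∧ ‖μ‖ ≤ |w|}
  have hS : S.Finite := (hp.isEntireOfOrder_levelFun w).finite_zeros |w|
  have key : ∀ T : Set ℂ, T.Finite → T ⊆ Complex.slitPlane → ∃ c : ℝ, 0 < c ∧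
      ∀ μ ∈ T, ∀ x : ℝ, 0 ≤ x → c * (x + ‖μ‖) ≤ ‖(x : ℂ) + μ‖ := by
    intro T hT
    induction T, hT using Set.Finite.induction_on with
    | empty => exact fun _ => ⟨1, one_pos, fun _ h => absurd h (Set.notMem_empty _)⟩
    | @insert a T _ _ ih =>
      intro hsub
      obtain ⟨c, hc, h⟩ := ih ((Set.subset_insert a T).trans hsub)
      obtain ⟨c', hc', h'⟩ := exists_mul_add_le_norm_add (hsub (Set.mem_insert a T))
      refine ⟨min c c', lt_min hc hc', fun μ hμ x hx => ?_⟩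
      rcases Set.mem_insert_iff.1 hμ with rfl | hμ
      · exact (mul_le_mul_of_nonneg_right (min_le_right _ _) (by positivity)).trans (h' x hx)
      · exact (mul_le_mul_of_nonneg_right (min_le_left _ _) (by positivity)).trans (h μ hμ x hx)
  obtain ⟨c, hc, h⟩ := key S hS fun μ hμ => hslit μ hμ.1
  refine ⟨min c (1 / 2), by positivity, fun μ hμ x hx => ?_⟩
  rcases le_total 0 μ.re with hre | hre
  · exact (mul_le_mul_of_nonneg_right (min_le_right _ _) (by positivity)).trans
      (add_le_two_mul_norm_add hre hx)
  · refine (mul_le_mul_of_nonneg_right (min_le_left _ _) (by positivity)).trans (h μ ⟨hμ, ?_⟩ x hx)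
    have h1 := hp.norm_le_norm_poincare (z := -μ) (by simpa using hre)
    rw [(hp.levelFun_eq_zero_iff.1 hμ).2] at h1
    simpa using h1

/-- `levelFun` on the real axis. -/
theorem levelFun_ofReal (w x : ℝ) : levelFun p w x = ((levelFun p w x).re : ℂ) := by
  rcases eq_or_ne w 0 with rfl | hw
  · rw [Complex.ofReal_zero]
    rcases eq_or_ne x 0 with rfl | hx
    · rw [levelFun_zero, Complex.ofReal_zero, dslope_same, hp.deriv_poincare_zero]
      simp
    · have h : levelFun p 0 x = ((poincareReal p x / x : ℝ) : ℂ) := by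
        have := hp.mul_levelFun_zero x
        rw [hp.poincare_ofReal] at this
        rw [Complex.ofReal_div, ← this]
        field_simp [Complex.ofReal_ne_zero.2 hx]
      rw [h, Complex.ofReal_re]
  · rw [levelFun_of_ne (Complex.ofReal_ne_zero.2 hw)]
    simp only [hp.poincare_ofReal]
    simp

theorem levelFun_re_pos {w : ℝ} (hw : w ≤ 0) {x : ℝ} (hx : 0 ≤ x) : 0 < (levelFun p w x).re := by
  rcases eq_or_ne w 0 with rfl | hw0
  · rw [Complex.ofReal_zero]
    rcases eq_or_lt_of_le hx with rfl | hx
    · rw [levelFun_zero, Complex.ofReal_zero, dslope_same, hp.deriv_poincare_zero]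
      simp
    · have h : levelFun p 0 x = ((poincareReal p x / x : ℝ) : ℂ) := by
        have := hp.mul_levelFun_zero x
        rw [hp.poincare_ofReal] at this
        rw [Complex.ofReal_div, ← this]
        field_simp [Complex.ofReal_ne_zero.2 hx.ne']
      rw [h, Complex.ofReal_re]
      exact div_pos (hp.poincareReal_pos hx) hx
  · rw [levelFun_of_ne (Complex.ofReal_ne_zero.2 hw0)]
    simp only [hp.poincare_ofReal, Complex.sub_re, Complex.ofReal_re]
    have := lt_of_le_of_ne hw hw0
    linarith [hp.poincareReal_nonneg hx]

end IsDecimationPolynomial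

/-! ### The functional equation under the Mellin transform. -/

/-- The coefficient of `1 / x` in the asymptotics of `decimationGap` at infinity. -/
def levelShift (p : ℝ[X]) (w : ℝ) : ℂ :=
  open Classical in if w = 0 then (p.natDegree : ℂ) - 1 else 0

/-- The derivative of `log (F (λ x) / F x ^ d)` for `F = levelFun p w`. -/
def decimationGap (p : ℝ[X]) (w x : ℝ) : ℂ :=
  scaling p * logDeriv (levelFun p w) ((scaling p * x : ℝ) : ℂ) -
    p.natDegree * logDeriv (levelFun p w) x

/-- The logarithmic derivative of `Psi p w`. -/
def decimationTail (p : ℝ[X]) (w x : ℝ) : ℂ := decimationGap p w x - levelShift p w / x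

/-- `decimationGap`, with its leading term at infinity cut off. -/
def truncatedGap (p : ℝ[X]) (w x : ℝ) : ℂ :=
  decimationGap p w x - (Set.Ioi 1).indicator (fun y : ℝ => levelShift p w / y) x

theorem levelShift_zero (p : ℝ[X]) : levelShift p 0 = (p.natDegree : ℂ) - 1 := if_pos rfl

theorem levelShift_of_ne {p : ℝ[X]} {w : ℝ} (hw : w ≠ 0) : levelShift p w = 0 := if_neg hw

namespace IsDecimationPolynomial

variable {p : ℝ[X]} (hp : IsDecimationPolynomial p)
include hp

theorem scaling_mul_deriv_poincare (z : ℂ) : scaling p * deriv (poincare p) (scaling p * z) =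
    aeval (poincare p z) (derivative p) * deriv (poincare p) z := by
  have h1 : HasDerivAt (fun z => poincare p (scaling p * z))
      (deriv (poincare p) (scaling p * z) * (scaling p * 1)) z :=
    (hp.differentiable_poincare _).hasDerivAt.comp z ((hasDerivAt_id z).const_mul _)
  have h2 : HasDerivAt (fun z => poincare p (scaling p * z))
      (aeval (poincare p z) (derivative p) * deriv (poincare p) z) z := by
    simp_rw [hp.poincare_scaling_mul]
    exact (p.hasDerivAt_aeval (poincare p z)).comp z (hp.differentiable_poincare z).hasDerivAt
  rw [← h1.unique h2]
  ring

theorem logDeriv_levelFun_zero {z : ℂ} (hz : z ≠ 0) (h : levelFun p 0 z ≠ 0) :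
    logDeriv (levelFun p 0) z = deriv (poincare p) z / poincare p z - 1 / z := by
  have h1 : poincare p = fun z => z * levelFun p 0 z := funext fun z => (hp.mul_levelFun_zero z).symm
  have h2 := logDeriv_mul (f := fun z : ℂ => z) z hz h differentiableAt_id
    (hp.differentiable_levelFun 0 z)
  rw [← h1, logDeriv_apply, logDeriv_apply] at h2
  rw [h2]
  simp

omit hp in
theorem logDeriv_levelFun_of_ne {w : ℂ} (hw : w ≠ 0) (z : ℂ) :
    logDeriv (levelFun p w) z = deriv (poincare p) z / (poincare p z - w) := by
  rw [levelFun_of_ne hw, logDeriv_apply, deriv_sub_const_fun]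

theorem levelFun_ne_zero {w : ℝ} (hw : w ≤ 0) {x : ℝ} (hx : 0 ≤ x) : levelFun p w x ≠ 0 :=
  (hp.hasSectorialZeros_levelFun hw).ne_zero_of_nonneg hx

/-- For w = 0, dividing out z puts (d - 1)/x into the gap; `levelShift` removes it, and what remains
is Φ' times a rational function of Φ for every w ≤ 0. -/
theorem decimationTail_eq {w : ℝ} (hw : w ≤ 0) {x : ℝ} (hx : 0 < x) :
    decimationTail p w x = deriv (poincare p) x *
      (aeval (poincare p x) (derivative p) / (aeval (poincare p x) p - w) -
        p.natDegree / (poincare p x - w)) := by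
  have hl := hp.scaling_pos
  have hx' : (x : ℂ) ≠ 0 := Complex.ofReal_ne_zero.2 hx.ne'
  have hl' : (scaling p : ℂ) ≠ 0 := Complex.ofReal_ne_zero.2 hl.ne'
  have key : decimationTail p w x =
      scaling p * deriv (poincare p) (scaling p * x) / (poincare p (scaling p * x) - w) -
        p.natDegree * (deriv (poincare p) x / (poincare p x - w)) := by
    rcases eq_or_ne w 0 with rfl | hw0
    · have h1 := hp.levelFun_ne_zero hw (mul_pos hl hx).le
      have h2 := hp.levelFun_ne_zero hw hx.le
      rw [decimationTail, decimationGap, levelShift_zero]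
      rw [Complex.ofReal_zero] at *
      rw [hp.logDeriv_levelFun_zero (Complex.ofReal_ne_zero.2 (mul_pos hl hx).ne') h1,
        hp.logDeriv_levelFun_zero hx' h2]
      push_cast
      field_simp
      ring
    · rw [decimationTail, decimationGap, levelShift_of_ne hw0,
        logDeriv_levelFun_of_ne (Complex.ofReal_ne_zero.2 hw0),
        logDeriv_levelFun_of_ne (Complex.ofReal_ne_zero.2 hw0)]
      push_cast
      ring
  rw [key, hp.scaling_mul_deriv_poincare, hp.poincare_scaling_mul]
  ring

/-- For w = 0 the bound on the logarithmic derivative is C x^(σ-1) with σ < 1, so Φ'/Φ is bounded on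
[1, ∞). -/
theorem exists_norm_deriv_poincare_le : ∃ C : ℝ, 0 < C ∧ ∀ x : ℝ, 1 ≤ x →
    ‖deriv (poincare p) x‖ ≤ C * poincareReal p x := by
  have h0 : HasSectorialZeros (levelFun p 0) := by
    simpa using hp.hasSectorialZeros_levelFun le_rfl
  obtain ⟨σ, hσ, hσ1⟩ := exists_between hp.rho_lt_one
  obtain ⟨C, hC, h⟩ := (hp.isEntireOfOrder_levelFun 0).exists_logDeriv_bound h0 hσ hσ1
  refine ⟨C + 1, by positivity, fun x hx => ?_⟩
  have hx0 : 0 < x := by linarith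
  have hx' : (x : ℂ) ≠ 0 := Complex.ofReal_ne_zero.2 hx0.ne'
  have h1 := h x hx0
  have hP := hp.poincareReal_pos hx0
  have h2 : ‖(1 : ℂ) / x‖ ≤ 1 := by
    rw [norm_div, norm_one, Complex.norm_real, Real.norm_of_nonneg hx0.le]
    exact div_le_one_of_le₀ hx hx0.le
  have h3 : C * x ^ (σ - 1) ≤ C * 1 :=
    mul_le_mul_of_nonneg_left (Real.rpow_le_one_of_one_le_of_nonpos hx (by linarith)) hC.le
  rw [hp.logDeriv_levelFun_zero hx' (h0.ne_zero_of_nonneg hx0.le)] at h1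
  have h4 : ‖deriv (poincare p) x / poincare p x‖ ≤ C + 1 := by
    calc ‖deriv (poincare p) x / poincare p x‖
        = ‖(deriv (poincare p) x / poincare p x - 1 / x) + 1 / x‖ := by rw [sub_add_cancel]
      _ ≤ _ := (norm_add_le _ _).trans (by linarith)
  rwa [norm_div, hp.poincare_ofReal, Complex.norm_real, Real.norm_of_nonneg hP.le,
    div_le_iff₀ hP] at h4

theorem tendsto_poincareReal : Tendsto (poincareReal p) atTop atTop :=
  tendsto_atTop_mono' _ ((eventually_ge_atTop 0).mono fun _ => hp.le_poincareReal) tendsto_id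

/-- Inverse powers of `Φ` decay faster than any power. -/
theorem inv_poincareReal_isBigO (a : ℝ) :
    (fun x => (poincareReal p x)⁻¹) =O[atTop] fun x : ℝ => x ^ (-a) := by
  obtain ⟨N, hN⟩ := exists_nat_ge a
  refine Asymptotics.IsBigO.of_bound 1 ?_
  filter_upwards [hp.eventually_pow_le_poincareReal N, eventually_ge_atTop 1] with x hx h1
  have hx0 : 0 < x := by linarith
  have h2 : x ^ a ≤ poincareReal p x := by
    refine le_trans ?_ hx
    rw [← Real.rpow_natCast]
    exact Real.rpow_le_rpow_of_exponent_le h1 hN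
  rw [one_mul, norm_inv, Real.norm_of_nonneg (hp.poincareReal_nonneg hx0.le),
    Real.norm_of_nonneg (by positivity), Real.rpow_neg hx0.le]
  exact inv_anti₀ (by positivity) h2

/-- In p'(y)(y - w) - d(p(y) - w) the terms of degree d cancel, while the common denominator has
degree d + 1. -/
theorem bracket_isBigO (w : ℝ) :
    (fun y : ℝ => ((derivative p).eval y / (p.eval y - w) - p.natDegree / (y - w)) * y ^ 2)
      =O[atTop] fun _ => (1 : ℝ) := by
  have hd := hp.two_le
  have hne := hp.ne_zero
  set N : ℝ[X] := derivative p * (X - C w) - C (p.natDegree : ℝ) * (p - C w) with hN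
  set Q : ℝ[X] := (p - C w) * (X - C w)
  have hpw : (p - C w).natDegree = p.natDegree := natDegree_sub_C
  have hpw0 : p - C w ≠ 0 := fun h => by rw [h, natDegree_zero] at hpw; omega
  have hQ : Q.natDegree = p.natDegree + 1 := by
    rw [natDegree_mul hpw0 (X_sub_C_ne_zero w), hpw, natDegree_X_sub_C]
  have hQ0 : Q ≠ 0 := mul_ne_zero hpw0 (X_sub_C_ne_zero w)
  have hN1 : N.natDegree ≤ p.natDegree := by
    refine (natDegree_sub_le _ _).trans (max_le ?_ ?_)
    · refine natDegree_mul_le.trans ?_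
      rw [natDegree_X_sub_C]
      have := natDegree_derivative_lt (p := p) (by omega)
      omega
    · exact (natDegree_C_mul_le _ _).trans hpw.le
  obtain ⟨n, hn⟩ : ∃ n, p.natDegree = n + 1 := ⟨p.natDegree - 1, by omega⟩
  have hN2 : N.coeff p.natDegree = 0 := by
    rw [hN, coeff_sub, coeff_C_mul, mul_sub, coeff_sub, coeff_sub, hn, coeff_mul_X, coeff_mul_C,
      coeff_derivative, coeff_derivative, coeff_C_succ,
      coeff_eq_zero_of_natDegree_lt (n := n + 1 + 1) (by omega)]
    push_cast
    ring
  have hN3 : N.natDegree ≤ p.natDegree - 1 := natDegree_le_pred hN1 hN2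
  have hdeg : (N * X ^ 2).degree ≤ Q.degree := by
    rw [degree_eq_natDegree hQ0, hQ]
    have h : (N * X ^ 2).natDegree ≤ p.natDegree + 1 := by
      refine natDegree_mul_le.trans ?_
      rw [natDegree_X_pow]
      omega
    exact degree_le_natDegree.trans (by exact_mod_cast h)
  have h1 := isBigO_atTop_of_degree_le _ _ hdeg
  obtain ⟨K, hK⟩ := h1.bound
  refine Asymptotics.IsBigO.of_bound K ?_
  have hev := Q.eventually_atTop_not_isRoot hQ0
  filter_upwards [hK, hev] with y hy hr
  have hQe : Q.eval y = (p.eval y - w) * (y - w) := by simp [Q]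
  have hr' : (p.eval y - w) * (y - w) ≠ 0 := by rw [← hQe]; exact hr
  have h2 : ((derivative p).eval y / (p.eval y - w) - p.natDegree / (y - w)) * y ^ 2 =
      (N * X ^ 2).eval y / Q.eval y := by
    have := left_ne_zero_of_mul hr'
    have := right_ne_zero_of_mul hr'
    rw [hQe, hN]
    simp only [eval_mul, eval_sub, eval_X, eval_C, eval_pow]
    field_simp
  rw [h2, norm_div, div_le_iff₀ (norm_pos_iff.2 hr), norm_one, mul_one]
  exact hy

/-- The factor Φ' is O(Φ) and the bracket is O(Φ^(-2)), so the product is O(1/Φ), smaller than any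
power. This decay permits the continuation of the transform. -/
theorem decimationTail_isBigO {w : ℝ} (hw : w ≤ 0) (a : ℝ) :
    decimationTail p w =O[atTop] fun x : ℝ => x ^ (-a) := by
  refine Asymptotics.IsBigO.trans ?_ (hp.inv_poincareReal_isBigO a)
  obtain ⟨C, hC, h⟩ := hp.exists_norm_deriv_poincare_le
  obtain ⟨K, hK⟩ := ((hp.bracket_isBigO w).comp_tendsto hp.tendsto_poincareReal).bound
  refine Asymptotics.IsBigO.of_bound (C * K) ?_
  filter_upwards [hK, eventually_ge_atTop 1] with x hx h1
  have hx0 : 0 < x := by linarith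
  have hy := hp.poincareReal_pos hx0
  simp only [Function.comp, norm_one, mul_one, norm_mul, norm_pow] at hx
  have h2 := hp.decimationTail_eq hw hx0
  have e1 : aeval (poincareReal p x : ℂ) (derivative p) =
      (((derivative p).eval (poincareReal p x) : ℝ) : ℂ) :=
    cmap_ofReal _ _
  have e2 : aeval (poincareReal p x : ℂ) p = ((p.eval (poincareReal p x) : ℝ) : ℂ) := cmap_ofReal _ _
  have h3 : aeval (poincare p x) (derivative p) / (aeval (poincare p x) p - w) -
        p.natDegree / (poincare p x - w) =
      (((derivative p).eval (poincareReal p x) / (p.eval (poincareReal p x) - w) -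
        p.natDegree / (poincareReal p x - w) : ℝ) : ℂ) := by
    rw [hp.poincare_ofReal, e1, e2]
    push_cast
    rfl
  rw [h2, h3, norm_mul, Complex.norm_real, norm_inv]
  rw [Real.norm_of_nonneg hy.le] at hx ⊢
  have hx2 : ‖(derivative p).eval (poincareReal p x) / (p.eval (poincareReal p x) - w) -
        p.natDegree / (poincareReal p x - w)‖ ≤ K / poincareReal p x ^ 2 := by
    rwa [le_div_iff₀ (by positivity)]
  calc _ ≤ (C * poincareReal p x) * (K / poincareReal p x ^ 2) :=
        mul_le_mul (h x h1) hx2 (norm_nonneg _) (by positivity)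
    _ = C * K * (poincareReal p x)⁻¹ := by field_simp

omit hp in
theorem truncatedGap_eventuallyEq (w : ℝ) : truncatedGap p w =ᶠ[atTop] decimationTail p w := by
  filter_upwards [eventually_gt_atTop 1] with x hx
  rw [truncatedGap, decimationTail, Set.indicator_of_mem (Set.mem_Ioi.2 hx)]

theorem continuousOn_decimationGap {w : ℝ} (hw : w ≤ 0) :
    ContinuousOn (decimationGap p w) (Set.Ici 0) := by
  have h := (hp.isEntireOfOrder_levelFun w).continuousOn_logDeriv (hp.hasSectorialZeros_levelFun hw)
  refine ContinuousOn.sub (continuousOn_const.mul ?_) (continuousOn_const.mul h)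
  exact h.comp (continuous_const.mul continuous_id).continuousOn fun x hx =>
    Set.mem_Ici.2 (mul_nonneg hp.scaling_pos.le hx)

theorem decimationGap_isBigO_zero {w : ℝ} (hw : w ≤ 0) :
    decimationGap p w =O[𝓝[>] 0] fun x : ℝ => x ^ (-(0 : ℝ)) :=
  isBigO_rpow_neg_zero_of_continuousOn (hp.continuousOn_decimationGap hw)

theorem truncatedGap_isBigO_zero {w : ℝ} (hw : w ≤ 0) :
    truncatedGap p w =O[𝓝[>] 0] fun x : ℝ => x ^ (-(0 : ℝ)) := by
  refine (hp.decimationGap_isBigO_zero hw).congr' ?_ EventuallyEq.rfl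
  filter_upwards [Ioo_mem_nhdsGT one_pos] with x hx
  rw [truncatedGap, Set.indicator_of_notMem (by simpa using hx.2.le), sub_zero]

omit hp in
theorem continuousOn_const_div (c : ℂ) : ContinuousOn (fun y : ℝ => c / y) (Set.Ioi 0) :=
  continuousOn_const.div Complex.continuous_ofReal.continuousOn fun _ hx =>
    Complex.ofReal_ne_zero.2 (ne_of_gt hx)

theorem locallyIntegrableOn_truncatedGap {w : ℝ} (hw : w ≤ 0) :
    LocallyIntegrableOn (truncatedGap p w) (Set.Ioi 0) := by
  have h1 : LocallyIntegrableOn (decimationGap p w) (Set.Ioi 0) :=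
    ((hp.continuousOn_decimationGap hw).mono Set.Ioi_subset_Ici_self).locallyIntegrableOn
      measurableSet_Ioi
  have h2 : LocallyIntegrableOn ((Set.Ioi 1).indicator fun y : ℝ => levelShift p w / y)
      (Set.Ioi 0) := by
    have h3 := (continuousOn_const_div (levelShift p w)).locallyIntegrableOn (μ := volume) measurableSet_Ioi
    rw [locallyIntegrableOn_iff isOpen_Ioi.isLocallyClosed] at h3 ⊢
    exact fun k hk hk2 => (h3 k hk hk2).indicator measurableSet_Ioi
  exact h1.sub h2

theorem truncatedGap_isBigO_atTop {w : ℝ} (hw : w ≤ 0) (a : ℝ) :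
    truncatedGap p w =O[atTop] fun x : ℝ => x ^ (-a) :=
  (hp.decimationTail_isBigO hw a).congr' (truncatedGap_eventuallyEq w).symm EventuallyEq.rfl

theorem mellinConvergent_truncatedGap {w : ℝ} (hw : w ≤ 0) {s : ℂ} (hs : 0 < s.re) :
    MellinConvergent (truncatedGap p w) s :=
  mellinConvergent_of_isBigO_rpow (hp.locallyIntegrableOn_truncatedGap hw)
    (hp.truncatedGap_isBigO_atTop hw (s.re + 1)) (lt_add_one _) (hp.truncatedGap_isBigO_zero hw) hs

theorem differentiableAt_mellin_truncatedGap {w : ℝ} (hw : w ≤ 0) {s : ℂ} (hs : 0 < s.re) :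
    DifferentiableAt ℂ (mellin (truncatedGap p w)) s :=
  mellin_differentiableAt_of_isBigO_rpow (hp.locallyIntegrableOn_truncatedGap hw)
    (hp.truncatedGap_isBigO_atTop hw (s.re + 1)) (lt_add_one _) (hp.truncatedGap_isBigO_zero hw) hs

omit hp in
/-- The Mellin transform of `c / x` on `(1, ∞)`. -/
theorem hasMellin_indicator_Ioi_div (c : ℂ) {s : ℂ} (hs : s.re < 1) :
    HasMellin ((Set.Ioi 1).indicator fun y : ℝ => c / y) s (c / (1 - s)) := by
  have hs' : (s - 2).re < -1 := by simp; linarith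
  have hsub : Set.Ioi (1 : ℝ) ⊆ Set.Ioi 0 := Set.Ioi_subset_Ioi zero_le_one
  have h0 : Set.EqOn (fun t : ℝ => (t : ℂ) ^ (s - 1) • (Set.Ioi 1).indicator (fun y : ℝ => c / y) t)
      ((Set.Ioi 1).indicator fun t : ℝ => c * (t : ℂ) ^ (s - 2)) (Set.Ioi 0) := by
    intro t ht
    have ht' : (t : ℂ) ≠ 0 := Complex.ofReal_ne_zero.2 (ne_of_gt ht)
    by_cases h1 : t ∈ Set.Ioi (1 : ℝ)
    · simp only [Set.indicator_of_mem h1, smul_eq_mul]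
      rw [show s - 2 = (s - 1) - 1 by ring, Complex.cpow_sub (s - 1) 1 ht', Complex.cpow_one]
      ring
    · simp only [Set.indicator_of_notMem h1, smul_zero]
  have h1 : IntegrableOn (fun t : ℝ => c * (t : ℂ) ^ (s - 2)) (Set.Ioi 1) :=
    (integrableOn_Ioi_cpow_of_lt hs' one_pos).const_mul c
  constructor
  · rw [MellinConvergent, integrableOn_congr_fun h0 measurableSet_Ioi]
    exact (h1.integrable_indicator measurableSet_Ioi).integrableOn
  · rw [mellin, setIntegral_congr_fun measurableSet_Ioi h0, setIntegral_indicator measurableSet_Ioi,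
      Set.inter_eq_right.2 hsub, integral_const_mul, integral_Ioi_cpow_of_lt hs' one_pos,
      Complex.ofReal_one, Complex.one_cpow, show s - 2 + 1 = -(1 - s) by ring, neg_div_neg_eq]
    ring

omit hp in
/-- The Mellin transform of `c / x` on `(0, 1]`. -/
theorem hasMellin_indicator_Ioc_div (c : ℂ) {s : ℂ} (hs : 1 < s.re) :
    HasMellin ((Set.Ioc 0 1).indicator fun y : ℝ => c / y) s (c / (s - 1)) := by
  have h := hasMellin_cpow_Ioc (-1) (s := s) (by simp; linarith)
  have h0 : ((Set.Ioc 0 1).indicator fun y : ℝ => c / y) =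
      fun t => c • (Set.Ioc (0 : ℝ) 1).indicator (fun t : ℝ => (t : ℂ) ^ (-1 : ℂ)) t := by
    ext t
    by_cases ht : t ∈ Set.Ioc (0 : ℝ) 1
    · simp only [Set.indicator_of_mem ht, Complex.cpow_neg_one, smul_eq_mul, div_eq_mul_inv]
    · simp only [Set.indicator_of_notMem ht, smul_zero]
  rw [h0]
  refine ⟨h.1.const_smul c, ?_⟩
  rw [mellin_const_smul, h.2, smul_eq_mul, ← sub_eq_add_neg]
  ring

/-- The transform of `truncatedGap` is holomorphic for Re s > 0. Adding c/(1 - s), with c the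
`levelShift`, gives the transform of the gap for 0 < Re s < 1, and the same expression gives that of
the tail for Re s > 1. The two strips are linked in this way. -/
theorem hasMellin_decimationGap {w : ℝ} (hw : w ≤ 0) {s : ℂ} (h0 : 0 < s.re) (h1 : s.re < 1) :
    HasMellin (decimationGap p w) s (mellin (truncatedGap p w) s + levelShift p w / (1 - s)) := by
  have h2 := hasMellin_indicator_Ioi_div (levelShift p w) h1
  have h := hasMellin_add (hp.mellinConvergent_truncatedGap hw h0) h2.1
  rw [h2.2] at h
  simpa only [truncatedGap, sub_add_cancel] using h

theorem hasMellin_decimationTail {w : ℝ} (hw : w ≤ 0) {s : ℂ} (h1 : 1 < s.re) :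
    HasMellin (decimationTail p w) s (mellin (truncatedGap p w) s - levelShift p w / (s - 1)) := by
  have h2 := hasMellin_indicator_Ioc_div (levelShift p w) h1
  have h := hasMellin_sub (hp.mellinConvergent_truncatedGap hw (by linarith)) h2.1
  rw [h2.2] at h
  have heq : Set.EqOn (fun t : ℝ => (t : ℂ) ^ (s - 1) • (truncatedGap p w t -
      (Set.Ioc 0 1).indicator (fun y : ℝ => levelShift p w / y) t))
      (fun t : ℝ => (t : ℂ) ^ (s - 1) • decimationTail p w t) (Set.Ioi 0) := by
    intro t ht
    have ht0 : (0 : ℝ) < t := ht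
    simp only [truncatedGap, decimationTail]
    rcases lt_or_ge 1 t with h | h
    · rw [Set.indicator_of_mem (Set.mem_Ioi.2 h), Set.indicator_of_notMem (by simp [h]), sub_zero]
    · rw [Set.indicator_of_notMem (by simpa using h), 
        Set.indicator_of_mem (show t ∈ Set.Ioc (0 : ℝ) 1 from ⟨ht0, h⟩), sub_zero]
  refine ⟨(integrableOn_congr_fun heq measurableSet_Ioi).1 h.1, ?_⟩
  rw [← h.2, mellin, mellin, setIntegral_congr_fun measurableSet_Ioi heq]

/-- The substitution λx multiplies the transform by λ^(-s). At 1 - s the factor becomes λ^s - d,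
whose zeros are the points s_k. -/
theorem hasMellin_decimationGap_of_logDeriv {L : ℝ → ℂ} {s : ℂ} (h : MellinConvergent L s) :
    HasMellin (fun x => scaling p * L (scaling p * x) - p.natDegree * L x) s
      (((scaling p : ℂ) ^ (1 - s) - p.natDegree) * mellin L s) := by
  have hl := hp.scaling_pos
  have h1 : MellinConvergent (fun x => L (scaling p * x)) s := (MellinConvergent.comp_mul_left hl).2 h
  have h2 := hasMellin_sub (h1.const_smul (scaling p : ℂ)) (h.const_smul (p.natDegree : ℂ))
  rw [mellin_const_smul, mellin_const_smul, mellin_comp_mul_left _ _ hl] at h2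
  refine ⟨h2.1, h2.2.trans ?_⟩
  rw [sub_eq_add_neg (1 : ℂ), Complex.cpow_add _ _ (Complex.ofReal_ne_zero.2 hl.ne'), Complex.cpow_one]
  simp only [smul_eq_mul]
  ring

end IsDecimationPolynomial

/-! ### The logarithm of Ψ and integration by parts. -/

/-- A primitive of `decimationGap`. -/
def gapPrimitive (p : ℝ[X]) (w x : ℝ) : ℂ :=
  open Classical in
  Complex.log (levelFun p w ((scaling p * x : ℝ) : ℂ)) -
    p.natDegree * Complex.log (levelFun p w x) +
    ((if w = 0 then Real.log (scaling p) else 0) - Real.log p.leadingCoeff : ℝ)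

namespace IsDecimationPolynomial

variable {p : ℝ[X]} (hp : IsDecimationPolynomial p)
include hp

theorem levelFun_mem_slitPlane {w : ℝ} (hw : w ≤ 0) {x : ℝ} (hx : 0 ≤ x) :
    levelFun p w x ∈ Complex.slitPlane := by
  rw [hp.levelFun_ofReal, Complex.ofReal_mem_slitPlane]
  exact hp.levelFun_re_pos hw hx

theorem hasDerivAt_log_levelFun {w : ℝ} (hw : w ≤ 0) {x : ℝ} (hx : 0 ≤ x) :
    HasDerivAt (fun y : ℝ => Complex.log (levelFun p w y)) (logDeriv (levelFun p w) x) x :=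
  ((hp.differentiable_levelFun w x).hasDerivAt.comp_ofReal).clog_real
    (hp.levelFun_mem_slitPlane hw hx)

theorem hasDerivAt_gapPrimitive {w : ℝ} (hw : w ≤ 0) {x : ℝ} (hx : 0 ≤ x) :
    HasDerivAt (gapPrimitive p w) (decimationGap p w x) x := by
  have hl := hp.scaling_pos
  have h1 := (hp.hasDerivAt_log_levelFun hw (mul_nonneg hl.le hx)).scomp x
    ((hasDerivAt_id x).const_mul (scaling p))
  have h2 := (hp.hasDerivAt_log_levelFun hw hx).const_mul (p.natDegree : ℂ)
  refine ((h1.sub h2).add_const _).congr_deriv ?_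
  rw [decimationGap, mul_one, Complex.real_smul]

/-- All quantities are positive on the positive axis, so the logarithms add. The constants in
`gapPrimitive` are -log a_d from the normalisation of Ψ and, for w = 0, log λ from the factor λx
divided out of Φ(λx). -/
theorem log_Psi {w : ℝ} (hw : w ≤ 0) {x : ℝ} (hx : 0 < x) :
    Complex.log (Psi p w x) = gapPrimitive p w x - levelShift p w * Complex.log x := by
  have hl := hp.scaling_pos
  have ha := hp.leadingCoeff_pos
  have h1 := hp.levelFun_re_pos hw hx.le
  have h2 := hp.levelFun_re_pos hw (mul_pos hl hx).le
  have e1 : poincareReal p x - w = (if w = 0 then x else 1) * (levelFun p w x).re := by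
    rw [← Complex.ofReal_inj, Complex.ofReal_mul, ← hp.levelFun_ofReal, Complex.ofReal_sub,
      ← hp.poincare_ofReal]
    split_ifs with h
    · rw [h, Complex.ofReal_zero, hp.mul_levelFun_zero, sub_zero]
    · rw [levelFun_of_ne (Complex.ofReal_ne_zero.2 h), Complex.ofReal_one, one_mul]
  have e2 : p.eval (poincareReal p x) - w =
      (if w = 0 then scaling p * x else 1) * (levelFun p w ((scaling p * x : ℝ) : ℂ)).re := by
    rw [← hp.poincareReal_scaling_mul, ← Complex.ofReal_inj, Complex.ofReal_mul,
      ← hp.levelFun_ofReal, Complex.ofReal_sub, ← hp.poincare_ofReal]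
    split_ifs with h
    · rw [h, Complex.ofReal_zero, hp.mul_levelFun_zero, sub_zero]
    · rw [levelFun_of_ne (Complex.ofReal_ne_zero.2 h), Complex.ofReal_one, one_mul]
  have hpsi : Psi p w x = (((p.eval (poincareReal p x) - w) /
      (p.leadingCoeff * (poincareReal p x - w) ^ p.natDegree) : ℝ) : ℂ) := by
    have e3 : aeval (poincareReal p x : ℂ) p = ((p.eval (poincareReal p x) : ℝ) : ℂ) :=
      cmap_ofReal _ _
    rw [Psi, hp.poincare_ofReal, e3]
    push_cast
    rfl
  have p1 : 0 < poincareReal p x - w := by linarith [hp.poincareReal_pos hx]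
  have p2 : 0 < p.eval (poincareReal p x) - w := by
    rw [← hp.poincareReal_scaling_mul]
    linarith [hp.poincareReal_pos (mul_pos hl hx)]
  rw [hpsi, ← Complex.ofReal_log (by positivity), gapPrimitive, hp.levelFun_ofReal,
    hp.levelFun_ofReal w x, ← Complex.ofReal_log h1.le, ← Complex.ofReal_log h2.le,
    ← Complex.ofReal_log hx.le, Real.log_div p2.ne' (by positivity),
    Real.log_mul ha.ne' (by positivity), Real.log_pow, e1, e2]
  rcases eq_or_ne w 0 with rfl | hw0
  · rw [levelShift_zero, if_pos rfl, if_pos rfl, if_pos rfl, Real.log_mul hx.ne' h1.ne',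
      Real.log_mul (by positivity) h2.ne', Real.log_mul hl.ne' hx.ne']
    push_cast
    ring
  · rw [levelShift_of_ne hw0, if_neg hw0, if_neg hw0, if_neg hw0, one_mul, one_mul]
    push_cast
    ring

/-- Numerator and denominator share the leading term a_d y^d, so their difference has degree at most
d - 1. -/
theorem Psi_isBigO (w : ℝ) :
    (fun y : ℝ => (p.eval y - w) / (p.leadingCoeff * (y - w) ^ p.natDegree) - 1)
      =O[atTop] fun y => y⁻¹ := by
  have hd := hp.two_le
  have ha := hp.leadingCoeff_pos
  set Q : ℝ[X] := C p.leadingCoeff * (X - C w) ^ p.natDegree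
  have hpw : (p - C w).natDegree = p.natDegree := natDegree_sub_C
  have hmon : ((X - C w) ^ p.natDegree : ℝ[X]).Monic := (monic_X_sub_C w).pow _
  have hdegX : ((X - C w) ^ p.natDegree : ℝ[X]).natDegree = p.natDegree := by
    rw [natDegree_pow, natDegree_X_sub_C, mul_one]
  have hQ : Q.natDegree = p.natDegree := by
    rw [natDegree_C_mul ha.ne', hdegX]
  have hQ0 : Q ≠ 0 := fun h => by rw [h, natDegree_zero] at hQ; omega
  have hcoeff : (p - C w - Q).coeff p.natDegree = 0 := by
    have h1 : ((X - C w) ^ p.natDegree : ℝ[X]).coeff p.natDegree = 1 := by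
      have := hmon.coeff_natDegree
      rwa [hdegX] at this
    rw [coeff_sub, coeff_sub, coeff_C_mul, h1, coeff_C_of_ne_zero (by omega)]
    simp
  have hle : (p - C w - Q).natDegree ≤ p.natDegree - 1 :=
    natDegree_le_pred ((natDegree_sub_le _ _).trans (max_le hpw.le hQ.le)) hcoeff
  have hdeg : ((p - C w - Q) * X).degree ≤ Q.degree := by
    rw [degree_eq_natDegree hQ0, hQ]
    have h : ((p - C w - Q) * X).natDegree ≤ p.natDegree := by
      refine natDegree_mul_le.trans ?_
      rw [natDegree_X]
      omega
    exact degree_le_natDegree.trans (by exact_mod_cast h)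
  obtain ⟨K, hK⟩ := (isBigO_atTop_of_degree_le _ _ hdeg).bound
  refine Asymptotics.IsBigO.of_bound K ?_
  filter_upwards [hK, Q.eventually_atTop_not_isRoot hQ0, eventually_gt_atTop 0] with y hy hr hy0
  have hQe : Q.eval y = p.leadingCoeff * (y - w) ^ p.natDegree := by simp [Q]
  have hr' : Q.eval y ≠ 0 := hr
  rw [← hQe]
  have h2 : (p.eval y - w) / Q.eval y - 1 = ((p - C w - Q) * X).eval y / Q.eval y * y⁻¹ := by
    simp only [eval_mul, eval_sub, eval_X, eval_C]
    field_simp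
  rw [h2, norm_mul, norm_div]
  gcongr
  rwa [div_le_iff₀ (norm_pos_iff.2 hr')]

theorem log_Psi_isBigO_atTop (w a : ℝ) :
    (fun x : ℝ => Complex.log (Psi p w x)) =O[atTop] fun x : ℝ => x ^ (-a) := by
  refine Asymptotics.IsBigO.trans ?_ (hp.inv_poincareReal_isBigO a)
  set f : ℝ → ℝ := fun y => (p.eval y - w) / (p.leadingCoeff * (y - w) ^ p.natDegree)
  have h1 : (fun y => f y - 1) =O[atTop] fun y => y⁻¹ := hp.Psi_isBigO w
  have h2 : Tendsto f atTop (𝓝 1) := by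
    have h3 := h1.trans_tendsto tendsto_inv_atTop_zero
    simpa using h3.add_const 1
  have h3 : (fun y => Real.log (f y)) =O[atTop] fun y => f y - 1 := by
    have := (Real.hasDerivAt_log one_ne_zero).isBigO_sub.comp_tendsto h2
    simpa [Function.comp_def] using this
  have h4 := (h3.trans h1).comp_tendsto hp.tendsto_poincareReal
  have h5 : ∀ᶠ x in atTop, 0 < f (poincareReal p x) :=
    (h2.comp hp.tendsto_poincareReal).eventually (lt_mem_nhds one_pos)
  refine Asymptotics.IsBigO.congr' (h4.norm_left) ?_ EventuallyEq.rfl |>.of_norm_left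
  filter_upwards [h5] with x hx
  have e3 : aeval (poincareReal p x : ℂ) p = ((p.eval (poincareReal p x) : ℝ) : ℂ) :=
    cmap_ofReal _ _
  have hpsi : Psi p w x = ((f (poincareReal p x) : ℝ) : ℂ) := by
    rw [Psi, hp.poincare_ofReal, e3]
    simp only [f]
    push_cast
    rfl
  rw [hpsi, ← Complex.ofReal_log hx.le, Complex.norm_real]
  rfl

theorem hasDerivAt_log_Psi {w : ℝ} (hw : w ≤ 0) {x : ℝ} (hx : 0 < x) :
    HasDerivAt (fun x : ℝ => Complex.log (Psi p w x)) (decimationTail p w x) x := by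
  have h1 : HasDerivAt (fun y : ℝ => Complex.log (y : ℂ)) (1 / (x : ℂ)) x :=
    HasDerivAt.clog_real (hasDerivAt_id (x : ℂ)).comp_ofReal (Complex.ofReal_mem_slitPlane.2 hx)
  have h2 := (hp.hasDerivAt_gapPrimitive hw hx.le).sub (h1.const_mul (levelShift p w))
  refine (h2.congr_deriv ?_).congr_of_eventuallyEq ?_
  · rw [decimationTail]; ring
  · filter_upwards [lt_mem_nhds hx] with y hy
    exact hp.log_Psi hw hy

theorem continuousOn_gapPrimitive {w : ℝ} (hw : w ≤ 0) :
    ContinuousOn (gapPrimitive p w) (Set.Ici 0) := fun _ hx =>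
  (hp.hasDerivAt_gapPrimitive hw hx).continuousAt.continuousWithinAt

/-- Near 0 only the term in log x is unbounded, and it is weaker than any negative power. -/
theorem log_Psi_isBigO_zero {w : ℝ} (hw : w ≤ 0) {b : ℝ} (hb : 0 < b) :
    (fun x : ℝ => Complex.log (Psi p w x)) =O[𝓝[>] 0] fun x : ℝ => x ^ (-b) := by
  have h1 := isBigO_rpow_neg_zero_of_continuousOn (hp.continuousOn_gapPrimitive hw)
  have h2 : (fun x : ℝ => x ^ (-(0 : ℝ))) =O[𝓝[>] 0] fun x : ℝ => x ^ (-b) := by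
    refine Asymptotics.IsBigO.of_bound 1 ?_
    filter_upwards [Ioo_mem_nhdsGT one_pos] with x hx
    have hx0 : 0 < x := hx.1
    rw [neg_zero, Real.rpow_zero, norm_one, one_mul, Real.norm_of_nonneg (by positivity)]
    exact Real.one_le_rpow_of_pos_of_le_one_of_nonpos hx.1 hx.2.le (by linarith)
  have h3 : (fun x : ℝ => levelShift p w * Complex.log x) =O[𝓝[>] 0] fun x : ℝ => x ^ (-b) := by
    refine Asymptotics.IsBigO.const_mul_left ?_ _
    have h4 := (isLittleO_log_rpow_nhdsGT_zero (neg_lt_zero.2 hb)).isBigO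
    refine (h4.norm_left.congr' ?_ EventuallyEq.rfl).of_norm_left
    filter_upwards [self_mem_nhdsWithin] with x hx
    rw [← Complex.ofReal_log (le_of_lt hx), Complex.norm_real]
  refine ((h1.trans h2).sub h3).congr' ?_ EventuallyEq.rfl
  filter_upwards [self_mem_nhdsWithin] with x hx
  exact (hp.log_Psi hw hx).symm

theorem mellinConvergent_log_Psi {w : ℝ} (hw : w ≤ 0) {s : ℂ} (hs : 0 < s.re) :
    MellinConvergent (fun x : ℝ => Complex.log (Psi p w x)) s := by
  refine mellinConvergent_of_isBigO_rpow ?_ (hp.log_Psi_isBigO_atTop w (s.re + 1)) (lt_add_one _)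
    (hp.log_Psi_isBigO_zero hw (half_pos hs)) (half_lt_self hs)
  refine ContinuousOn.locallyIntegrableOn (fun x hx => ?_) measurableSet_Ioi
  exact (hp.hasDerivAt_log_Psi hw hx).continuousAt.continuousWithinAt

theorem tendsto_log_Psi_mul_cpow_zero {w : ℝ} (hw : w ≤ 0) {s : ℂ} (hs : s.re < 0) :
    Tendsto (fun x : ℝ => Complex.log (Psi p w x) * (x : ℂ) ^ (-s)) (𝓝[>] 0) (𝓝 0) := by
  have h1 := hp.log_Psi_isBigO_zero hw (b := -s.re / 2) (by linarith)
  have h2 : (fun x : ℝ => (x : ℂ) ^ (-s)) =O[𝓝[>] 0] fun x : ℝ => x ^ (-s.re) := by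
    refine Asymptotics.IsBigO.of_bound 1 ?_
    filter_upwards [self_mem_nhdsWithin] with x hx
    have hx0 : (0 : ℝ) < x := hx
    rw [Complex.norm_cpow_eq_rpow_re_of_pos hx0, one_mul, Real.norm_of_nonneg (by positivity),
      Complex.neg_re]
  refine (h1.mul h2).trans_tendsto ?_
  have h3 : Tendsto (fun x : ℝ => x ^ (-s.re / 2)) (𝓝[>] 0) (𝓝 0) := by
    have h4 := (Real.continuous_rpow_const (q := -s.re / 2) (by linarith)).tendsto 0
    rw [Real.zero_rpow (by linarith)] at h4
    exact h4.mono_left nhdsWithin_le_nhds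
  refine h3.congr' ?_
  filter_upwards [self_mem_nhdsWithin] with x hx
  rw [← Real.rpow_add hx]
  ring_nf

theorem tendsto_log_Psi_mul_cpow_atTop (w : ℝ) (s : ℂ) :
    Tendsto (fun x : ℝ => Complex.log (Psi p w x) * (x : ℂ) ^ (-s)) atTop (𝓝 0) := by
  have h1 := hp.log_Psi_isBigO_atTop w (-s.re + 1)
  have h2 : (fun x : ℝ => (x : ℂ) ^ (-s)) =O[atTop] fun x : ℝ => x ^ (-s.re) := by
    refine Asymptotics.IsBigO.of_bound 1 ?_
    filter_upwards [eventually_gt_atTop 0] with x hx0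
    rw [Complex.norm_cpow_eq_rpow_re_of_pos hx0, one_mul, Real.norm_of_nonneg (by positivity),
      Complex.neg_re]
  refine (h1.mul h2).trans_tendsto ((tendsto_rpow_neg_atTop one_pos).congr' ?_)
  filter_upwards [eventually_gt_atTop 0] with x hx
  rw [← Real.rpow_add hx]
  ring_nf

/-- Integration by parts against x^(-s). The boundary term at 0 vanishes because Re s < 0, the one
at infinity by the rapid decay of log Ψ. -/
theorem mellin_decimationTail {w : ℝ} (hw : w ≤ 0) {s : ℂ} (hs : s.re < 0) :
    mellin (decimationTail p w) (1 - s) =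
      s * ∫ x in Set.Ioi (0 : ℝ), Complex.log (Psi p w x) * (x : ℂ) ^ (-s - 1) := by
  have hs1 : 1 < (1 - s).re := by simp; linarith
  have hs0 : s ≠ 0 := by rintro rfl; simp at hs
  have hI := (hp.hasMellin_decimationTail hw hs1).1
  have hJ := hp.mellinConvergent_log_Psi hw (s := -s) (by simpa using hs)
  rw [MellinConvergent, show 1 - s - 1 = -s by ring] at hI
  rw [MellinConvergent] at hJ
  have h := integral_Ioi_mul_deriv_eq_deriv_mul (a := (0 : ℝ)) (a' := (0 : ℂ)) (b' := 0)
    (u := fun x : ℝ => Complex.log (Psi p w x)) (v := fun x : ℝ => (x : ℂ) ^ (-s))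
    (u' := decimationTail p w) (v' := fun x : ℝ => -s * (x : ℂ) ^ (-s - 1))
    (fun x hx => hp.hasDerivAt_log_Psi hw hx)
    (fun x hx => by
      have h1 := (hasDerivAt_id (x : ℂ)).cpow_const (c := -s) (Complex.ofReal_mem_slitPlane.2 hx)
      exact (h1.comp_ofReal).congr_deriv (by simp))
    (by
      have := hJ.const_mul (-s)
      refine this.congr (Eventually.of_forall fun x => ?_)
      simp only [Pi.mul_apply, smul_eq_mul]
      ring)
    (by
      refine Integrable.congr hI (Eventually.of_forall fun x => ?_)
      simp only [Pi.mul_apply, smul_eq_mul]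
      ring)
    (hp.tendsto_log_Psi_mul_cpow_zero hw hs) (hp.tendsto_log_Psi_mul_cpow_atTop w s)
  rw [mellin, show 1 - s - 1 = -s by ring]
  have e1 : ∫ x in Set.Ioi (0 : ℝ), Complex.log (Psi p w x) * (-s * (x : ℂ) ^ (-s - 1)) =
      -s * ∫ x in Set.Ioi (0 : ℝ), Complex.log (Psi p w x) * (x : ℂ) ^ (-s - 1) := by
    rw [← integral_const_mul]
    congr 1
    ext x
    ring
  have e2 : ∫ x in Set.Ioi (0 : ℝ), decimationTail p w x * (x : ℂ) ^ (-s) =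
      ∫ x in Set.Ioi (0 : ℝ), (x : ℂ) ^ (-s) • decimationTail p w x := by
    congr 1
    ext x
    rw [smul_eq_mul, mul_comm]
  rw [e1, e2] at h
  linear_combination h

/-- At 1 the transform is the plain integral of the gap, that is, minus the value of `gapPrimitive`
at 0. For w < 0 the level function equals -w there. -/
theorem mellin_truncatedGap_one {w : ℝ} (hw : w < 0) : mellin (truncatedGap p w) 1 =
    ((p.natDegree - 1) * Real.log (-w) + Real.log p.leadingCoeff : ℝ) := by
  have h0 : truncatedGap p w = decimationGap p w := by
    ext x
    simp [truncatedGap, levelShift_of_ne hw.ne]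
  have hlog : ∀ x : ℝ, 0 < x → Complex.log (Psi p w x) = gapPrimitive p w x := fun x hx => by
    rw [hp.log_Psi hw.le hx, levelShift_of_ne hw.ne, zero_mul, sub_zero]
  have hI := hp.mellinConvergent_truncatedGap hw.le (s := 1) (by simp)
  rw [MellinConvergent, h0] at hI
  have hI' : IntegrableOn (decimationGap p w) (Set.Ioi 0) := by simpa using hI
  have h1 := integral_Ioi_of_hasDerivAt_of_tendsto (m := (0 : ℂ))
    (hp.continuousOn_gapPrimitive hw.le 0 Set.self_mem_Ici)
    (fun x hx => hp.hasDerivAt_gapPrimitive hw.le (le_of_lt hx)) hI' (by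
      have := hp.tendsto_log_Psi_mul_cpow_atTop w 0
      simp only [neg_zero, Complex.cpow_zero, mul_one] at this
      refine this.congr' ?_
      filter_upwards [eventually_gt_atTop 0] with x hx
      exact hlog x hx)
  rw [mellin, h0]
  simp only [sub_self, Complex.cpow_zero, one_smul]
  have h2 : levelFun p w 0 = ((-w : ℝ) : ℂ) := by
    rw [levelFun_of_ne (Complex.ofReal_ne_zero.2 hw.ne)]
    simp [hp.poincare_zero]
  rw [h1, gapPrimitive, if_neg hw.ne, mul_zero, Complex.ofReal_zero, h2,
    ← Complex.ofReal_log (by linarith)]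
  push_cast
  ring

end IsDecimationPolynomial

/-! ### Continuation of the partial zeta functions. -/

/-- The numerator of the continuation of the partial zeta function to `Re s < 1`. -/
def zetaNumerator (p : ℝ[X]) (w : ℝ) (s : ℂ) : ℂ :=
  Complex.sin (Real.pi * s) * mellin (truncatedGap p w) (1 - s) +
    levelShift p w * dslope (fun s : ℂ => Complex.sin (Real.pi * s)) 0 s

open Classical in
/-- The meromorphic continuation of the partial zeta function. -/
def continuedZeta (p : ℝ[X]) (w : ℝ) (s : ℂ) : ℂ :=
  if s.re < 1 then
    zetaNumerator p w s / (Real.pi * ((scaling p : ℂ) ^ s - p.natDegree))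
  else partialZeta p w s

theorem continuedZeta_of_lt (p : ℝ[X]) (w : ℝ) {s : ℂ} (hs : s.re < 1) : continuedZeta p w s =
    zetaNumerator p w s / (Real.pi * ((scaling p : ℂ) ^ s - p.natDegree)) := if_pos hs

theorem sin_pi_mul_ne_zero_of_re {s : ℂ} (h0 : 0 < s.re) (h1 : s.re < 1) :
    Complex.sin (Real.pi * s) ≠ 0 := by
  rw [Complex.sin_ne_zero_iff]
  intro k hk
  have h2 : s = k := by
    have hpi : (Real.pi : ℂ) ≠ 0 := Complex.ofReal_ne_zero.2 Real.pi_ne_zero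
    rw [mul_comm] at hk
    exact mul_right_cancel₀ hpi hk
  rw [h2, Complex.intCast_re] at h0 h1
  have h3 : 0 < k := by exact_mod_cast h0
  have h4 : k < 1 := by exact_mod_cast h1
  omega

theorem mul_dslope_sin (s : ℂ) : s * dslope (fun s : ℂ => Complex.sin (Real.pi * s)) 0 s =
    Complex.sin (Real.pi * s) := by
  have := sub_smul_dslope (fun s : ℂ => Complex.sin (Real.pi * s)) 0 s
  simpa using this

theorem differentiable_dslope_sin :
    Differentiable ℂ (dslope (fun s : ℂ => Complex.sin (Real.pi * s)) 0) := by
  rw [← differentiableOn_univ, Complex.differentiableOn_dslope univ_mem, differentiableOn_univ]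
  fun_prop

namespace IsDecimationPolynomial

variable {p : ℝ[X]} (hp : IsDecimationPolynomial p)
include hp

theorem log_scaling_pos : 0 < Real.log (scaling p) := Real.log_pos hp.one_lt_scaling

theorem scaling_ne_zero : (scaling p : ℂ) ≠ 0 := Complex.ofReal_ne_zero.2 hp.scaling_pos.ne'

theorem scaling_cpow_eq_exp (s : ℂ) :
    (scaling p : ℂ) ^ s = Complex.exp ((Real.log (scaling p) : ℂ) * s) := by
  rw [Complex.cpow_def_of_ne_zero hp.scaling_ne_zero, Complex.ofReal_log hp.scaling_pos.le]

theorem norm_scaling_cpow (s : ℂ) : ‖(scaling p : ℂ) ^ s‖ = scaling p ^ s.re :=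
  Complex.norm_cpow_eq_rpow_re_of_pos hp.scaling_pos s

theorem scaling_cpow_neg_eq_iff {c s : ℂ} (hc : c ≠ 0) :
    (scaling p : ℂ) ^ (-s) = c ↔ ∃ k : ℤ, s = ratPole p c k := by
  have hl : (Real.log (scaling p) : ℂ) ≠ 0 := Complex.ofReal_ne_zero.2 hp.log_scaling_pos.ne'
  have h0 : (scaling p : ℂ) ^ (-s) = c ↔
      (scaling p : ℂ) ^ (-s) = Complex.exp (Complex.log c) := by rw [Complex.exp_log hc]
  rw [h0, hp.scaling_cpow_eq_exp, Complex.exp_eq_exp_iff_exists_int]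
  constructor
  · rintro ⟨n, hn⟩
    refine ⟨-n, ?_⟩
    rw [ratPole]
    push_cast
    field_simp
    linear_combination -hn
  · rintro ⟨k, hk⟩
    refine ⟨-k, ?_⟩
    rw [hk, ratPole]
    push_cast
    field_simp
    ring

theorem scaling_cpow_eq_natDegree_iff {s : ℂ} :
    (scaling p : ℂ) ^ s = p.natDegree ↔ ∃ k : ℤ, s = basePole p k := by
  have hd : (0 : ℝ) < p.natDegree := by exact_mod_cast (by linarith [hp.two_le] : 0 < p.natDegree)
  have hd' : ((p.natDegree : ℂ))⁻¹ ≠ 0 := inv_ne_zero (by exact_mod_cast hd.ne')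
  rw [← inv_inj, ← Complex.cpow_neg, hp.scaling_cpow_neg_eq_iff hd']
  have h : ∀ k, ratPole p ((p.natDegree : ℂ))⁻¹ k = basePole p k := fun k => by
    have h1 : Complex.log ((p.natDegree : ℂ))⁻¹ = ((-Real.log p.natDegree : ℝ) : ℂ) := by
      rw [← Real.log_inv, Complex.ofReal_log (by positivity)]
      push_cast
      rfl
    rw [ratPole, basePole, h1, rho, Real.logb]
    push_cast
    ring
  simp_rw [h]

theorem basePole_re (k : ℤ) : (basePole p k).re = rho p := by
  have h := hp.scaling_cpow_eq_natDegree_iff.2 ⟨k, rfl⟩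
  have h1 := congrArg norm h
  rw [hp.norm_scaling_cpow, Complex.norm_natCast, ← hp.scaling_rpow_rho] at h1
  have h2 := congrArg Real.log h1
  rw [Real.log_rpow hp.scaling_pos, Real.log_rpow hp.scaling_pos] at h2
  exact mul_right_cancel₀ hp.log_scaling_pos.ne' h2

theorem differentiableAt_zetaNumerator {w : ℝ} (hw : w ≤ 0) {s : ℂ} (hs : s.re < 1) :
    DifferentiableAt ℂ (zetaNumerator p w) s := by
  have h1 : DifferentiableAt ℂ (fun s => mellin (truncatedGap p w) (1 - s)) s :=
    DifferentiableAt.comp s (f := fun s : ℂ => 1 - s)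
      (hp.differentiableAt_mellin_truncatedGap hw (by simpa using hs)) (by fun_prop)
  refine DifferentiableAt.add (DifferentiableAt.mul (by fun_prop) h1) ?_
  exact (differentiable_dslope_sin s).const_mul _

/-- The scaling relation and `mellin_logDeriv` evaluate the same transform. The first alternative
sets aside the points where the transform of the logarithmic derivative is not under control. -/
theorem mellin_decimationGap_eq {w : ℝ} (hw : w ≤ 0) {s : ℂ} (h0 : 0 < s.re) (h1 : s.re < 1) :
    s.re ≤ rho p ∨ Complex.sin (Real.pi * s) * mellin (decimationGap p w) (1 - s) =
      Real.pi * ((scaling p : ℂ) ^ s - p.natDegree) * partialZeta p w s := by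
  refine or_iff_not_imp_left.2 fun hs => ?_
  push Not at hs
  have hF := hp.isEntireOfOrder_levelFun w
  have hS := hp.hasSectorialZeros_levelFun hw
  have g0 : 0 < (1 - s).re := by simpa using h1
  have g1 : (1 - s).re < 1 - rho p := by simpa using hs
  have h2 := (hp.hasMellin_decimationGap_of_logDeriv (hF.mellinConvergent_logDeriv hS g0 g1)).2
  have h3 := hF.mellin_logDeriv hS g0 g1
  rw [show 1 - s - 1 = -s by ring, ← hp.partialZeta_eq_tsum,
    show (Real.pi : ℂ) * (1 - s) = Real.pi - Real.pi * s by ring, Complex.sin_pi_sub] at h3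
  rw [h3, sub_sub_cancel] at h2
  have h4 : mellin (decimationGap p w) (1 - s) = _ := h2
  rw [h4]
  have := sin_pi_mul_ne_zero_of_re h0 h1
  field_simp

/-- The correction c/(1 - s) becomes c/s at 1 - s. Its product with sin(πs) is c times the `dslope`
of the sine, which keeps the numerator regular at s = 0. -/
theorem zetaNumerator_eq {w : ℝ} (hw : w ≤ 0) {s : ℂ} (h0 : 0 < s.re) (h1 : s.re < 1) :
    zetaNumerator p w s = Complex.sin (Real.pi * s) * mellin (decimationGap p w) (1 - s) := by
  have hs : s ≠ 0 := by rintro rfl; simp at h0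
  rw [(hp.hasMellin_decimationGap hw (s := 1 - s) (by simpa using h1) (by simpa using h0)).2,
    zetaNumerator, sub_sub_cancel, mul_add, ← mul_dslope_sin s]
  field_simp

/-- The two branches of the definition overlap on ρ < Re s < 1, where λ^s ≠ d because all s_k have
real part ρ. Their agreement there makes the glued function analytic across Re s = 1. -/
theorem continuedZeta_eq_partialZeta {w : ℝ} (hw : w ≤ 0) {s : ℂ} (hs : rho p < s.re) :
    continuedZeta p w s = partialZeta p w s := by
  rcases lt_or_ge s.re 1 with h1 | h1
  · have h0 : 0 < s.re := hp.rho_pos.trans hs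
    have h2 : (scaling p : ℂ) ^ s - p.natDegree ≠ 0 := fun h => by
      obtain ⟨k, hk⟩ := hp.scaling_cpow_eq_natDegree_iff.1 (sub_eq_zero.1 h)
      rw [hk, hp.basePole_re] at hs
      exact lt_irrefl _ hs
    have hpi : (Real.pi : ℂ) ≠ 0 := Complex.ofReal_ne_zero.2 Real.pi_ne_zero
    rw [continuedZeta_of_lt p w h1, hp.zetaNumerator_eq hw h0 h1,
      (hp.mellin_decimationGap_eq hw h0 h1).resolve_left (not_le.2 hs)]
    field_simp
  · exact if_neg (not_lt.2 h1)

omit hp in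
theorem eventuallyEq_continuedZeta (w : ℝ) {s : ℂ} (hs : s.re < 1) : continuedZeta p w =ᶠ[𝓝 s]
    fun s => zetaNumerator p w s / (Real.pi * ((scaling p : ℂ) ^ s - p.natDegree)) := by
  filter_upwards [(isOpen_lt Complex.continuous_re continuous_const).mem_nhds hs] with z hz
  exact continuedZeta_of_lt p w hz

theorem analyticAt_zetaNumerator {w : ℝ} (hw : w ≤ 0) {s : ℂ} (hs : s.re < 1) :
    AnalyticAt ℂ (zetaNumerator p w) s := by
  have hU : IsOpen {z : ℂ | z.re < 1} := isOpen_lt Complex.continuous_re continuous_const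
  have h : DifferentiableOn ℂ (zetaNumerator p w) {z : ℂ | z.re < 1} := fun z hz =>
    (hp.differentiableAt_zetaNumerator hw hz).differentiableWithinAt
  exact h.analyticAt (hU.mem_nhds hs)

theorem analyticAt_zetaDenominator (s : ℂ) :
    AnalyticAt ℂ (fun s : ℂ => Real.pi * ((scaling p : ℂ) ^ s - p.natDegree)) s := by
  have h : Differentiable ℂ fun s : ℂ => Real.pi * ((scaling p : ℂ) ^ s - p.natDegree) := by
    intro s
    exact ((differentiableAt_id.const_cpow (Or.inl hp.scaling_ne_zero)).sub_const _).const_mul _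
  exact h.analyticAt s

theorem analyticAt_continuedZeta_of_rho_lt {w : ℝ} (hw : w ≤ 0) {s : ℂ} (hs : rho p < s.re) :
    AnalyticAt ℂ (continuedZeta p w) s := by
  have hU : IsOpen {z : ℂ | rho p < z.re} := isOpen_lt continuous_const Complex.continuous_re
  refine ((hp.differentiableOn_partialZeta w).analyticAt (hU.mem_nhds hs)).congr ?_
  filter_upwards [hU.mem_nhds hs] with z hz
  exact (hp.continuedZeta_eq_partialZeta hw hz).symm

theorem analyticAt_continuedZeta {w : ℝ} (hw : w ≤ 0) {s : ℂ} (hs : ∀ k : ℤ, s ≠ basePole p k) :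
    AnalyticAt ℂ (continuedZeta p w) s := by
  rcases lt_or_ge s.re 1 with h1 | h1
  · refine (AnalyticAt.div (hp.analyticAt_zetaNumerator hw h1) (hp.analyticAt_zetaDenominator s)
      ?_).congr (eventuallyEq_continuedZeta w h1).symm
    refine mul_ne_zero (Complex.ofReal_ne_zero.2 Real.pi_ne_zero) fun h => ?_
    obtain ⟨k, hk⟩ := hp.scaling_cpow_eq_natDegree_iff.1 (sub_eq_zero.1 h)
    exact hs k hk
  · exact hp.analyticAt_continuedZeta_of_rho_lt hw (hp.rho_lt_one.trans_le h1)

theorem meromorphic_continuedZeta {w : ℝ} (hw : w ≤ 0) : Meromorphic (continuedZeta p w) := by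
  intro s
  rcases lt_or_ge s.re 1 with h1 | h1
  · exact ((hp.analyticAt_zetaNumerator hw h1).meromorphicAt.div
      (hp.analyticAt_zetaDenominator s).meromorphicAt).congr
      ((eventuallyEq_continuedZeta w h1).symm.filter_mono nhdsWithin_le_nhds)
  · exact (hp.analyticAt_continuedZeta_of_rho_lt hw (hp.rho_lt_one.trans_le h1)).meromorphicAt

/-- The difference is wΦ'/(Φ(Φ - w)) + 1/x = O(1/x) at infinity. It converges on the whole strip,
while each term separately is known to do so only for Re s < 1 - ρ, which leaves out the points 1 -
s_k. -/
theorem mellinConvergent_logDeriv_sub {w : ℝ} (hw : w < 0) {s : ℂ} (h0 : 0 < s.re)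
    (h1 : s.re < 1) : MellinConvergent
      (fun x : ℝ => logDeriv (levelFun p w) x - logDeriv (levelFun p (0 : ℝ)) x) s := by
  have hFw := hp.isEntireOfOrder_levelFun w
  have hF0 := hp.isEntireOfOrder_levelFun (0 : ℝ)
  have hc := (hFw.continuousOn_logDeriv (hp.hasSectorialZeros_levelFun hw.le)).sub
    (hF0.continuousOn_logDeriv (hp.hasSectorialZeros_levelFun le_rfl))
  refine mellinConvergent_of_isBigO_rpow (a := 1) (b := 0)
    ((hc.mono Set.Ioi_subset_Ici_self).locallyIntegrableOn measurableSet_Ioi) ?_ h1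
    (isBigO_rpow_neg_zero_of_continuousOn hc) h0
  obtain ⟨C, hC, h⟩ := hp.exists_norm_deriv_poincare_le
  refine Asymptotics.IsBigO.of_bound (C * |w| + 1) ?_
  filter_upwards [eventually_ge_atTop 1] with x hx
  have hx0 : 0 < x := by linarith
  have hx' : (x : ℂ) ≠ 0 := Complex.ofReal_ne_zero.2 hx0.ne'
  have hy := hp.le_poincareReal hx0.le
  have hy0 : 0 < poincareReal p x := by linarith
  have hyw : 0 < poincareReal p x - w := by linarith
  have hne := hp.levelFun_ne_zero le_rfl hx0.le
  rw [Complex.ofReal_zero] at hne ⊢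
  rw [logDeriv_levelFun_of_ne (Complex.ofReal_ne_zero.2 hw.ne),
    hp.logDeriv_levelFun_zero hx' hne]
  have e1 : deriv (poincare p) x / (poincare p x - w) -
      (deriv (poincare p) x / poincare p x - 1 / x) =
      deriv (poincare p) x * w / (poincare p x * (poincare p x - w)) + 1 / x := by
    have g1 : poincare p x ≠ 0 := by
      rw [hp.poincare_ofReal]; exact Complex.ofReal_ne_zero.2 hy0.ne'
    have g2 : poincare p x - w ≠ 0 := by
      rw [hp.poincare_ofReal, ← Complex.ofReal_sub]; exact Complex.ofReal_ne_zero.2 hyw.ne'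
    field_simp
    ring
  rw [e1, Real.rpow_neg_one, norm_inv, Real.norm_of_nonneg hx0.le]
  refine (norm_add_le _ _).trans ?_
  have e2 : ‖(1 : ℂ) / x‖ = x⁻¹ := by
    rw [norm_div, norm_one, Complex.norm_real, Real.norm_of_nonneg hx0.le, one_div]
  have e3 : ‖deriv (poincare p) x * w / (poincare p x * (poincare p x - w))‖ ≤ C * |w| * x⁻¹ := by
    rw [norm_div, norm_mul, norm_mul, hp.poincare_ofReal, ← Complex.ofReal_sub, Complex.norm_real,
      Complex.norm_real, Complex.norm_real, Real.norm_of_nonneg hy0.le, Real.norm_of_nonneg hyw.le,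
      Real.norm_eq_abs]
    calc ‖deriv (poincare p) x‖ * |w| / (poincareReal p x * (poincareReal p x - w))
        ≤ (C * poincareReal p x) * |w| / (poincareReal p x * x) := by
          gcongr
          · exact h x hx
          · linarith
      _ = C * |w| * x⁻¹ := by field_simp
  rw [e2]
  linarith

/-- The difference of the gaps for w and 0 has the transform (λ^s - d) times a finite number, and
this vanishes at s_k. The residue is therefore the one for w = 0. -/
theorem zetaNumerator_basePole {w : ℝ} (hw : w ≤ 0) (k : ℤ) :
    zetaNumerator p w (basePole p k) = zetaNumerator p 0 (basePole p k) := by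
  rcases eq_or_lt_of_le hw with rfl | hw0
  · rfl
  have h0 : 0 < (basePole p k).re := by rw [hp.basePole_re]; exact hp.rho_pos
  have h1 : (basePole p k).re < 1 := by rw [hp.basePole_re]; exact hp.rho_lt_one
  have g0 : 0 < (1 - basePole p k).re := by simpa using h1
  have g1 : (1 - basePole p k).re < 1 := by simpa using h0
  rw [hp.zetaNumerator_eq hw h0 h1, hp.zetaNumerator_eq le_rfl h0 h1]
  congr 1
  have h2 := hp.hasMellin_decimationGap_of_logDeriv (hp.mellinConvergent_logDeriv_sub hw0 g0 g1)
  have h3 := hasMellin_sub (hp.hasMellin_decimationGap hw g0 g1).1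
    (hp.hasMellin_decimationGap le_rfl g0 g1).1
  rw [sub_sub_cancel, hp.scaling_cpow_eq_natDegree_iff.2 ⟨k, rfl⟩, sub_self, zero_mul] at h2
  have h4 : (fun t => decimationGap p w t - decimationGap p 0 t) = fun x : ℝ =>
      scaling p * (logDeriv (levelFun p w) ((scaling p * x : ℝ) : ℂ) -
        logDeriv (levelFun p (0 : ℝ)) ((scaling p * x : ℝ) : ℂ)) -
      p.natDegree * (logDeriv (levelFun p w) x - logDeriv (levelFun p (0 : ℝ)) x) := by
    ext t
    simp only [decimationGap]
    ring
  have h5 := h3.2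
  rw [h4] at h5
  exact sub_eq_zero.1 (h5.symm.trans h2.2)

theorem hasDerivAt_scaling_cpow (s : ℂ) : HasDerivAt (fun s : ℂ => (scaling p : ℂ) ^ s)
    ((scaling p : ℂ) ^ s * Real.log (scaling p)) s := by
  have := (hasDerivAt_id s).const_cpow (c := (scaling p : ℂ)) (Or.inl hp.scaling_ne_zero)
  rw [Complex.ofReal_log hp.scaling_pos.le]
  simpa using this

theorem tendsto_sub_mul_continuedZeta {w : ℝ} (hw : w ≤ 0) (k : ℤ) :
    Tendsto (fun s => (s - basePole p k) * continuedZeta p w s) (𝓝[≠] (basePole p k))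
      (𝓝 (zetaNumerator p 0 (basePole p k) /
        (Real.pi * (p.natDegree * Real.log (scaling p))))) := by
  have h1 : (basePole p k).re < 1 := by rw [hp.basePole_re]; exact hp.rho_lt_one
  have hk := hp.scaling_cpow_eq_natDegree_iff.2 ⟨k, rfl⟩
  have hd : (p.natDegree : ℂ) ≠ 0 := by
    have := hp.two_le
    exact_mod_cast (by omega : p.natDegree ≠ 0)
  have hl : (Real.log (scaling p) : ℂ) ≠ 0 := Complex.ofReal_ne_zero.2 hp.log_scaling_pos.ne'
  have hpi : (Real.pi : ℂ) ≠ 0 := Complex.ofReal_ne_zero.2 Real.pi_ne_zero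
  have h2 := (hasDerivAt_iff_tendsto_slope.1 (hp.hasDerivAt_scaling_cpow (basePole p k)))
  rw [hk] at h2
  have h3 := (hp.analyticAt_zetaNumerator hw h1).continuousAt.tendsto.mono_left
    (nhdsWithin_le_nhds (s := {basePole p k}ᶜ))
  rw [hp.zetaNumerator_basePole hw] at h3
  refine (h3.div (h2.const_mul (Real.pi : ℂ)) (by simp [hd, hl, hpi])).congr' ?_
  have h4 := (eventuallyEq_continuedZeta (p := p) w h1).filter_mono
    (nhdsWithin_le_nhds (s := {basePole p k}ᶜ))
  filter_upwards [h4, self_mem_nhdsWithin] with s hs hne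
  have hne' : s - basePole p k ≠ 0 := sub_ne_zero.2 hne
  rw [hs]
  simp only [Pi.div_apply, slope_def_field, hk]
  field_simp

theorem continuedZeta_eq_integral {w : ℝ} (hw : w ≤ 0) {s : ℂ} (hs : s.re < 0) :
    continuedZeta p w s = s * Complex.sin (Real.pi * s) /
        (Real.pi * ((scaling p : ℂ) ^ s - (p.natDegree : ℂ))) *
      ∫ x in Set.Ioi (0 : ℝ), Complex.log (Psi p w x) * (x : ℂ) ^ (-s - 1) := by
  have hs0 : s ≠ 0 := by rintro rfl; simp at hs
  have h1 := hp.mellin_decimationTail hw hs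
  rw [(hp.hasMellin_decimationTail hw (s := 1 - s) (by simp; linarith)).2] at h1
  have h2 : zetaNumerator p w s = Complex.sin (Real.pi * s) *
      (mellin (truncatedGap p w) (1 - s) - levelShift p w / (1 - s - 1)) := by
    rw [zetaNumerator, show 1 - s - 1 = -s by ring, ← mul_dslope_sin s]
    field_simp
    ring
  rw [continuedZeta_of_lt p w (by linarith), h2, h1]
  ring

theorem integrableOn_log_Psi {w : ℝ} (hw : w ≤ 0) {s : ℂ} (hs : s.re < 0) :
    IntegrableOn (fun x : ℝ => Complex.log (Psi p w x) * (x : ℂ) ^ (-s - 1)) (Set.Ioi 0) := by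
  have h := hp.mellinConvergent_log_Psi hw (s := -s) (by simpa using hs)
  refine Integrable.congr h (Eventually.of_forall fun x => ?_)
  simp only [smul_eq_mul, mul_comm]

omit hp in
-- The zeros are those of the sine. For w = 0 the point 0 is excluded, because the `dslope` of the
-- sine equals π there.
theorem continuedZeta_neg_natCast (w : ℝ) {n : ℕ} (h : w ≠ 0 ∨ n ≠ 0) :
    continuedZeta p w (-(n : ℂ)) = 0 := by
  have hsin : Complex.sin (Real.pi * (-(n : ℂ))) = 0 := by
    rw [mul_neg, Complex.sin_neg, mul_comm, Complex.sin_nat_mul_pi, neg_zero]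
  rw [continuedZeta_of_lt p w (by
    have : (0 : ℝ) ≤ n := n.cast_nonneg
    simp only [Complex.neg_re, Complex.natCast_re]
    linarith), zetaNumerator, hsin, zero_mul, zero_add]
  rcases eq_or_ne w 0 with rfl | hw
  · have hn : -(n : ℂ) ≠ 0 := neg_ne_zero.2 (Nat.cast_ne_zero.2 (h.resolve_left (not_not.2 rfl)))
    have h1 := mul_dslope_sin (-(n : ℂ))
    rw [hsin] at h1
    rw [(mul_eq_zero.1 h1).resolve_left hn, mul_zero, zero_div]
  · rw [levelShift_of_ne hw, zero_mul, zero_div]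

theorem hasDerivAt_continuedZeta_zero {w : ℝ} (hw : w < 0) : HasDerivAt (continuedZeta p w)
    (-((Real.log p.leadingCoeff / ((p.natDegree : ℝ) - 1) + Real.log (-w) : ℝ) : ℂ)) 0 := by
  have hd : (p.natDegree : ℂ) - 1 ≠ 0 := by
    have := hp.two_le
    rw [sub_ne_zero]
    exact_mod_cast (by omega : p.natDegree ≠ 1)
  have hpi : (Real.pi : ℂ) ≠ 0 := Complex.ofReal_ne_zero.2 Real.pi_ne_zero
  have h0 : (0 : ℂ).re < 1 := by simp
  have hM : DifferentiableAt ℂ (fun s => mellin (truncatedGap p w) (1 - s)) 0 :=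
    DifferentiableAt.comp (0 : ℂ) (f := fun s : ℂ => 1 - s)
      (hp.differentiableAt_mellin_truncatedGap hw.le (by simp)) (by fun_prop)
  have hsin : HasDerivAt (fun s : ℂ => Complex.sin (Real.pi * s)) (Real.pi : ℂ) 0 := by
    have := ((hasDerivAt_id (0 : ℂ)).const_mul (Real.pi : ℂ)).csin
    simpa using this
  have hnum : HasDerivAt (zetaNumerator p w) (Real.pi * mellin (truncatedGap p w) 1) 0 := by
    have h1 : zetaNumerator p w =
        fun s => Complex.sin (Real.pi * s) * mellin (truncatedGap p w) (1 - s) := by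
      ext s
      rw [zetaNumerator, levelShift_of_ne hw.ne, zero_mul, add_zero]
    rw [h1]
    refine (hsin.mul hM.hasDerivAt).congr_deriv ?_
    simp
  have hden : HasDerivAt (fun s : ℂ => Real.pi * ((scaling p : ℂ) ^ s - p.natDegree))
      (Real.pi * Real.log (scaling p)) 0 := by
    have := ((hp.hasDerivAt_scaling_cpow 0).sub_const (p.natDegree : ℂ)).const_mul (Real.pi : ℂ)
    simpa using this
  have hden0 : (Real.pi : ℂ) * ((scaling p : ℂ) ^ (0 : ℂ) - p.natDegree) ≠ 0 := by
    rw [Complex.cpow_zero]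
    exact mul_ne_zero hpi (by rw [← neg_sub]; exact neg_ne_zero.2 hd)
  refine ((hnum.div hden hden0).congr_of_eventuallyEq
    (eventuallyEq_continuedZeta w h0)).congr_deriv ?_
  have hn0 : zetaNumerator p w 0 = 0 := by
    simp [zetaNumerator, levelShift_of_ne hw.ne]
  rw [hn0, hp.mellin_truncatedGap_one hw, Complex.cpow_zero, zero_mul, sub_zero]
  have hd2 : (1 : ℂ) - p.natDegree ≠ 0 := by rw [← neg_sub]; exact neg_ne_zero.2 hd
  push_cast
  field_simp
  ring

end IsDecimationPolynomial

/-! ### Full support of the self-similar measure and the sign of the eigenvalues. -/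

namespace SimilitudeSystem

variable {D m : ℕ} (S : SimilitudeSystem D m)

theorem selfSimilar : S.K = ⋃ i, S.map i '' S.K := S.selfSimilar_K

theorem map_mem_K (i : Fin m) {x : EuclideanSpace ℝ (Fin D)} (hx : x ∈ S.K) : S.map i x ∈ S.K := by
  rw [S.selfSimilar]
  exact Set.mem_iUnion.2 ⟨i, x, hx, rfl⟩

theorem wordMap_succ (ε : ℕ → Fin m) (n : ℕ) (x : EuclideanSpace ℝ (Fin D)) :
    S.wordMap ε (n + 1) x = S.wordMap ε n (S.map (ε n) x) := rfl

theorem wordMap_mem_K (ε : ℕ → Fin m) (n : ℕ) :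
    ∀ {x : EuclideanSpace ℝ (Fin D)}, x ∈ S.K → S.wordMap ε n x ∈ S.K := by
  induction n with
  | zero => exact fun hx => hx
  | succ n ih => exact fun hx => ih (S.map_mem_K (ε n) hx)

theorem dist_map (i : Fin m) (x y : EuclideanSpace ℝ (Fin D)) :
    dist (S.map i x) (S.map i y) = S.ratio i * dist x y := by
  rw [dist_eq_norm, dist_eq_norm, map, map, add_sub_add_left_eq_sub, ← map_sub, S.norm_A,
    sub_sub_sub_cancel_right]

theorem exists_contraction_bound : ∃ q : ℝ, 0 ≤ q ∧ q < 1 ∧ ∀ i, S.ratio i ≤ q := by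
  rcases isEmpty_or_nonempty (Fin m) with h | h
  · exact ⟨0, le_rfl, one_pos, fun i => isEmptyElim i⟩
  · obtain ⟨j, hj⟩ := Finite.exists_max S.ratio
    exact ⟨S.ratio j, (S.ratio_pos j).le, S.ratio_lt_one j, hj⟩

theorem dist_wordMap_le {q : ℝ} (h0 : 0 ≤ q) (hq : ∀ i, S.ratio i ≤ q) (ε : ℕ → Fin m) (n : ℕ) :
    ∀ x y : EuclideanSpace ℝ (Fin D),
      dist (S.wordMap ε n x) (S.wordMap ε n y) ≤ q ^ n * dist x y := by
  induction n with
  | zero => exact fun x y => by simp [wordMap]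
  | succ n ih =>
    intro x y
    rw [wordMap_succ, wordMap_succ]
    calc _ ≤ q ^ n * dist (S.map (ε n) x) (S.map (ε n) y) := ih _ _
      _ ≤ q ^ n * (q * dist x y) := by
          rw [S.dist_map]
          gcongr
          exact hq _
      _ = q ^ (n + 1) * dist x y := by ring

theorem exists_dist_wordMap_succ_le : ∃ q M : ℝ, 0 ≤ q ∧ q < 1 ∧ 0 ≤ M ∧
    (∀ i, S.ratio i ≤ q) ∧ ∀ (ε : ℕ → Fin m) (n : ℕ),
      dist (S.wordMap ε n 0) (S.wordMap ε (n + 1) 0) ≤ M * q ^ n := by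
  obtain ⟨q, h0, h1, hq⟩ := S.exists_contraction_bound
  refine ⟨q, ∑ i, dist 0 (S.map i 0), h0, h1, Finset.sum_nonneg fun _ _ => dist_nonneg, hq,
    fun ε n => ?_⟩
  rw [wordMap_succ]
  refine (S.dist_wordMap_le h0 hq ε n _ _).trans ?_
  rw [mul_comm]
  gcongr
  exact Finset.single_le_sum (f := fun i => dist 0 (S.map i 0)) (fun _ _ => dist_nonneg)
    (Finset.mem_univ (ε n))

theorem tendsto_wordMap_zero (ε : ℕ → Fin m) :
    Tendsto (fun n => S.wordMap ε n 0) atTop (𝓝 (S.address ε)) := by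
  obtain ⟨q, M, _, h1, _, _, h⟩ := S.exists_dist_wordMap_succ_le
  exact (cauchySeq_of_le_geometric q M h1 (h ε)).tendsto_limUnder

/-- The starting point may change with n as long as it stays in the bounded set K, since the word
maps contract geometrically. -/
theorem tendsto_wordMap (ε : ℕ → Fin m) {x : ℕ → EuclideanSpace ℝ (Fin D)}
    (hx : ∀ n, x n ∈ S.K) : Tendsto (fun n => S.wordMap ε n (x n)) atTop (𝓝 (S.address ε)) := by
  obtain ⟨q, h0, h1, hq⟩ := S.exists_contraction_bound
  obtain ⟨R, hR⟩ := S.isCompact_K.isBounded.subset_closedBall 0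
  refine (S.tendsto_wordMap_zero ε).congr_dist ?_
  refine squeeze_zero (fun _ => dist_nonneg) (fun n => ?_)
    (by simpa using (tendsto_pow_atTop_nhds_zero_of_lt_one h0 h1).mul_const R)
  refine (S.dist_wordMap_le h0 hq ε n _ _).trans ?_
  gcongr
  rw [dist_comm]
  exact hR (hx n)

theorem address_mem_K (ε : ℕ → Fin m) : S.address ε ∈ S.K := by
  obtain ⟨y, hy⟩ := S.nonempty_K
  exact S.isCompact_K.isClosed.mem_of_tendsto (S.tendsto_wordMap ε fun _ => hy)
    (Eventually.of_forall fun n => S.wordMap_mem_K ε n hy)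

/-- Self-similarity assigns to each point of K a first letter and a preimage in K. Iterating the
choice spells out an address. -/
theorem exists_address_eq {x : EuclideanSpace ℝ (Fin D)} (hx : x ∈ S.K) :
    ∃ ε, S.address ε = x := by
  have h : ∀ y : S.K, ∃ iz : Fin m × S.K, S.map iz.1 iz.2 = y := by
    intro y
    obtain ⟨i, z, hz, h⟩ := Set.mem_iUnion.1 (S.selfSimilar.subset y.2)
    exact ⟨(i, ⟨z, hz⟩), h⟩
  choose f hf using h
  set z : ℕ → S.K := fun n => (fun y => (f y).2)^[n] ⟨x, hx⟩
  set ε : ℕ → Fin m := fun n => (f (z n)).1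
  have hz : ∀ n, S.map (ε n) (z (n + 1)) = z n := fun n => by
    have : z (n + 1) = (f (z n)).2 := Function.iterate_succ_apply' _ _ _
    rw [this]
    exact hf (z n)
  have hw : ∀ n, S.wordMap ε n (z n) = x := by
    intro n
    induction n with
    | zero => rfl
    | succ n ih => rw [wordMap_succ, hz, ih]
  refine ⟨ε, tendsto_nhds_unique (S.tendsto_wordMap ε fun n => (z n).2) ?_⟩
  simp only [hw]
  exact tendsto_const_nhds

theorem wordMap_congr {ε δ : ℕ → Fin m} {n : ℕ} (h : ∀ k < n, ε k = δ k) :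
    S.wordMap ε n = S.wordMap δ n := by
  induction n with
  | zero => rfl
  | succ n ih => rw [wordMap, wordMap, ih fun k hk => h k (hk.trans n.lt_succ_self),
      h n n.lt_succ_self]

theorem exists_forall_dist_address_lt {η : ℝ} (hη : 0 < η) : ∃ n : ℕ, ∀ ε δ : ℕ → Fin m,
    (∀ k < n, ε k = δ k) → dist (S.address ε) (S.address δ) < η := by
  obtain ⟨q, M, h0, h1, hM, _, h⟩ := S.exists_dist_wordMap_succ_le
  have hlim : Tendsto (fun n : ℕ => M * q ^ n / (1 - q) + M * q ^ n / (1 - q)) atTop (𝓝 0) := by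
    have := ((tendsto_pow_atTop_nhds_zero_of_lt_one h0 h1).const_mul M).div_const (1 - q)
    simpa using this.add this
  obtain ⟨n, hn⟩ := (hlim.eventually (gt_mem_nhds hη)).exists
  refine ⟨n, fun ε δ hεδ => lt_of_le_of_lt ?_ hn⟩
  have e1 := dist_le_of_le_geometric_of_tendsto q M h1 (h ε) (S.tendsto_wordMap_zero ε) n
  have e2 := dist_le_of_le_geometric_of_tendsto q M h1 (h δ) (S.tendsto_wordMap_zero δ) n
  rw [S.wordMap_congr hεδ] at e1
  rw [dist_comm] at e1
  exact (dist_triangle _ _ _).trans (add_le_add e1 e2)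

theorem continuous_address : Continuous S.address := by
  rw [continuous_iff_continuousAt]
  intro ε
  rw [ContinuousAt, Metric.tendsto_nhds]
  intro η hη
  obtain ⟨n, hn⟩ := S.exists_forall_dist_address_lt hη
  have h : ∀ᶠ δ : ℕ → Fin m in 𝓝 ε, ∀ k ∈ Finset.range n, δ k = ε k := by
    rw [Filter.eventually_all_finset]
    intro k _
    have h1 : Tendsto (fun δ : ℕ → Fin m => δ k) (𝓝 ε) (𝓝 (ε k)) :=
      (continuous_apply k).tendsto ε
    exact h1.eventually ((isOpen_discrete {ε k}).mem_nhds rfl)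
  filter_upwards [h] with δ hδ
  exact hn δ ε fun k hk => hδ k (Finset.mem_range.2 hk)

theorem measurable_address : Measurable S.address := S.continuous_address.measurable

theorem weights_cylinder_pos (ε : ℕ → Fin m) (n : ℕ) :
    0 < (Measure.infinitePi fun _ : ℕ => S.weights.toMeasure) {δ | ∀ k ∈ Finset.range n, δ k = ε k} := by
  have h := Measure.infinitePi_pi (μ := fun _ : ℕ => S.weights.toMeasure) (s := Finset.range n)
    (t := fun k => {ε k}) (fun k _ => measurableSet_singleton _)
  have h2 : {δ : ℕ → Fin m | ∀ k ∈ Finset.range n, δ k = ε k} =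
      Set.pi (Finset.range n : Set ℕ) fun k => {ε k} := by
    ext δ
    simp [Set.mem_pi]
  rw [h2, h, CanonicallyOrderedAdd.prod_pos]
  intro k _
  rw [PMF.toMeasure_apply_singleton _ _ (measurableSet_singleton _)]
  exact ENNReal.ofReal_pos.2 (Real.rpow_pos_of_pos (S.ratio_pos _) _)

/-- By continuity of the address map, the preimage of a non-empty open set contains a cylinder, and
cylinders have positive mass because all weights are positive. This excludes non-zero continuous
eigenfunctions that vanish almost everywhere. -/
theorem measureK_pos {U : Set S.K} (hU : IsOpen U) (hne : U.Nonempty) : 0 < S.measureK U := by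
  obtain ⟨V, hV, rfl⟩ := isOpen_induced_iff.1 hU
  obtain ⟨x, hx⟩ := hne
  have hKm : MeasurableSet S.K := S.isCompact_K.isClosed.measurableSet
  rw [measureK, (MeasurableEmbedding.subtype_coe hKm).comap_apply, Subtype.image_preimage_coe,
    Measure.map_apply S.measurable_address (hKm.inter hV.measurableSet)]
  obtain ⟨ε, hε⟩ := S.exists_address_eq x.2
  have hxV : S.address ε ∈ V := by rw [hε]; exact hx
  obtain ⟨η, hη, hball⟩ := Metric.isOpen_iff.1 hV _ hxV
  obtain ⟨n, hn⟩ := S.exists_forall_dist_address_lt hη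
  refine (S.weights_cylinder_pos ε n).trans_le (measure_mono fun δ hδ => ?_)
  exact ⟨S.address_mem_K δ, hball (hn δ ε fun k hk => hδ k (Finset.mem_range.2 hk))⟩

end SimilitudeSystem

theorem energyStep_nonneg {D m : ℕ} (S : SimilitudeSystem D m)
    {E₀ : LinearMap.BilinForm ℝ (S.V₀ → ℝ)} (hE : ∀ u, 0 ≤ E₀ u u) {r : Fin m → ℝ}
    (hr : ∀ i, 0 < r i) {κ : ℝ} (hκ : 0 < κ) (n : ℕ) :
    ∀ u : EuclideanSpace ℝ (Fin D) → ℝ, 0 ≤ energyStep S E₀ r κ n u u := by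
  induction n with
  | zero => exact fun u => hE _
  | succ n ih =>
    exact fun u => mul_nonneg hκ.le (Finset.sum_nonneg fun i _ =>
      mul_nonneg (inv_nonneg.2 (hr i).le) (ih _))

namespace HarmonicStructure

variable {D m : ℕ} {F : PcfFractal D m} (H : HarmonicStructure F)

/-- The eigenvalues of the Laplacian are not positive. -/
theorem nonpos_of_isLaplacian {B : Set (EuclideanSpace ℝ (Fin D))} {u : C(F.K, ℝ)} {c : ℝ}
    (hu : H.IsLaplacian B u fun x => c * u x) (hu0 : u ≠ 0) : c ≤ 0 := by
  by_contra! hc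
  obtain ⟨hdom, hL2, hlim⟩ := hu
  -- Testing the weak equation with u itself: non-negative energy forces the integral of c u² to be
  -- at most 0, so u vanishes almost everywhere if c > 0.
  have h1 : 0 ≤ -∫ x, c * u x * u x ∂F.measureK :=
    ge_of_tendsto' (hlim u hdom) fun n =>
      energyStep_nonneg _ H.isDirichletForm.nonneg H.r_pos H.κ_pos n _
  have hint : Integrable (fun x => c * u x * u x) F.measureK := by
    have h2 := (hL2.integrable_sq).const_mul c⁻¹
    refine h2.congr (Eventually.of_forall fun x => ?_)
    field_simp
  have hnn : 0 ≤ fun x => c * u x * u x := fun x => by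
    have := mul_self_nonneg (u x)
    simp only [Pi.zero_apply, mul_assoc]
    positivity
  have h3 : ∫ x, c * u x * u x ∂F.measureK = 0 :=
    le_antisymm (by linarith) (integral_nonneg hnn)
  rw [integral_eq_zero_iff_of_nonneg hnn hint] at h3
  have hopen : IsOpen {x : F.K | u x ≠ 0} := isOpen_ne_fun u.continuous continuous_const
  have hne : {x : F.K | u x ≠ 0}.Nonempty := by
    by_contra! h
    refine hu0 (ContinuousMap.ext fun x => ?_)
    by_contra hx
    exact Set.notMem_empty x (h ▸ hx)
  refine (F.measureK_pos hopen hne).ne' (measure_mono_null (fun x hx => ?_) (ae_iff.1 h3))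
  have hx' : u x ≠ 0 := hx
  change ¬ (c * u x * u x = 0)
  simp [hc.ne', hx']

theorem eigenMult_ne_zero {B : Set (EuclideanSpace ℝ (Fin D))} {z : ℂ} (h : H.eigenMult B z ≠ 0) :
    z.im = 0 ∧ z.re ≤ 0 := by
  rw [eigenMult] at h
  split_ifs at h with him
  · refine ⟨him, ?_⟩
    by_contra! hre
    apply h
    have hbot : H.eigenspace B z.re = ⊥ := by
      rw [eigenspace, Submodule.span_eq_bot]
      intro u hu
      by_contra hu0
      exact absurd (H.nonpos_of_isLaplacian hu hu0) (not_le.2 hre)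
    rw [hbot, rank_bot, map_zero]
  · exact absurd rfl h

end HarmonicStructure

/-! ### Power series of rational functions -/

/-- The recursion ‖c‖ a_{n+1} ≤ r a_n + g_{n+1} for a_n = ‖f_n‖ r^n, summed over n, bounds ‖c‖ - r
times the partial sums of a. -/
theorem summable_norm_coeff_of_mul_X_sub_C {f : PowerSeries ℂ} {c : ℂ} {r : ℝ} (hr : 0 ≤ r)
    (hc : r < ‖c‖)
    (h : Summable fun n => ‖PowerSeries.coeff n (f * ((X - C c : ℂ[X]) : PowerSeries ℂ))‖ * r ^ n) :
    Summable fun n => ‖PowerSeries.coeff n f‖ * r ^ n := by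
  have hc0 : 0 < ‖c‖ := hr.trans_lt hc
  set g : ℕ → ℝ := fun n => ‖PowerSeries.coeff n (f * ((X - C c : ℂ[X]) : PowerSeries ℂ))‖ * r ^ n
  set a : ℕ → ℝ := fun n => ‖PowerSeries.coeff n f‖ * r ^ n
  have hg0 : ∀ n, 0 ≤ g n := fun n => by positivity
  have ha0 : ∀ n, 0 ≤ a n := fun n => by positivity
  have hrec : ∀ n, ‖c‖ * a (n + 1) ≤ r * a n + g (n + 1) := by
    intro n
    have h1 : PowerSeries.coeff (n + 1) (f * ((X - C c : ℂ[X]) : PowerSeries ℂ)) =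
        PowerSeries.coeff n f - PowerSeries.coeff (n + 1) f * c := by
      rw [Polynomial.coe_sub, Polynomial.coe_X, Polynomial.coe_C, mul_sub, map_sub,
        PowerSeries.coeff_succ_mul_X, PowerSeries.coeff_mul_C]
    have h2 : PowerSeries.coeff (n + 1) f * c = PowerSeries.coeff n f -
        PowerSeries.coeff (n + 1) (f * ((X - C c : ℂ[X]) : PowerSeries ℂ)) := by
      rw [h1]; ring
    have h3 := norm_sub_le (PowerSeries.coeff n f)
      (PowerSeries.coeff (n + 1) (f * ((X - C c : ℂ[X]) : PowerSeries ℂ)))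
    rw [← h2, norm_mul] at h3
    calc ‖c‖ * a (n + 1) = (‖PowerSeries.coeff (n + 1) f‖ * ‖c‖) * r ^ (n + 1) := by
          simp only [a]; ring
      _ ≤ _ := mul_le_mul_of_nonneg_right h3 (by positivity)
      _ = r * a n + g (n + 1) := by simp only [a, g]; ring
  refine summable_of_sum_range_le (c := (‖c‖ * a 0 + ∑' n, g n) / (‖c‖ - r)) ha0 fun n => ?_
  rw [le_div_iff₀ (by linarith)]
  have key : ∀ n, ‖c‖ * ∑ i ∈ Finset.range (n + 1), a i ≤
      ‖c‖ * a 0 + r * ∑ i ∈ Finset.range n, a i + ∑ i ∈ Finset.range n, g (i + 1) := by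
    intro n
    induction n with
    | zero => simp
    | succ n ih =>
      rw [Finset.sum_range_succ, mul_add, Finset.sum_range_succ _ n, Finset.sum_range_succ _ n]
      have := hrec n
      rw [Finset.sum_range_succ] at ih
      linarith
  have h1 : ∑ i ∈ Finset.range n, g (i + 1) ≤ ∑' n, g n := by
    have h2 := h.sum_le_tsum (Finset.range (n + 1)) fun i _ => hg0 i
    rw [Finset.sum_range_succ'] at h2
    linarith [hg0 0]
  have h3 : ∑ i ∈ Finset.range n, a i ≤ ∑ i ∈ Finset.range (n + 1), a i := by
    rw [Finset.sum_range_succ]; linarith [ha0 n]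
  have h4 := key n
  nlinarith

/-- The linear factors of the denominator are peeled off one root at a time. -/
theorem summable_norm_coeff_of_mul {D : ℂ[X]} (hD : D ≠ 0) {f : PowerSeries ℂ} {r : ℝ} (hr : 0 ≤ r)
    (hroot : ∀ c, D.eval c = 0 → r < ‖c‖)
    (h : Summable fun n => ‖PowerSeries.coeff n (f * (D : PowerSeries ℂ))‖ * r ^ n) :
    Summable fun n => ‖PowerSeries.coeff n f‖ * r ^ n := by
  induction hn : D.natDegree using Nat.strong_induction_on generalizing D with
  | _ n ih =>
    by_cases h0 : D.degree = 0
    · rw [eq_C_of_degree_eq_zero h0] at h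
      have hc : D.coeff 0 ≠ 0 := fun hc => hD (by rw [eq_C_of_degree_eq_zero h0, hc, C_0])
      have h1 := h.mul_left ‖D.coeff 0‖⁻¹
      refine h1.congr fun k => ?_
      rw [Polynomial.coe_C, PowerSeries.coeff_mul_C, norm_mul]
      have := norm_ne_zero_iff.2 hc
      field_simp
    · obtain ⟨c, hc⟩ := IsAlgClosed.exists_root D h0
      obtain ⟨E, hE⟩ := dvd_iff_isRoot.2 hc
      have hE0 : E ≠ 0 := by rintro rfl; exact hD (by rw [hE, mul_zero])
      have hdeg : D.natDegree = E.natDegree + 1 := by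
        rw [hE, natDegree_mul (X_sub_C_ne_zero c) hE0, natDegree_X_sub_C, add_comm]
      have h2 : f * (D : PowerSeries ℂ) =
          (f * (E : PowerSeries ℂ)) * ((X - C c : ℂ[X]) : PowerSeries ℂ) := by
        rw [hE, Polynomial.coe_mul]; ring
      rw [h2] at h
      refine ih _ (by omega) hE0 (fun b hb => hroot b ?_)
        (summable_norm_coeff_of_mul_X_sub_C hr (hroot c hc) h) rfl
      rw [hE, eval_mul, hb, mul_zero]

theorem hasSum_coeff_mul_pow (P : ℂ[X]) (z : ℂ) : HasSum (fun n => P.coeff n * z ^ n) (P.eval z) := by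
  rw [eval_eq_sum_range]
  refine hasSum_sum_of_ne_finset_zero fun n hn => ?_
  rw [coeff_eq_zero_of_natDegree_lt (by simpa using hn), zero_mul]

theorem summable_norm_polynomial_coeff (P : ℂ[X]) (r : ℝ) :
    Summable fun n => ‖P.coeff n‖ * r ^ n := by
  refine summable_of_ne_finset_zero (s := Finset.range (P.natDegree + 1)) fun n hn => ?_
  rw [coeff_eq_zero_of_natDegree_lt (by simpa using hn), norm_zero, zero_mul]

/-- The expansion of a rational function inside the disc bounded by its first pole. -/
theorem hasSum_ratFunc {f : PowerSeries ℂ} {Q : RatFunc ℂ}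
    (h : f * (Q.denom : PowerSeries ℂ) = (Q.num : PowerSeries ℂ)) {z : ℂ}
    (hz : ∀ c, Q.denom.eval c = 0 → ‖z‖ < ‖c‖) :
    (Summable fun n => ‖PowerSeries.coeff n f * z ^ n‖) ∧
      ∑' n, PowerSeries.coeff n f * z ^ n = Q.eval (RingHom.id ℂ) z := by
  have h1 : Summable fun n => ‖PowerSeries.coeff n f‖ * ‖z‖ ^ n := by
    refine summable_norm_coeff_of_mul Q.denom_ne_zero (norm_nonneg z) hz ?_
    rw [h]
    simpa only [Polynomial.coeff_coe] using summable_norm_polynomial_coeff Q.num ‖z‖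
  have h2 : Summable fun n => ‖PowerSeries.coeff n f * z ^ n‖ := by
    simpa only [norm_mul, norm_pow] using h1
  refine ⟨h2, ?_⟩
  have h3 : Summable fun n => ‖Q.denom.coeff n * z ^ n‖ := by
    simpa only [norm_mul, norm_pow] using summable_norm_polynomial_coeff Q.denom ‖z‖
  have h4 := tsum_mul_tsum_eq_tsum_sum_antidiagonal_of_summable_norm h2 h3
  have h5 : ∀ n, ∑ kl ∈ Finset.HasAntidiagonal.antidiagonal n,
      PowerSeries.coeff kl.1 f * z ^ kl.1 * (Q.denom.coeff kl.2 * z ^ kl.2) =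
        Q.num.coeff n * z ^ n := by
    intro n
    have h6 := congrArg (PowerSeries.coeff n) h
    rw [PowerSeries.coeff_mul, Polynomial.coeff_coe] at h6
    rw [← h6, Finset.sum_mul]
    refine Finset.sum_congr rfl fun kl hkl => ?_
    rw [← Finset.HasAntidiagonal.mem_antidiagonal.1 hkl, pow_add, Polynomial.coeff_coe]
    ring
  simp_rw [h5] at h4
  rw [(hasSum_coeff_mul_pow Q.denom z).tsum_eq, (hasSum_coeff_mul_pow Q.num z).tsum_eq] at h4
  have h7 : Q.denom.eval z ≠ 0 := fun h0 => lt_irrefl _ (hz z h0)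
  rw [RatFunc.eval, eval₂_id, eval₂_id, eq_div_iff h7, h4]

theorem ofReal_pow_cpow {x : ℝ} (hx : 0 ≤ x) (m : ℕ) (s : ℂ) :
    ((x : ℂ) ^ m) ^ s = ((x : ℂ) ^ s) ^ m := by
  induction m with
  | zero => simp
  | succ m ih =>
    rw [pow_succ, ← Complex.ofReal_pow, Complex.mul_cpow_ofReal_nonneg (pow_nonneg hx m) hx,
      Complex.ofReal_pow, ih, pow_succ]

/-! ### Summation over the spectrum. -/

namespace IsDecimationPolynomial

variable {p : ℝ[X]} (hp : IsDecimationPolynomial p)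
include hp

/-- Without zeros the level function would be constant, its order being below one; Φ grows too fast
on the positive axis for that. -/
theorem exists_levelFun_eq_zero (w : ℂ) : ∃ z, levelFun p w z = 0 := by
  by_contra! h
  have hc := (hp.isEntireOfOrder_levelFun w).eq_const_of_forall_ne_zero h
  obtain ⟨x, hx, hx1⟩ := ((hp.eventually_pow_le_poincareReal 2).and (eventually_gt_atTop 1)).exists
  have hx0 : 0 < x := by linarith
  have h1 := hc x
  rcases eq_or_ne w 0 with rfl | hw
  · have h2 := hp.mul_levelFun_zero x
    rw [h1, levelFun_zero, dslope_same, hp.deriv_poincare_zero, mul_one, hp.poincare_ofReal,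
      Complex.ofReal_inj] at h2
    nlinarith
  · rw [levelFun_of_ne hw] at h1
    simp only [hp.poincare_zero, zero_sub, hp.poincare_ofReal] at h1
    have h2 : (poincareReal p x : ℂ) = 0 := by linear_combination h1
    rw [Complex.ofReal_eq_zero] at h2
    nlinarith

theorem exists_poincareReal_eq {y : ℝ} (hy : 0 < y) : ∃ x, 0 < x ∧ poincareReal p x = y := by
  have hcont : Continuous (poincareReal p) :=
    Complex.continuous_re.comp (hp.differentiable_poincare.continuous.comp Complex.continuous_ofReal)
  have h1 : y ∈ Set.Icc (poincareReal p 0) (poincareReal p y) := by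
    rw [hp.poincareReal_zero]
    exact ⟨hy.le, hp.le_poincareReal hy.le⟩
  obtain ⟨x, hx, hxy⟩ := intermediate_value_Icc hy.le hcont.continuousOn h1
  refine ⟨x, lt_of_le_of_ne hx.1 fun h => ?_, hxy⟩
  rw [← h, hp.poincareReal_zero] at hxy
  linarith

/-- The points x/λ^m tend to 0, where no level function vanishes. Only finitely many m thus
contribute to the multiplicity of a given eigenvalue. -/
theorem exists_forall_zeroMult_eq_zero (A : Finset ℂ) (x : ℂ) : ∃ N : ℕ, ∀ w ∈ A, ∀ m ≥ N,
    zeroMult (levelFun p w) (x / (scaling p : ℂ) ^ m) = 0 := by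
  have h1 : Tendsto (fun m : ℕ => -(x / (scaling p : ℂ) ^ m)) atTop (𝓝 0) := by
    have h2 : ‖((scaling p : ℂ))⁻¹‖ < 1 := by
      rw [norm_inv, Complex.norm_real, Real.norm_of_nonneg hp.scaling_pos.le]
      exact inv_lt_one_of_one_lt₀ hp.one_lt_scaling
    have h3 := ((tendsto_pow_atTop_nhds_zero_of_norm_lt_one h2).const_mul x).neg
    simpa [div_eq_mul_inv] using h3
  have h2 : ∀ᶠ m in atTop, ∀ w ∈ A,
      zeroMult (levelFun p w) (x / (scaling p : ℂ) ^ m) = 0 := by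
    rw [Filter.eventually_all_finset]
    intro w _
    have h3 := ((hp.differentiable_levelFun w).continuous.tendsto 0).comp h1
    filter_upwards [h3.eventually_ne (hp.levelFun_apply_zero w)] with m hm
    exact (hp.isEntireOfOrder_levelFun w).zeroMult_eq_zero_iff.2 hm
  obtain ⟨N, hN⟩ := eventually_atTop.1 h2
  exact ⟨N, fun w hw m hm => hN m hm w hw⟩

end IsDecimationPolynomial

namespace HasSpectralDecimation

variable {mult : ℂ → ℕ∞} {p : ℝ[X]} {A : Finset ℂ} {β : ℂ → ℕ → ℕ} {R : ℂ → RatFunc ℂ}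
  (hp : IsDecimationPolynomial p) (h : HasSpectralDecimation mult p A β R)
include hp h

theorem mult_neg_eq {x : ℂ} (hx : x ≠ 0) {N : ℕ} (hN : ∀ w ∈ A, ∀ m ≥ N,
    zeroMult (levelFun p w) (x / (scaling p : ℂ) ^ m) = 0) :
    mult (-x) = ((∑ w ∈ A, ∑ m ∈ Finset.range N,
      β w m * zeroMult (levelFun p w) (x / (scaling p : ℂ) ^ m) : ℕ) : ℕ∞) := by
  rw [h.multiplicity _ (neg_ne_zero.2 hx), Nat.cast_sum]
  refine Finset.sum_congr rfl fun w hw => ?_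
  have h1 : ∀ m, levelMult p w (-x / (scaling p : ℂ) ^ m) =
      (zeroMult (levelFun p w) (x / (scaling p : ℂ) ^ m) : ℕ∞) := fun m => by
    rw [neg_div, hp.levelMult_eq (div_ne_zero hx (pow_ne_zero _ hp.scaling_ne_zero))]
  simp_rw [h1]
  rw [tsum_eq_sum (s := Finset.range N)]
  · push_cast
    rfl
  · intro m hm
    rw [hN w hw m (by simpa using hm), Nat.cast_zero, mul_zero]

/-- All contributions are non-negative, so one non-zero term makes an eigenvalue. The sign of the
spectrum is thereby transmitted to the zeros of the level functions. -/
theorem mult_ne_zero {w μ : ℂ} {k : ℕ} (hw : w ∈ A) (hk : β w k ≠ 0)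
    (hμ : zeroMult (levelFun p w) μ ≠ 0) : mult (-((scaling p : ℂ) ^ k * μ)) ≠ 0 := by
  have hl : (scaling p : ℂ) ^ k ≠ 0 := pow_ne_zero _ hp.scaling_ne_zero
  have hμ0 := (hp.zeroMult_levelFun_neg_ne_zero hμ).1
  obtain ⟨N, hN⟩ := hp.exists_forall_zeroMult_eq_zero A ((scaling p : ℂ) ^ k * μ)
  rw [mult_neg_eq hp h (mul_ne_zero hl hμ0) hN]
  have hkN : k < N := by
    by_contra! hkN
    refine hμ ?_
    have := hN w hw k hkN
    rwa [mul_div_cancel_left₀ _ hl] at this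
  intro h0
  rw [Nat.cast_eq_zero, Finset.sum_eq_zero_iff] at h0
  have h1 := h0 w hw
  rw [Finset.sum_eq_zero_iff] at h1
  have h2 := h1 k (Finset.mem_range.2 hkN)
  rw [mul_div_cancel_left₀ _ hl, mul_eq_zero] at h2
  exact h2.elim hk hμ

variable (hmult : ∀ z, mult z ≠ 0 → z.im = 0 ∧ z.re ≤ 0)
include hmult

/-- The zeros of `levelFun p w` are negative if `w` contributes to the spectrum. -/
theorem exists_pos_of_zeroMult_ne_zero {w μ : ℂ} (hw : w ∈ A) (hk : ∃ k, β w k ≠ 0)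
    (hμ : zeroMult (levelFun p w) μ ≠ 0) : ∃ x : ℝ, 0 < x ∧ μ = x := by
  obtain ⟨k, hk⟩ := hk
  obtain ⟨h1, h2⟩ := hmult _ (mult_ne_zero hp h hw hk hμ)
  have hl : 0 < scaling p ^ k := pow_pos hp.scaling_pos k
  have hμ0 := (hp.zeroMult_levelFun_neg_ne_zero hμ).1
  rw [← Complex.ofReal_pow, Complex.neg_im, Complex.im_ofReal_mul] at h1
  rw [← Complex.ofReal_pow, Complex.neg_re, Complex.re_ofReal_mul] at h2
  have h3 : μ.im = 0 := by
    have : scaling p ^ k * μ.im = 0 := by linarith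
    exact (mul_eq_zero.1 this).resolve_left hl.ne'
  have h4 : 0 ≤ μ.re := by
    by_contra! hneg
    nlinarith
  have h5 : μ = (μ.re : ℂ) := Complex.ext rfl h3
  refine ⟨μ.re, lt_of_le_of_ne h4 fun h0 => hμ0 ?_, h5⟩
  rw [h5, ← h0, Complex.ofReal_zero]

/-- The level function has a zero, which is negative because it yields an eigenvalue, so w is a real
value of Φ. If w were positive, Φ would take it on the positive axis too, and this would give a
positive eigenvalue. -/
theorem nonpos_of_relevant {w : ℂ} (hw : w ∈ A) (hk : ∃ k, β w k ≠ 0) : w.im = 0 ∧ w.re ≤ 0 := by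
  obtain ⟨z, hz⟩ := hp.exists_levelFun_eq_zero w
  have hF := hp.isEntireOfOrder_levelFun w
  have hμ : ∀ z, levelFun p w z = 0 → zeroMult (levelFun p w) (-z) ≠ 0 := fun z hz h0 =>
    hF.zeroMult_eq_zero_iff.1 h0 (by rwa [neg_neg])
  obtain ⟨x, hx, hzx⟩ := exists_pos_of_zeroMult_ne_zero hp h hmult hw hk (hμ z hz)
  have hz' : z = ((-x : ℝ) : ℂ) := by rw [Complex.ofReal_neg, ← hzx, neg_neg]
  have hwz := (hp.levelFun_eq_zero_iff.1 hz).2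
  rw [hz', hp.poincare_ofReal] at hwz
  have him : w.im = 0 := by rw [← hwz, Complex.ofReal_im]
  refine ⟨him, ?_⟩
  by_contra! hpos
  obtain ⟨y, hy, hyw⟩ := hp.exists_poincareReal_eq hpos
  have hy0 : levelFun p w y = 0 := by
    refine hp.levelFun_eq_zero_iff.2 ⟨Complex.ofReal_ne_zero.2 hy.ne', ?_⟩
    rw [hp.poincare_ofReal, hyw]
    exact Complex.ext rfl him.symm
  obtain ⟨t, ht, hyt⟩ := exists_pos_of_zeroMult_ne_zero hp h hmult hw hk (hμ y hy0)
  rw [← Complex.ofReal_neg, Complex.ofReal_inj] at hyt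
  linarith

omit hmult hp in
theorem ratFunc_eq_zero {w : ℂ} (hw : w ∈ A) (hβ : ∀ k, β w k = 0) : R w = 0 := by
  have h1 := h.generating w hw
  have h2 : (PowerSeries.mk fun m => (β w m : ℂ)) = 0 := by
    ext n
    simp [hβ]
  rw [h2, zero_mul] at h1
  rw [← RatFunc.num_eq_zero_iff]
  exact (Polynomial.coe_eq_zero_iff).1 h1.symm

/-- The contribution of `w` to the spectral zeta function. -/
theorem hasSum_level {w s : ℂ} (hw : w ∈ A) (hs : rho p < s.re)
    (hR : ∀ c : ℂ, (R w).denom.eval c = 0 → ‖(scaling p : ℂ) ^ (-s)‖ < ‖c‖) :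
    HasSum (fun x : {x : ℝ // x ≠ 0} =>
      (∑' m : ℕ, (β w m : ℂ) * zeroMult (levelFun p w) (((x : ℝ) : ℂ) / (scaling p : ℂ) ^ m)) *
        ((x : ℝ) : ℂ) ^ (-s))
      ((R w).eval (RingHom.id ℂ) ((scaling p : ℂ) ^ (-s)) * partialZeta p w s) := by
  by_cases hβ : ∀ k, β w k = 0
  · rw [ratFunc_eq_zero h hw hβ, RatFunc.eval_zero, zero_mul]
    simp only [hβ, Nat.cast_zero, zero_mul, tsum_zero]
    exact hasSum_zero
  push Not at hβ
  have hF := hp.isEntireOfOrder_levelFun w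
  have hl := hp.scaling_ne_zero
  obtain ⟨hS1, hS2⟩ := hasSum_ratFunc (h.generating w hw) hR
  simp only [PowerSeries.coeff_mk] at hS1 hS2
  have hZ := hF.summable_zeroMult_mul_cpow hs
  set a : ℕ → ℂ := fun m => (β w m : ℂ) * ((scaling p : ℂ) ^ (-s)) ^ m
  set b : ℂ → ℂ := fun μ => (zeroMult (levelFun p w) μ : ℂ) * μ ^ (-s)
  have hprod : HasSum (fun z : ℕ × ℂ => a z.1 * b z.2)
      ((R w).eval (RingHom.id ℂ) ((scaling p : ℂ) ^ (-s)) * partialZeta p w s) := by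
    have h1 := (summable_mul_of_summable_norm hS1 hZ.norm).hasSum
    rwa [← tsum_mul_tsum_of_summable_norm hS1 hZ.norm, hS2, ← hp.partialZeta_eq_tsum] at h1
  -- The product series is indexed by (m, μ), the spectrum by (x, m) with x = λ^m μ.
  set e : ℂ × ℕ ≃ ℕ × ℂ :=
    { toFun := fun z => (z.2, z.1 / (scaling p : ℂ) ^ z.2)
      invFun := fun z => ((scaling p : ℂ) ^ z.1 * z.2, z.1)
      left_inv := fun z => by
        ext
        · exact mul_div_cancel₀ _ (pow_ne_zero _ hl)
        · rfl
      right_inv := fun z => by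
        ext
        · rfl
        · exact mul_div_cancel_left₀ _ (pow_ne_zero _ hl) }
  -- Positivity of μ is essential here: it makes (λ^m μ)^(-s) = λ^(-ms) μ^(-s) hold for the
  -- principal branch.
  have hterm : ∀ x : ℂ, ∀ m : ℕ, a m * b (x / (scaling p : ℂ) ^ m) =
      (β w m : ℂ) * zeroMult (levelFun p w) (x / (scaling p : ℂ) ^ m) * x ^ (-s) := by
    intro x m
    rcases eq_or_ne (zeroMult (levelFun p w) (x / (scaling p : ℂ) ^ m)) 0 with h0 | h0
    · simp only [b, h0, Nat.cast_zero, zero_mul, mul_zero]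
    obtain ⟨t, ht, hxt⟩ := exists_pos_of_zeroMult_ne_zero hp h hmult hw hβ h0
    have hx : x = ((scaling p ^ m : ℝ) : ℂ) * (t : ℂ) := by
      rw [← hxt, Complex.ofReal_pow]
      field_simp
    have hpow : x ^ (-s) = ((scaling p : ℂ) ^ (-s)) ^ m * (t : ℂ) ^ (-s) := by
      rw [hx, Complex.mul_cpow_ofReal_nonneg (pow_nonneg hp.scaling_pos.le m) ht.le,
        Complex.ofReal_pow, ofReal_pow_cpow hp.scaling_pos.le]
    rw [hpow]
    simp only [a, b]
    rw [hxt]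
    ring
  have hswap : HasSum (fun z : ℂ × ℕ =>
      (β w z.2 : ℂ) * zeroMult (levelFun p w) (z.1 / (scaling p : ℂ) ^ z.2) * z.1 ^ (-s))
      ((R w).eval (RingHom.id ℂ) ((scaling p : ℂ) ^ (-s)) * partialZeta p w s) := by
    have h1 := e.hasSum_iff.2 hprod
    have h2 : (fun z : ℕ × ℂ => a z.1 * b z.2) ∘ e = fun z : ℂ × ℕ =>
        (β w z.2 : ℂ) * zeroMult (levelFun p w) (z.1 / (scaling p : ℂ) ^ z.2) * z.1 ^ (-s) :=
      funext fun z => hterm z.1 z.2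
    rwa [h2] at h1
  have hfib := hswap.prod_fiberwise fun x => by
    obtain ⟨N, hN⟩ := hp.exists_forall_zeroMult_eq_zero {w} x
    have h1 : Summable fun m : ℕ =>
        (β w m : ℂ) * zeroMult (levelFun p w) (x / (scaling p : ℂ) ^ m) :=
      summable_of_ne_finset_zero (s := Finset.range N) fun m hm => by
        rw [hN w (Finset.mem_singleton_self w) m (by simpa using hm), Nat.cast_zero, mul_zero]
    exact h1.hasSum.mul_right (x ^ (-s))
  have hinj : Function.Injective fun x : {x : ℝ // x ≠ 0} => ((x : ℝ) : ℂ) :=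
    Complex.ofReal_injective.comp Subtype.val_injective
  -- Passing from complex x to non-zero real x loses nothing, since every x with a non-zero term is
  -- λ^m times a positive number.
  refine (hinj.hasSum_iff fun x hx => ?_).2 hfib
  have h1 : ∀ m : ℕ, (β w m : ℂ) * zeroMult (levelFun p w) (x / (scaling p : ℂ) ^ m) = 0 := by
    intro m
    rcases eq_or_ne (zeroMult (levelFun p w) (x / (scaling p : ℂ) ^ m)) 0 with h0 | h0
    · rw [h0, Nat.cast_zero, mul_zero]
    obtain ⟨t, ht, hxt⟩ := exists_pos_of_zeroMult_ne_zero hp h hmult hw hβ h0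
    refine absurd ⟨⟨scaling p ^ m * t, (mul_pos (pow_pos hp.scaling_pos m) ht).ne'⟩, ?_⟩ hx
    simp only [Complex.ofReal_mul, Complex.ofReal_pow, ← hxt]
    field_simp
  simp only [h1, tsum_zero, zero_mul]

/-- The spectral zeta function as a combination of partial zeta functions. -/
theorem hasSum_spectrum {s : ℂ} (hs : rho p < s.re) (hR : ∀ w ∈ A, ∀ c : ℂ,
    (R w).denom.eval c = 0 → ‖(scaling p : ℂ) ^ (-s)‖ < ‖c‖) :
    HasSum (fun x : {x : ℝ // x ≠ 0} => ((mult (-((x : ℝ) : ℂ))).toNat : ℂ) * ((x : ℝ) : ℂ) ^ (-s))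
      (∑ w ∈ A, (R w).eval (RingHom.id ℂ) ((scaling p : ℂ) ^ (-s)) * partialZeta p w s) := by
  refine (hasSum_sum fun w hw => hasSum_level hp h hmult hw hs (hR w hw)).congr_fun fun x => ?_
  have hx : ((x : ℝ) : ℂ) ≠ 0 := Complex.ofReal_ne_zero.2 x.2
  obtain ⟨N, hN⟩ := hp.exists_forall_zeroMult_eq_zero A ((x : ℝ) : ℂ)
  rw [mult_neg_eq hp h hx hN, ENat.toNat_natCast, ← Finset.sum_mul]
  push_cast
  congr 1
  refine Finset.sum_congr rfl fun w hw => ?_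
  rw [tsum_eq_sum (s := Finset.range N)]
  intro m hm
  rw [hN w hw m (by simpa using hm), Nat.cast_zero, mul_zero]

end HasSpectralDecimation

/-! ### Continuation of the spectral zeta function. -/

/-- The meromorphic continuation of the partial zeta functions, for real `w`. -/
def partialZetaContinuation (p : ℝ[X]) (w s : ℂ) : ℂ := continuedZeta p w.re s

namespace IsDecimationPolynomial

variable {p : ℝ[X]} (hp : IsDecimationPolynomial p)
include hp

theorem analyticAt_scaling_cpow_neg (s : ℂ) :
    AnalyticAt ℂ (fun s : ℂ => (scaling p : ℂ) ^ (-s)) s := by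
  have h : Differentiable ℂ fun s : ℂ => (scaling p : ℂ) ^ (-s) := fun s =>
    differentiableAt_id.neg.const_cpow (Or.inl hp.scaling_ne_zero)
  exact h.analyticAt s

theorem analyticAt_eval_scaling_cpow (P : ℂ[X]) (s : ℂ) :
    AnalyticAt ℂ (fun s : ℂ => P.eval ((scaling p : ℂ) ^ (-s))) s :=
  (P.differentiable.analyticAt _).comp (hp.analyticAt_scaling_cpow_neg s)

omit hp in
theorem ratFunc_eval_eq (Q : RatFunc ℂ) (z : ℂ) :
    Q.eval (RingHom.id ℂ) z = Q.num.eval z / Q.denom.eval z := by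
  rw [RatFunc.eval, eval₂_id, eval₂_id]

theorem meromorphicAt_ratFunc (Q : RatFunc ℂ) (s : ℂ) :
    MeromorphicAt (fun s : ℂ => Q.eval (RingHom.id ℂ) ((scaling p : ℂ) ^ (-s))) s := by
  simp_rw [ratFunc_eval_eq]
  exact (hp.analyticAt_eval_scaling_cpow Q.num s).meromorphicAt.div
    (hp.analyticAt_eval_scaling_cpow Q.denom s).meromorphicAt

theorem analyticAt_ratFunc (Q : RatFunc ℂ) {s : ℂ}
    (h : Q.denom.eval ((scaling p : ℂ) ^ (-s)) ≠ 0) :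
    AnalyticAt ℂ (fun s : ℂ => Q.eval (RingHom.id ℂ) ((scaling p : ℂ) ^ (-s))) s := by
  simp_rw [ratFunc_eval_eq]
  exact (hp.analyticAt_eval_scaling_cpow Q.num s).div (hp.analyticAt_eval_scaling_cpow Q.denom s) h

/-- A vertical line covers the whole circle of radius λ^(-c), so the absence of poles on the line
yields boundedness by compactness of the circle. -/
theorem scaling_cpow_neg_surjOn {c : ℝ} {z : ℂ} (hz : ‖z‖ = scaling p ^ (-c)) :
    ∃ t : ℝ, (scaling p : ℂ) ^ (-((c : ℂ) + t * Complex.I)) = z := by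
  have hz0 : z ≠ 0 := by
    rw [← norm_pos_iff, hz]
    exact Real.rpow_pos_of_pos hp.scaling_pos _
  have h1 := (hp.scaling_cpow_neg_eq_iff hz0).2 ⟨0, rfl⟩
  set s := ratPole p z 0
  have h2 : s.re = c := by
    have h3 := congrArg norm h1
    rw [hp.norm_scaling_cpow, hz, Complex.neg_re] at h3
    have h4 := congrArg Real.log h3
    rw [Real.log_rpow hp.scaling_pos, Real.log_rpow hp.scaling_pos] at h4
    exact neg_injective (mul_right_cancel₀ hp.log_scaling_pos.ne' h4)
  refine ⟨s.im, ?_⟩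
  rw [← h2, Complex.re_add_im]
  exact h1

/-- A rational function of `λ ^ (-s)` is bounded on a vertical line without poles. -/
theorem exists_norm_ratFunc_le (Q : RatFunc ℂ) {c : ℝ}
    (h : ∀ t : ℝ, Q.denom.eval ((scaling p : ℂ) ^ (-((c : ℂ) + t * Complex.I))) ≠ 0) :
    ∃ M : ℝ, 0 ≤ M ∧ ∀ t : ℝ,
      ‖Q.eval (RingHom.id ℂ) ((scaling p : ℂ) ^ (-((c : ℂ) + t * Complex.I)))‖ ≤ M := by
  have hcont : ContinuousOn (fun z => Q.num.eval z / Q.denom.eval z)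
      (Metric.sphere (0 : ℂ) (scaling p ^ (-c))) := by
    refine Q.num.continuous.continuousOn.div Q.denom.continuous.continuousOn fun z hz => ?_
    obtain ⟨t, ht⟩ := hp.scaling_cpow_neg_surjOn (mem_sphere_zero_iff_norm.1 hz)
    rw [← ht]
    exact h t
  obtain ⟨M, hM⟩ := (isCompact_sphere (0 : ℂ) (scaling p ^ (-c))).exists_bound_of_continuousOn hcont
  refine ⟨max M 0, le_max_right _ _, fun t => ?_⟩
  rw [ratFunc_eval_eq]
  refine (hM _ ?_).trans (le_max_left _ _)
  rw [mem_sphere_zero_iff_norm, hp.norm_scaling_cpow]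
  simp

end IsDecimationPolynomial

namespace HasSpectralDecimation

variable {mult : ℂ → ℕ∞} {p : ℝ[X]} {A : Finset ℂ} {β : ℂ → ℕ → ℕ} {R : ℂ → RatFunc ℂ}
  (hp : IsDecimationPolynomial p) (h : HasSpectralDecimation mult p A β R)
  (hmult : ∀ z, mult z ≠ 0 → z.im = 0 ∧ z.re ≤ 0)
include hp h hmult

/-- This justifies that `partialZetaContinuation` sees only the real part of w: any w that is not
real and non-positive enters with coefficient R w = 0. -/
theorem eq_zero_or_relevant {w : ℂ} (hw : w ∈ A) :
    R w = 0 ∨ (∃ k, β w k ≠ 0) ∧ w.re ≤ 0 ∧ w = (w.re : ℂ) := by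
  by_cases hβ : ∃ k, β w k ≠ 0
  · obtain ⟨h1, h2⟩ := nonpos_of_relevant hp h hmult hw hβ
    exact Or.inr ⟨hβ, h2, Complex.ext rfl h1⟩
  · push Not at hβ
    exact Or.inl (ratFunc_eq_zero h hw hβ)

theorem zetaSum_eq {s : ℂ} (hs : rho p < s.re) :
    zetaSum p A R (partialZetaContinuation p) s =
      ∑ w ∈ A, (R w).eval (RingHom.id ℂ) ((scaling p : ℂ) ^ (-s)) * partialZeta p w s := by
  refine Finset.sum_congr rfl fun w hw => ?_
  rcases eq_zero_or_relevant hp h hmult hw with h0 | ⟨-, h1, h2⟩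
  · rw [h0, RatFunc.eval_zero, zero_mul, zero_mul]
  · rw [partialZetaContinuation, hp.continuedZeta_eq_partialZeta h1 hs, ← h2]

theorem meromorphic_zetaSum : Meromorphic (zetaSum p A R (partialZetaContinuation p)) := by
  intro s
  have h1 : zetaSum p A R (partialZetaContinuation p) = ∑ w ∈ A, fun s =>
      (R w).eval (RingHom.id ℂ) ((scaling p : ℂ) ^ (-s)) * partialZetaContinuation p w s := by
    ext s
    rw [zetaSum, Finset.sum_apply]
  rw [h1]
  refine MeromorphicAt.sum fun w hw => ?_
  rcases eq_zero_or_relevant hp h hmult hw with h0 | ⟨-, h1, -⟩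
  · simp only [h0, RatFunc.eval_zero, zero_mul]
    exact MeromorphicAt.const 0 s
  · exact (hp.meromorphicAt_ratFunc (R w) s).mul (hp.meromorphic_continuedZeta h1 s)

theorem analyticAt_zetaSum {s : ℂ} (hs : ∀ k : ℤ, s ≠ basePole p k)
    (hR : ∀ w ∈ A, (R w).denom.eval ((scaling p : ℂ) ^ (-s)) ≠ 0) :
    AnalyticAt ℂ (zetaSum p A R (partialZetaContinuation p)) s := by
  have h1 : zetaSum p A R (partialZetaContinuation p) = fun s => ∑ w ∈ A,
      (R w).eval (RingHom.id ℂ) ((scaling p : ℂ) ^ (-s)) * partialZetaContinuation p w s := rfl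
  rw [h1]
  refine Finset.analyticAt_fun_sum A fun w hw => ?_
  rcases eq_zero_or_relevant hp h hmult hw with h0 | ⟨-, h1, -⟩
  · simp only [h0, RatFunc.eval_zero, zero_mul]
    exact analyticAt_const
  · exact (hp.analyticAt_ratFunc (R w) (hR w hw)).mul (hp.analyticAt_continuedZeta h1 hs)

/-- At s_k one has λ^(-s) = 1/d, where every R w is regular, and the partial zeta functions have
simple poles at most. Hence (s - s_k) times the sum has a finite limit, so its order is
non-negative. -/
theorem neg_one_le_order_zetaSum (hR : ∀ w ∈ A, (R w).denom.eval ((p.natDegree : ℂ)⁻¹) ≠ 0)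
    (k : ℤ) : ((-1 : ℤ) : WithTop ℤ) ≤
      meromorphicOrderAt (zetaSum p A R (partialZetaContinuation p)) (basePole p k) := by
  set s₀ := basePole p k
  have hM := meromorphic_zetaSum hp h hmult s₀
  have hpole : (scaling p : ℂ) ^ (-s₀) = (p.natDegree : ℂ)⁻¹ := by
    rw [Complex.cpow_neg, hp.scaling_cpow_eq_natDegree_iff.2 ⟨k, rfl⟩]
  have hid : MeromorphicAt (fun s : ℂ => s - s₀) s₀ := by fun_prop
  have hlim : ∃ c, Tendsto ((fun s => s - s₀) * zetaSum p A R (partialZetaContinuation p))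
      (𝓝[≠] s₀) (𝓝 c) := by
    have h1 : ∀ w ∈ A, ∃ c, Tendsto (fun s => (s - s₀) *
        ((R w).eval (RingHom.id ℂ) ((scaling p : ℂ) ^ (-s)) * partialZetaContinuation p w s))
        (𝓝[≠] s₀) (𝓝 c) := by
      intro w hw
      rcases eq_zero_or_relevant hp h hmult hw with h0 | ⟨-, h1, -⟩
      · simp only [h0, RatFunc.eval_zero, zero_mul, mul_zero]
        exact ⟨0, tendsto_const_nhds⟩
      · have h2 := (hp.analyticAt_ratFunc (R w) (s := s₀)
          (by rw [hpole]; exact hR w hw)).continuousAt.tendsto.mono_left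
          (nhdsWithin_le_nhds (s := {s₀}ᶜ))
        refine ⟨_, (h2.mul (hp.tendsto_sub_mul_continuedZeta h1 k)).congr fun s => ?_⟩
        rw [partialZetaContinuation]
        ring
    choose! c hc using h1
    refine ⟨∑ w ∈ A, c w, (tendsto_finsetSum A hc).congr fun s => ?_⟩
    rw [Pi.mul_apply, zetaSum, Finset.mul_sum]
  have h2 := (tendsto_nhds_iff_meromorphicOrderAt_nonneg (hid.mul hM)).1 hlim
  have h3 : meromorphicOrderAt (fun s : ℂ => s - s₀) s₀ = (1 : ℤ) := by
    rw [meromorphicOrderAt_eq_int_iff hid]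
    exact ⟨fun _ => 1, analyticAt_const, one_ne_zero, Eventually.of_forall fun z => by simp⟩
  rw [meromorphicOrderAt_mul hid hM, h3] at h2
  cases hord : meromorphicOrderAt (zetaSum p A R (partialZetaContinuation p)) s₀ with
  | top => exact le_top
  | coe n =>
    rw [hord] at h2
    have h4 : (0 : ℤ) ≤ 1 + n := by exact_mod_cast h2
    exact_mod_cast (by omega : -1 ≤ n)

/-- For positive μ the modulus of μ^(-s) is μ^(-c) on the whole line, so the absolutely convergent
series at c is a bound. -/
theorem exists_norm_partialZeta_le {w : ℂ} (hw : w ∈ A) (hk : ∃ k, β w k ≠ 0) {c : ℝ}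
    (hc : rho p < c) : ∃ M : ℝ, 0 ≤ M ∧
      ∀ t : ℝ, ‖partialZeta p w ((c : ℂ) + t * Complex.I)‖ ≤ M := by
  have hF := hp.isEntireOfOrder_levelFun w
  have hsum := hF.summable_zeroMult_mul_rpow hc
  refine ⟨∑' μ : ℂ, (zeroMult (levelFun p w) μ : ℝ) * ‖μ‖ ^ (-c),
    tsum_nonneg fun _ => by positivity, fun t => ?_⟩
  rw [hp.partialZeta_eq_tsum]
  refine tsum_of_norm_bounded hsum.hasSum fun μ => ?_
  rcases eq_or_ne (zeroMult (levelFun p w) μ) 0 with h0 | h0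
  · simp [h0]
  obtain ⟨x, hx, rfl⟩ := exists_pos_of_zeroMult_ne_zero hp h hmult hw hk h0
  rw [norm_mul, Complex.norm_natCast, Complex.norm_cpow_eq_rpow_re_of_pos hx, Complex.norm_real,
    Real.norm_of_nonneg hx.le]
  simp

theorem exists_norm_zetaSum_le {c : ℝ} (hc : rho p < c) (hR : ∀ w ∈ A, ∀ t : ℝ,
    (R w).denom.eval ((scaling p : ℂ) ^ (-((c : ℂ) + t * Complex.I))) ≠ 0) :
    ∃ M : ℝ, ∀ t : ℝ,
      ‖zetaSum p A R (partialZetaContinuation p) ((c : ℂ) + t * Complex.I)‖ ≤ M := by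
  have h1 : ∀ w ∈ A, ∃ M : ℝ, ∀ t : ℝ,
      ‖(R w).eval (RingHom.id ℂ) ((scaling p : ℂ) ^ (-((c : ℂ) + t * Complex.I))) *
        partialZeta p w ((c : ℂ) + t * Complex.I)‖ ≤ M := by
    intro w hw
    rcases eq_zero_or_relevant hp h hmult hw with h0 | ⟨hk, -, -⟩
    · refine ⟨0, fun t => ?_⟩
      rw [h0, RatFunc.eval_zero, zero_mul, norm_zero]
    · obtain ⟨M₁, hM₁, hb₁⟩ := hp.exists_norm_ratFunc_le (R w) (hR w hw)
      obtain ⟨M₂, hM₂, hb₂⟩ := exists_norm_partialZeta_le hp h hmult hw hk hc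
      refine ⟨M₁ * M₂, fun t => ?_⟩
      rw [norm_mul]
      exact mul_le_mul (hb₁ t) (hb₂ t) (norm_nonneg _) hM₁
  choose! M hM using h1
  refine ⟨∑ w ∈ A, M w, fun t => ?_⟩
  rw [zetaSum_eq hp h hmult (by simpa using hc)]
  exact (norm_sum_le _ _).trans (Finset.sum_le_sum fun w hw => hM w hw t)

end HasSpectralDecimation

end

/-! ### Assembly of the theorem. -/

theorem mainTheorem1 {D m : ℕ} (F : PcfFractal D m) (H : HarmonicStructure F)
    (B : Set (EuclideanSpace ℝ (Fin D))) (hB : B ⊆ F.V₀)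
    (p : ℝ[X]) (hd : 2 ≤ p.natDegree) (hp0 : p.eval 0 = 0) (hlam : 1 < scaling p)
    (hJ : ∀ z ∈ juliaSet p, z.im = 0 ∧ z.re ≤ 0)
    (A : Finset ℂ) (β : ℂ → ℕ → ℕ) (R : ℂ → RatFunc ℂ)
    (hdec : HasSpectralDecimation (H.eigenMult B) p A β R) :
    -- the Poincaré function is well defined and entire, and solves the Poincaré equation
    ((∀ z : ℂ, Tendsto (fun n : ℕ => (fun x : ℂ => aeval x p)^[n] (z / (scaling p : ℂ) ^ n))
        atTop (𝓝 (poincare p z))) ∧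
      Differentiable ℂ (poincare p) ∧ poincare p 0 = 0 ∧ deriv (poincare p) 0 = 1 ∧
      ∀ z : ℂ, poincare p ((scaling p : ℂ) * z) = aeval (poincare p z) p) ∧
    -- `ρ ≤ 1/2`, with equality only for polynomials conjugate to a Chebyshev polynomial
    (rho p ≤ 1 / 2 ∧
      (rho p = 1 / 2 → ∃ a b : ℝ, a ≠ 0 ∧
        (C a * X + C b).comp p =
          (Polynomial.Chebyshev.T ℝ (p.natDegree : ℤ)).comp (C a * X + C b))) ∧
    -- the relevant `w` are real and non-positive
    (∀ w ∈ A, (∃ k, β w k ≠ 0) → w.im = 0 ∧ w.re ≤ 0) ∧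
    ∃ Z : ℂ → ℂ → ℂ,
      -- meromorphic continuation of the partial zeta functions
      (∃ r : ℤ → ℂ, ∀ w : ℝ, w ≤ 0 →
        (∀ s : ℂ, rho p < s.re →
          Summable (partialZetaTerm p w s) ∧ Z w s = partialZeta p w s) ∧
        Meromorphic (Z w) ∧
        (∀ s : ℂ, (∀ k : ℤ, s ≠ basePole p k) → AnalyticAt ℂ (Z w) s) ∧
        (∀ k : ℤ, Tendsto (fun s => (s - basePole p k) * Z w s) (𝓝[≠] (basePole p k))
          (𝓝 (r k))) ∧
        (∀ s : ℂ, s.re < 0 →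
          IntegrableOn (fun x : ℝ => Complex.log (Psi p w x) * (x : ℂ) ^ (-s - 1))
            (Set.Ioi 0) ∧
          Z w s = s * Complex.sin (Real.pi * s) /
              (Real.pi * ((scaling p : ℂ) ^ s - (p.natDegree : ℂ))) *
            ∫ x in Set.Ioi (0 : ℝ), Complex.log (Psi p w x) * (x : ℂ) ^ (-s - 1)) ∧
        (∀ n : ℕ, w ≠ 0 ∨ n ≠ 0 → Z w (-(n : ℂ)) = 0) ∧
        (w ≠ 0 → HasDerivAt (Z w)
          (-((Real.log p.leadingCoeff / ((p.natDegree : ℝ) - 1) + Real.log (-w) : ℝ) : ℂ)) 0)) ∧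
      -- meromorphic continuation of the spectral zeta function
      (∀ s : ℂ, rho p < s.re →
        (∀ w ∈ A, ∀ c : ℂ, (R w).denom.eval c = 0 → ‖(scaling p : ℂ) ^ (-s)‖ < ‖c‖) →
        Summable (H.spectralZetaTerm B s) ∧ H.spectralZeta B s = zetaSum p A R Z s) ∧
      Meromorphic (zetaSum p A R Z) ∧
      (∀ s : ℂ, (∀ k : ℤ, s ≠ basePole p k) →
        (∀ w ∈ A, ∀ c : ℂ, (R w).denom.eval c = 0 → ∀ k : ℤ, s ≠ ratPole p c k) →
        AnalyticAt ℂ (zetaSum p A R Z) s) ∧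
      ((∀ w ∈ A, (R w).denom.eval ((p.natDegree : ℂ)⁻¹) ≠ 0) →
        ∀ k : ℤ, ((-1 : ℤ) : WithTop ℤ) ≤
          meromorphicOrderAt (zetaSum p A R Z) (basePole p k)) ∧
      -- boundedness on vertical lines
      (∀ c : ℝ, rho p < c →
        (∀ w ∈ A, ∀ t : ℝ,
          (R w).denom.eval ((scaling p : ℂ) ^ (-((c : ℂ) + t * Complex.I))) ≠ 0) →
        ∃ M : ℝ, ∀ t : ℝ, ‖zetaSum p A R Z ((c : ℂ) + t * Complex.I)‖ ≤ M) := by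
  have hp : IsDecimationPolynomial p := ⟨hd, hp0, hlam, hJ⟩
  have hmult : ∀ z, H.eigenMult B z ≠ 0 → z.im = 0 ∧ z.re ≤ 0 := fun z => H.eigenMult_ne_zero
  refine ⟨⟨fun z => (hp.tendsto_approx z).congr fun n => aeval_poincareApprox p n z,
    hp.differentiable_poincare, hp.poincare_zero,
    hp.deriv_poincare_zero, hp.poincare_scaling_mul⟩, ⟨hp.rho_le_half, fun h =>
    hp.sq_natDegree_le_scaling.2 (hp.scaling_eq_of_rho_eq_half h)⟩,
    fun w hw hk => hdec.nonpos_of_relevant hp hmult hw hk, partialZetaContinuation p,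
    ⟨fun k => zetaNumerator p 0 (basePole p k) /
      (Real.pi * (p.natDegree * Real.log (scaling p))), fun w hw => ?_⟩, fun s hs hR => ?_,
    hdec.meromorphic_zetaSum hp hmult, fun s hs hR => ?_,
    hdec.neg_one_le_order_zetaSum hp hmult, fun c hc hR =>
    hdec.exists_norm_zetaSum_le hp hmult hc hR⟩
  · have hZ : partialZetaContinuation p (w : ℂ) = continuedZeta p w := rfl
    rw [hZ]
    exact ⟨fun s hs => ⟨hp.summable_partialZetaTerm w hs, hp.continuedZeta_eq_partialZeta hw hs⟩,
      hp.meromorphic_continuedZeta hw, fun s hs => hp.analyticAt_continuedZeta hw hs,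
      hp.tendsto_sub_mul_continuedZeta hw,
      fun s hs => ⟨hp.integrableOn_log_Psi hw hs, hp.continuedZeta_eq_integral hw hs⟩,
      fun n hn => IsDecimationPolynomial.continuedZeta_neg_natCast w hn,
      fun hw0 => hp.hasDerivAt_continuedZeta_zero (lt_of_le_of_ne hw hw0)⟩
  · have h := hdec.hasSum_spectrum hp hmult hs hR
    exact ⟨h.summable, h.tsum_eq.trans (hdec.zetaSum_eq hp hmult hs).symm⟩
  · refine hdec.analyticAt_zetaSum hp hmult hs fun w hw h0 => ?_
    -- The number c = λ^(-s) is itself a root of the denominator and is non-zero, so s is one of the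
    -- excluded points belonging to c.
    have hne : (scaling p : ℂ) ^ (-s) ≠ 0 := by
      rw [Ne, Complex.cpow_eq_zero_iff, not_and_or]
      exact Or.inl hp.scaling_ne_zero
    obtain ⟨k, hk⟩ := (hp.scaling_cpow_neg_eq_iff hne).1 rfl
    exact hR w hw _ h0 k hk
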